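/- Let $X_1,X_2,\dots$ and $Y_1,Y_2,\dots$ be real random variables, all independent, the $X_i$ identically distributed and the $Y_j$ identically distributed. Put $U_{ij}=I(X_i\le Y_j)$, $\theta=P(X_1\le Y_1)=E[U_{ij}]$, and $$\sigma^2=\mathrm{Cov}[U_{11},U_{12}]+\mathrm{Cov}[U_{11},U_{21}].$$ Fix $s>0$. In the imprecise Dirichlet process (IDP) model with strength $s$, the distributions $F_X$ and $F_Y$ have independent Dirichlet process priors $Dp(s,G_1)$ and $Dp(s,G_2)$, where $G_1,G_2$ range over all probability measures on $\mathbb R$. Given $x=(x_1,\dots,x_n)$ and $y=(y_1,\dots,y_n)$, the posteriors of $F_X$ and $F_Y$ are independent Dirichlet processes with base measures $sG_1+\sum_i\delta_{x_i}$ and $sG_2+\sum_j\delta_{y_j}$. Let $\underline{\mathcal P}_n(c)$ and $\overline{\mathcal P}_n(c)$ be the infimum and the supremum over $G_1,G_2$ of the posterior probability of $\int F_X\,dF_Y>c$. Let $L_n$ (the lower distribution of the IDP rank-sum test) be the law of $\sum_{i,j=1}^n w_{1i}w_{2j}I(x_i\le y_j)$, where $(w_{10},\dots,w_{1n})$ and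 $(w_{20},\dots,w_{2n})$ are independent with law $Dir(s,1,\dots,1)$. Let $\mu_n$ and $\tau_n^2$ be the mean and the variance of $L_n$. When no data are specified, $x=(X_1,\dots,X_n)$ and $y=(Y_1,\dots,Y_n)$. Then: 1. For all $n$, all data $x,y$ and all real $c$: $\underline{\mathcal P}_n(c)=L_n((c,\infty))$. 2. $\sigma^2\ge 0$, and $\sigma^2>0$ if $0<\theta<1$. For almost every realization of the data sequences, as $n\to\infty$, the lower distribution is asymptotically normal, with mean tending to $\theta$ and variance asymptotic to $\sigma^2/n=\frac1n\mathrm{Cov}[U_{11},U_{12}]+\frac1n\mathrm{Cov}[U_{11},U_{21}]$. That is, if $V_n\sim L_n$ then $\sqrt n\,(V_n-\mu_n)$ converges in distribution to $N(0,\sigma^2)$, $\mu_n\to\theta$, and $n\tau_n^2\to\sigma^2$. Moreover $\sqrt n\,(\mu_n-U/n^2)\to0$, where $U=\sum_{i,j\le n}U_{ij}$ is the Mann–Whitney statistic. 3. The Mann–Whitney statistic has the same normal limit: $\sqrt n\,(U/n^2-\theta)$ converges in distribution to $N(0,\sigma^2)$ under the law of the data. 4. The IDP test of $P(X\le Y)\le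 c$ against $P(X\le Y)>c$ is consistent. Almost surely, $\underline{\mathcal P}_n(c)$ and $\overline{\mathcal P}_n(c)$ both tend to $1$ for every $c<\theta$, and both tend to $0$ for every $c>\theta$. At the boundary $c=\theta$, if $0<\theta<1$ then for every $\gamma\in(0,1)$ the probabilities, under the law of the data, of $\underline{\mathcal P}_n(\theta)>1-\gamma$ and of $\overline{\mathcal P}_n(\theta)>1-\gamma$ both tend to $\gamma$. -/

import Mathlib

open MeasureTheory ProbabilityTheory Filter Topology
open scoped NNReal ENNReal

noncomputable section

/-- The law of a Gamma variable with shape `a` and rate `1`; for `a = 0` it is, as usual in the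
definition of the Dirichlet distribution, the point mass at `0`. -/
def gammaLaw (a : ℝ) : Measure ℝ :=
  if 0 < a then gammaMeasure a 1 else Measure.dirac 0

instance gammaLaw_isProbabilityMeasure (a : ℝ) : IsProbabilityMeasure (gammaLaw a) := by
  unfold gammaLaw
  split_ifs with h
  · exact isProbabilityMeasure_gammaMeasure h one_pos
  · infer_instance

/-- The Dirichlet distribution `Dir(a)` with parameters `a i ≥ 0`, not all zero: the law of
independent `Gamma(a i, 1)` variables divided by their sum. -/
def dirichlet {ι : Type*} [Fintype ι] (a : ι → ℝ) : Measure (ι → ℝ) :=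
  (Measure.pi fun i => gammaLaw (a i)).map fun g i => g i / ∑ j, g j

instance dirichlet_isProbabilityMeasure {ι : Type*} [Fintype ι] (a : ι → ℝ) :
    IsProbabilityMeasure (dirichlet a) := by
  unfold dirichlet
  exact Measure.isProbabilityMeasure_map (by fun_prop)

/-- `μ` is the law of a Dirichlet process with (finite, nonzero) base measure `α`: a random
probability measure `Q` whose vector of masses on every finite measurable partition `B` has
distribution `Dir(α(B 0), …, α(B (k-1)))`. The process `Dp(s, G)` has base measure `s • G`. -/
structure IsDirichletProcess {𝕏 : Type*} [MeasurableSpace 𝕏] (α : Measure 𝕏)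
    (μ : Measure (Measure 𝕏)) : Prop where
  isProbabilityMeasure : IsProbabilityMeasure μ
  ae_isProbabilityMeasure : ∀ᵐ Q ∂μ, IsProbabilityMeasure Q
  map_partition : ∀ (k : ℕ) (B : Fin k → Set 𝕏), (∀ i, MeasurableSet (B i)) →
    Pairwise (fun i j => Disjoint (B i) (B j)) → (⋃ i, B i) = Set.univ →
    μ.map (fun Q i => Q.real (B i)) = dirichlet fun i => α.real (B i)

/-- Base measure of the posterior Dirichlet process: prior `Dp(s, G)`, observations `x`. -/
def posteriorBase (s : ℝ) (G : Measure ℝ) {n : ℕ} (x : Fin n → ℝ) : Measure ℝ :=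
  ENNReal.ofReal s • G + ∑ i, Measure.dirac (x i)

/-- `P(X ≤ Y) = ∫ F_X dF_Y` for independent `X ∼ Q₁`, `Y ∼ Q₂`. -/
def probLE (Q₁ Q₂ : Measure ℝ) : ℝ := ∫ y, Q₁.real (Set.Iic y) ∂Q₂

/-- All posterior probabilities of the event `P(X ≤ Y) > c` given the samples `x` and `y`, when
`F_X` and `F_Y` have independent priors `Dp(s, G₁)` and `Dp(s, G₂)`, and `G₁`, `G₂` range over all
probability measures on the line. -/
def posteriorProbs (s : ℝ) {n : ℕ} (x y : Fin n → ℝ) (c : ℝ) : Set ℝ :=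
  {p | ∃ G₁ G₂ : Measure ℝ, IsProbabilityMeasure G₁ ∧ IsProbabilityMeasure G₂ ∧
    ∃ μ₁ μ₂ : Measure (Measure ℝ),
      IsDirichletProcess (posteriorBase s G₁ x) μ₁ ∧
      IsDirichletProcess (posteriorBase s G₂ y) μ₂ ∧
      p = (μ₁.prod μ₂).real {Q | c < probLE Q.1 Q.2}}

/-- Lower posterior probability of `P(X ≤ Y) > c` in the imprecise Dirichlet process model. -/
def lowerProb (s : ℝ) {n : ℕ} (x y : Fin n → ℝ) (c : ℝ) : ℝ := sInf (posteriorProbs s x y c)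

/-- Upper posterior probability of `P(X ≤ Y) > c` in the imprecise Dirichlet process model. -/
def upperProb (s : ℝ) {n : ℕ} (x y : Fin n → ℝ) (c : ℝ) : ℝ := sSup (posteriorProbs s x y c)

/-- The indicator `I_{[a,∞)}(b)` of `a ≤ b`. -/
def leInd (a b : ℝ) : ℝ := (Set.Ici a).indicator 1 b

/-- The law `Dir(s, 1, …, 1)` of the weights `(w₀, w₁, …, wₙ)`. -/
def weightLaw (s : ℝ) (n : ℕ) : Measure (Fin (n + 1) → ℝ) :=
  dirichlet (Fin.cons s fun _ => 1)

/-- The weighted two-sample statistic `∑ᵢⱼ w₁ᵢ w₂ⱼ I(xᵢ ≤ yⱼ)`, `i, j = 1, …, n`; the weights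
`w₁₀`, `w₂₀` do not enter. -/
def weightedRankSum {n : ℕ} (x y : Fin n → ℝ) (w : (Fin (n + 1) → ℝ) × (Fin (n + 1) → ℝ)) : ℝ :=
  ∑ i : Fin n, ∑ j : Fin n, w.1 i.succ * w.2 j.succ * leInd (x i) (y j)

/-- The lower distribution of the rank-sum test given the samples `x`, `y`: the law of
`∑ᵢⱼ w₁ᵢ w₂ⱼ I(xᵢ ≤ yⱼ)` under independent weight vectors with law `Dir(s, 1, …, 1)`. -/
def lowerDist (s : ℝ) {n : ℕ} (x y : Fin n → ℝ) : Measure ℝ :=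
  ((weightLaw s n).prod (weightLaw s n)).map (weightedRankSum x y)

/-- The normalized Mann–Whitney statistic `U / n²`. -/
def mannWhitney {n : ℕ} (x y : Fin n → ℝ) : ℝ :=
  (∑ i : Fin n, ∑ j : Fin n, leInd (x i) (y j)) / (n : ℝ) ^ 2

instance lowerDist_isProbabilityMeasure (s : ℝ) {n : ℕ} (x y : Fin n → ℝ) :
    IsProbabilityMeasure (lowerDist s x y) := by
  unfold lowerDist weightLaw
  exact Measure.isProbabilityMeasure_map
    (Measurable.aemeasurable (by unfold weightedRankSum; fun_prop))

/-- The first `n` terms of a sequence of random variables, evaluated at `ω`. -/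
def sample {Ω : Type*} (X : ℕ → Ω → ℝ) (n : ℕ) (ω : Ω) : Fin n → ℝ := fun i => X i ω

end

/-! A Dirichlet vector is a normalized vector of independent Gamma variables, so merging coordinates
adds parameters (`map_fiberSum_dirichlet`). Split the posterior masses into one part of shape 1 per
observation and prior parts of total shape `s`. Merging these parts by location gives the posterior
masses of the observed values; merging all prior parts gives `Dir(s, 1, …, 1)`. On this common space
the posterior mass of each observed value dominates the total weight of the observations there
(`exists_coupling_posterior`). The kernel `I(x ≤ y)` is nonnegative, so under every prior `∫ F_X
dF_Y` stochastically dominates the law `L_n`. Equality occurs when the prior mass of `X` lies to the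
right of everything and that of `Y` to the left (`exists_mem_posteriorProbs_le`). The same
domination for `1 - I(x ≤ y)` bounds the upper probability by the tail of the rank sum plus the two
prior weights. These weights are of order `1/n`, invisible at the scale `1/√n`, so lower and upper
probabilities have the same limits.

For fixed data, write the weights through two infinite Gamma sequences and centre every variable at
1. The unnormalized rank sum becomes a linear part, a bilinear part and prior terms
(`weighted_rank_sum_decomposition`). The bilinear part has second moment at most `n²` and is
negligible against `n^(3/2)`; the linear part has uniformly small coefficients and obeys a central
limit theorem (`tendstoInDistribution_weighted_sum`); the normalization tends to 1 by the strong
law. The limit depends on the data only through `U/n²` and the sums of squared row and column sums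
over `n³`. These converge almost surely (`TwoSample.ae_tendsto`), and the limiting variance is `Var
κ(X) + Var ψ(Y) = σ²` with `κ(a) = P(a ≤ Y)`, `ψ(b) = P(X ≤ b)`.

The Mann–Whitney statistic has the same limit because its Hoeffding projection is the sum of
`κ(X_i)` and `ψ(Y_j)` up to a degenerate kernel (`TwoSample.tendstoInDistribution_mean`). At `c = θ`
the posterior probability is the tail of the standardized `L_n` at `-√n (μ_n - θ)`. The tail
function converges to a Gaussian tail and the argument is asymptotically Gaussian with the same
variance, so the probability is asymptotically uniform (`tendsto_measureReal_tail_gt`). -/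

/-! ### Gamma laws and their convolution -/

/-- Integration against a Gamma law with unit rate, as an integral over the half line. -/
lemma integral_gammaMeasure_one {a : ℝ} (ha : 0 < a) (f : ℝ → ℝ) :
    ∫ x, f x ∂(gammaMeasure a 1) =
      ∫ x in Set.Ioi 0, (x ^ (a - 1) * Real.exp (-x) / Real.Gamma a) * f x := by
  rw [gammaMeasure, integral_withDensity_eq_integral_toReal_smul (by unfold gammaPDF; fun_prop)
    (by simp [gammaPDF])]
  rw [← integral_Ici_eq_integral_Ioi, ← integral_indicator measurableSet_Ici]
  congr 1 with x
  by_cases hx : 0 ≤ x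
  · rw [Set.indicator_of_mem (by exact hx), gammaPDF,
      ENNReal.toReal_ofReal (gammaPDFReal_nonneg ha one_pos x), gammaPDFReal, if_pos hx]
    simp only [Real.one_rpow, one_mul, smul_eq_mul]
    ring
  · rw [Set.indicator_of_notMem (by simpa using hx), gammaPDF,
      ENNReal.toReal_ofReal (gammaPDFReal_nonneg ha one_pos x), gammaPDFReal, if_neg hx, zero_smul]

/-- The value 0 for `t ≥ 1` is that of a Bochner integral which does not exist: there the
exponential factor is at least 1, and `x ^ (a - 1)` is not integrable on the half line. Recording it
makes the function determine its own domain of integrability. -/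
lemma mgf_gammaMeasure_one {a : ℝ} (ha : 0 < a) (t : ℝ) :
    mgf id (gammaMeasure a 1) t = if t < 1 then (1 - t) ^ (-a) else 0 := by
  simp only [mgf, id]
  rw [integral_gammaMeasure_one ha]
  have h0 : ∀ x : ℝ, (x ^ (a - 1) * Real.exp (-x) / Real.Gamma a) * Real.exp (t * x) =
      (Real.Gamma a)⁻¹ * (x ^ (a - 1) * Real.exp (-((1 - t) * x))) := fun x => by
    rw [show -((1 - t) * x) = -x + t * x by ring, Real.exp_add]; ring
  simp_rw [h0]
  split_ifs with ht
  · rw [integral_const_mul, Real.integral_rpow_mul_exp_neg_mul_Ioi ha (by linarith),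
      mul_comm, mul_assoc, mul_inv_cancel₀ (Real.Gamma_pos_of_pos ha).ne', mul_one,
      one_div, Real.inv_rpow (by linarith), Real.rpow_neg (by linarith)]
  · refine integral_undef fun hint => not_integrableOn_Ioi_rpow (a - 1) ?_
    have h1 : IntegrableOn (fun x : ℝ => x ^ (a - 1) * Real.exp (-((1 - t) * x))) (Set.Ioi 0) := by
      refine (hint.const_mul (Real.Gamma a)).congr (ae_of_all _ fun x => ?_)
      field_simp [(Real.Gamma_pos_of_pos ha).ne']
    refine Integrable.mono' h1 (by fun_prop) ?_
    filter_upwards [ae_restrict_mem measurableSet_Ioi] with x hx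
    have hx : 0 < x := hx
    rw [Real.norm_of_nonneg (by positivity)]
    refine le_mul_of_one_le_right (by positivity) (Real.one_le_exp ?_)
    nlinarith

/-- A moment generating function is positive exactly where the exponential is integrable, so the
domain can be read off from the closed form. -/
lemma integrableExpSet_gammaMeasure_one {a : ℝ} (ha : 0 < a) :
    integrableExpSet id (gammaMeasure a 1) = Set.Iio 1 := by
  have := isProbabilityMeasure_gammaMeasure ha one_pos
  ext t
  simp only [integrableExpSet, Set.mem_ofPred_eq, Set.mem_Iio]
  rw [← mgf_pos_iff, mgf_gammaMeasure_one ha]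
  split_ifs with h
  · simpa [h] using Real.rpow_pos_of_pos (by linarith) _
  · simp [h]

/-- The moment generating functions multiply. Since they agree everywhere, including the value 0
outside the domain, their complex extensions agree on the strip over the interior of the domain;
this strip contains the imaginary axis, where they are characteristic functions. -/
lemma gammaMeasure_conv_gammaMeasure {a b : ℝ} (ha : 0 < a) (hb : 0 < b) :
    gammaMeasure a 1 ∗ gammaMeasure b 1 = gammaMeasure (a + b) 1 := by
  have := isProbabilityMeasure_gammaMeasure ha one_pos
  have := isProbabilityMeasure_gammaMeasure hb one_pos
  have := isProbabilityMeasure_gammaMeasure (add_pos ha hb) one_pos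
  have hmgf : mgf id (gammaMeasure a 1 ∗ gammaMeasure b 1) = mgf id (gammaMeasure (a + b) 1) := by
    ext t
    have h1 : mgf id (gammaMeasure a 1 ∗ gammaMeasure b 1) t =
        mgf id (gammaMeasure a 1) t * mgf id (gammaMeasure b 1) t := by
      rw [Measure.conv, mgf_id_map (by fun_prop)]
      simp only [mgf, id, mul_add, Real.exp_add]
      exact integral_prod_mul (fun x : ℝ => Real.exp (t * x)) (fun x : ℝ => Real.exp (t * x))
    rw [h1]
    simp only [mgf_gammaMeasure_one ha, mgf_gammaMeasure_one hb,
        mgf_gammaMeasure_one (add_pos ha hb)]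
    split_ifs with ht
    · rw [← Real.rpow_add (by linarith)]; ring_nf
    · simp
  have hset := integrableExpSet_eq_of_mgf hmgf
  have heq := eqOn_complexMGF_of_mgf hmgf
  refine Measure.ext_of_charFun (funext fun t => ?_)
  rw [← complexMGF_id_mul_I, ← complexMGF_id_mul_I]
  refine heq ?_
  simp [hset, integrableExpSet_gammaMeasure_one (add_pos ha hb)]

lemma gammaLaw_of_pos {a : ℝ} (ha : 0 < a) : gammaLaw a = gammaMeasure a 1 := if_pos ha

lemma gammaLaw_zero : gammaLaw 0 = Measure.dirac 0 := if_neg (lt_irrefl 0)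

lemma gammaLaw_conv_gammaLaw {a b : ℝ} (ha : 0 ≤ a) (hb : 0 ≤ b) :
    gammaLaw a ∗ gammaLaw b = gammaLaw (a + b) := by
  rcases ha.eq_or_lt with rfl | ha
  · rw [gammaLaw_zero, Measure.dirac_zero_conv, zero_add]
  rcases hb.eq_or_lt with rfl | hb
  · rw [gammaLaw_zero, Measure.conv_dirac_zero, add_zero]
  rw [gammaLaw_of_pos ha, gammaLaw_of_pos hb, gammaLaw_of_pos (add_pos ha hb),
    gammaMeasure_conv_gammaMeasure ha hb]

lemma ae_nonneg_gammaLaw (a : ℝ) : ∀ᵐ x ∂(gammaLaw a), 0 ≤ x := by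
  unfold gammaLaw
  split_ifs with h
  · rw [gammaMeasure, ae_withDensity_iff (by unfold gammaPDF; fun_prop)]
    refine ae_of_all _ fun x hx => ?_
    by_contra! hneg
    exact hx (gammaPDF_of_neg hneg)
  · rw [ae_dirac_iff measurableSet_Ici]

lemma ae_pos_gammaLaw {a : ℝ} (ha : 0 < a) : ∀ᵐ x ∂(gammaLaw a), 0 < x := by
  have h0 : ∀ᵐ x ∂(gammaLaw a), x ≠ 0 := by
    rw [gammaLaw_of_pos ha, gammaMeasure]
    exact (withDensity_absolutelyContinuous _ _).ae_le (Measure.ae_ne volume 0)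
  filter_upwards [ae_nonneg_gammaLaw a, h0] with x h1 h2 using lt_of_le_of_ne h1 h2.symm

/-! ### Aggregation for Gamma and Dirichlet laws -/

/-- Summing independent Gamma variables over the fibers of a map adds their shapes. -/
lemma map_fiberSum_pi_gammaLaw {ι κ : Type*} [Fintype ι] [Fintype κ] [DecidableEq κ]
    (f : ι → κ) {a : ι → ℝ} (ha : ∀ i, 0 ≤ a i) :
    (Measure.pi fun i => gammaLaw (a i)).map (fun g k => ∑ i with f i = k, g i) =
      Measure.pi fun k => gammaLaw (∑ i with f i = k, a i) := by
  classical
  let F : (ι → ℝ) →L[ℝ] (κ → ℝ) :=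
    ContinuousLinearMap.pi fun k => ∑ i with f i = k, ContinuousLinearMap.proj i
  have hF : (fun g : ι → ℝ => fun k => ∑ i with f i = k, g i) = F := by
    ext g k; simp [F]
  rw [hF]
  have : IsProbabilityMeasure ((Measure.pi fun i => gammaLaw (a i)).map F) :=
    Measure.isProbabilityMeasure_map (by fun_prop)
  refine Measure.ext_of_charFunDual (funext fun L => ?_)
  rw [charFunDual_map, charFunDual_pi, charFunDual_pi]
  have hsingle : ∀ i, (L.comp F).comp (ContinuousLinearMap.single ℝ (fun _ : ι => ℝ) i) =
      L.comp (ContinuousLinearMap.single ℝ (fun _ : κ => ℝ) (f i)) := by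
    intro i
    ext
    simp only [ContinuousLinearMap.comp_apply]
    congr 1
    ext k
    simp [F, Pi.single_apply, eq_comm]
  simp only [hsingle]
  rw [← Finset.prod_fiberwise (s := Finset.univ) (g := f)]
  refine Finset.prod_congr rfl fun k _ => ?_
  -- Empty fibers are allowed: shape 0 is the point mass at 0, whose characteristic function is the
  -- empty product.
  have key : ∀ s : Finset ι, ∀ ℓ : StrongDual ℝ ℝ,
      ∏ i ∈ s, charFunDual (gammaLaw (a i)) ℓ = charFunDual (gammaLaw (∑ i ∈ s, a i)) ℓ := by
    intro s ℓ
    induction s using Finset.induction_on with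
    | empty => simp [gammaLaw_zero, charFunDual_apply]
    | insert i s hi ih =>
      rw [Finset.prod_insert hi, Finset.sum_insert hi, ih,
        ← gammaLaw_conv_gammaLaw (ha i) (Finset.sum_nonneg fun j _ => ha j), charFunDual_conv]
  rw [← key]
  refine Finset.prod_congr rfl fun i hi => ?_
  rw [(Finset.mem_filter.1 hi).2]

lemma measurable_dirichlet_normalize {ι : Type*} [Fintype ι] :
    Measurable fun (g : ι → ℝ) i => g i / ∑ j, g j := by fun_prop

/-- The aggregation property of the Dirichlet distribution. -/
lemma map_fiberSum_dirichlet {ι κ : Type*} [Fintype ι] [Fintype κ] [DecidableEq κ]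
    (f : ι → κ) {a : ι → ℝ} (ha : ∀ i, 0 ≤ a i) :
    (dirichlet a).map (fun w k => ∑ i with f i = k, w i) =
      dirichlet fun k => ∑ i with f i = k, a i := by
  rw [dirichlet, dirichlet, ← map_fiberSum_pi_gammaLaw f ha, Measure.map_map (by fun_prop)
    measurable_dirichlet_normalize, Measure.map_map measurable_dirichlet_normalize (by fun_prop)]
  congr 1
  ext g k
  simp only [Function.comp_apply, Finset.sum_div]
  -- Merging coordinates preserves the total, so it commutes with the normalization.
  rw [Finset.sum_fiberwise]

lemma ae_nonneg_pi_gammaLaw {ι : Type*} [Fintype ι] (a : ι → ℝ) :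
    ∀ᵐ g ∂(Measure.pi fun i => gammaLaw (a i)), ∀ i, 0 ≤ g i :=
  ae_all_iff.2 fun i => Measure.tendsto_eval_ae_ae.eventually (ae_nonneg_gammaLaw (a i))

lemma ae_nonneg_dirichlet {ι : Type*} [Fintype ι] (a : ι → ℝ) :
    ∀ᵐ w ∂(dirichlet a), ∀ i, 0 ≤ w i := by
  rw [dirichlet, ae_map_iff measurable_dirichlet_normalize.aemeasurable (by measurability)]
  filter_upwards [ae_nonneg_pi_gammaLaw a] with g hg i
  exact div_nonneg (hg i) (Finset.sum_nonneg fun j _ => hg j)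

lemma ae_sum_eq_one_dirichlet {ι : Type*} [Fintype ι] {a : ι → ℝ} (ha : ∃ i, 0 < a i) :
    ∀ᵐ w ∂(dirichlet a), ∑ i, w i = 1 := by
  obtain ⟨i, hi⟩ := ha
  rw [dirichlet, ae_map_iff measurable_dirichlet_normalize.aemeasurable
    (measurableSet_eq_fun (by fun_prop) (by fun_prop))]
  filter_upwards [ae_nonneg_pi_gammaLaw a,
    Measure.tendsto_eval_ae_ae.eventually (ae_pos_gammaLaw hi)] with g hg hgi
  rw [← Finset.sum_div, div_self]
  exact (Finset.sum_pos' (fun j _ => hg j) ⟨i, Finset.mem_univ i, hgi⟩).ne'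

/-! ### Moments of Beta and Dirichlet weights -/

/-- Size biasing a Gamma law raises its shape by one. -/
lemma integral_mul_gammaMeasure_one {a : ℝ} (ha : 0 < a) (f : ℝ → ℝ) :
    ∫ x, x * f x ∂(gammaMeasure a 1) = a * ∫ x, f x ∂(gammaMeasure (a + 1) 1) := by
  rw [integral_gammaMeasure_one ha, integral_gammaMeasure_one (by linarith), ← integral_const_mul]
  refine setIntegral_congr_fun measurableSet_Ioi fun x hx => ?_
  have hx : 0 < x := hx
  have hΓ := (Real.Gamma_pos_of_pos ha).ne'
  rw [Real.Gamma_add_one ha.ne', show a + 1 - 1 = (a - 1) + 1 by ring, Real.rpow_add_one hx.ne']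
  field_simp

lemma ae_pos_gammaMeasure_one {a : ℝ} (ha : 0 < a) : ∀ᵐ x ∂(gammaMeasure a 1), 0 < x :=
  gammaLaw_of_pos ha ▸ ae_pos_gammaLaw ha

/-- Size biasing applied to `x⁻¹` makes the left side the total mass 1. -/
lemma integral_inv_gammaMeasure_one {c : ℝ} (hc : 0 < c) :
    ∫ x, x⁻¹ ∂(gammaMeasure (c + 1) 1) = c⁻¹ := by
  have := isProbabilityMeasure_gammaMeasure hc one_pos
  have h := integral_mul_gammaMeasure_one hc (fun x => x⁻¹)
  rw [integral_congr_ae (g := fun _ => (1 : ℝ))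
    ((ae_pos_gammaMeasure_one hc).mono fun x hx => mul_inv_cancel₀ hx.ne')] at h
  simp only [integral_const, probReal_univ, smul_eq_mul, mul_one] at h
  exact eq_inv_of_mul_eq_one_right h.symm

lemma integral_inv_sq_gammaMeasure_one {c : ℝ} (hc : 0 < c) :
    ∫ x, (x ^ 2)⁻¹ ∂(gammaMeasure (c + 2) 1) = (c * (c + 1))⁻¹ := by
  have h := integral_mul_gammaMeasure_one (show 0 < c + 1 by linarith) (fun x => (x ^ 2)⁻¹)
  rw [integral_congr_ae (g := fun x : ℝ => x⁻¹)
    ((ae_pos_gammaMeasure_one (by linarith)).mono fun x hx => by field_simp),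
    integral_inv_gammaMeasure_one hc, show c + 1 + 1 = c + 2 by ring] at h
  rw [mul_inv, h]
  field_simp

/-- The first two moments of a Beta variable, as a ratio of Gamma variables. -/
lemma integral_beta_ratio {a b : ℝ} (ha : 0 < a) (hb : 0 < b) :
    ∫ p, p.1 / (p.1 + p.2) ∂((gammaMeasure a 1).prod (gammaMeasure b 1)) = a / (a + b) ∧
    ∫ p, (p.1 / (p.1 + p.2)) ^ 2 ∂((gammaMeasure a 1).prod (gammaMeasure b 1)) =
      a * (a + 1) / ((a + b) * (a + b + 1)) := by
  have := isProbabilityMeasure_gammaMeasure ha one_pos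
  have := isProbabilityMeasure_gammaMeasure hb one_pos
  have ha1 : 0 < a + 1 := by linarith
  have ha2 : 0 < a + 2 := by linarith
  have := isProbabilityMeasure_gammaMeasure ha1 one_pos
  have := isProbabilityMeasure_gammaMeasure ha2 one_pos
  have hpos : ∀ᵐ p ∂((gammaMeasure a 1).prod (gammaMeasure b 1)), 0 < p.1 ∧ 0 < p.2 :=
    (Measure.quasiMeasurePreserving_fst.ae (ae_pos_gammaMeasure_one ha)).and
      (Measure.quasiMeasurePreserving_snd.ae (ae_pos_gammaMeasure_one hb))
  have hbd : ∀ p : ℝ × ℝ, 0 < p.1 ∧ 0 < p.2 → 0 ≤ p.1 / (p.1 + p.2) ∧ p.1 / (p.1 + p.2) ≤ 1 :=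
    fun p hp => ⟨div_nonneg hp.1.le (by linarith), div_le_one_of_le₀ (by linarith) (by linarith)⟩
  have hint1 : Integrable (fun p : ℝ × ℝ => p.1 / (p.1 + p.2))
      ((gammaMeasure a 1).prod (gammaMeasure b 1)) := by
    refine Integrable.of_bound (Measurable.aestronglyMeasurable (by fun_prop)) 1
      (hpos.mono fun p hp => ?_)
    rw [Real.norm_of_nonneg (hbd p hp).1]; exact (hbd p hp).2
  have hint2 : Integrable (fun p : ℝ × ℝ => (p.1 / (p.1 + p.2)) ^ 2)
      ((gammaMeasure a 1).prod (gammaMeasure b 1)) := by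
    refine Integrable.of_bound (Measurable.aestronglyMeasurable (by fun_prop)) 1
      (hpos.mono fun p hp => ?_)
    rw [Real.norm_of_nonneg (by positivity)]
    exact pow_le_one₀ (hbd p hp).1 (hbd p hp).2
  constructor
  · rw [integral_prod _ hint1]
    simp only [div_eq_mul_inv, integral_const_mul]
    -- Size biasing absorbs the numerator into the shape; what remains is the mean of the reciprocal
    -- of a sum of two independent Gamma variables, which is again Gamma. The second moment absorbs
    -- the numerator twice.
    rw [integral_mul_gammaMeasure_one ha (fun x => ∫ y, (x + y)⁻¹ ∂(gammaMeasure b 1))]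
    have hval := integral_inv_gammaMeasure_one (add_pos ha hb)
    rw [show a + b + 1 = a + 1 + b by ring] at hval
    -- A nonzero Bochner integral forces integrability.
    have hi : Integrable (fun x : ℝ => x⁻¹) (gammaMeasure (a + 1 + b) 1) :=
      .of_integral_ne_zero (by rw [hval]; positivity)
    have := isProbabilityMeasure_gammaMeasure (add_pos ha1 hb) one_pos
    rw [← gammaMeasure_conv_gammaMeasure ha1 hb] at hi hval
    rw [← integral_conv hi, hval]
  · rw [integral_prod _ hint2]
    simp only [div_pow]
    simp only [div_eq_mul_inv, integral_const_mul]
    have e : ∀ x : ℝ, x ^ 2 * ∫ y, ((x + y) ^ 2)⁻¹ ∂(gammaMeasure b 1) =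
        x * (x * ∫ y, ((x + y) ^ 2)⁻¹ ∂(gammaMeasure b 1)) := fun x => by ring
    simp only [e]
    rw [integral_mul_gammaMeasure_one ha
      (fun x => x * ∫ y, ((x + y) ^ 2)⁻¹ ∂(gammaMeasure b 1)),
      integral_mul_gammaMeasure_one ha1 (fun x => ∫ y, ((x + y) ^ 2)⁻¹ ∂(gammaMeasure b 1)),
      show a + 1 + 1 = a + 2 by ring]
    have hval := integral_inv_sq_gammaMeasure_one (add_pos ha hb)
    rw [show a + b + 2 = a + 2 + b by ring] at hval
    have hi : Integrable (fun x : ℝ => (x ^ 2)⁻¹) (gammaMeasure (a + 2 + b) 1) :=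
      .of_integral_ne_zero (by rw [hval]; positivity)
    rw [← gammaMeasure_conv_gammaMeasure ha2 hb] at hi hval
    rw [← integral_conv hi, hval]
    ring

/-- The first two moments of the total weight of a block of coordinates under a Dirichlet law. -/
lemma integral_sum_dirichlet {ι : Type*} [Fintype ι] [DecidableEq ι] {a : ι → ℝ}
    (ha : ∀ i, 0 ≤ a i) (S : Finset ι) (hS : 0 < ∑ i ∈ S, a i) (hS' : 0 < ∑ i ∈ Sᶜ, a i) :
    ∫ w, ∑ i ∈ S, w i ∂(dirichlet a) = (∑ i ∈ S, a i) / ∑ i, a i ∧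
    ∫ w, (∑ i ∈ S, w i) ^ 2 ∂(dirichlet a) =
      (∑ i ∈ S, a i) * (∑ i ∈ S, a i + 1) / ((∑ i, a i) * (∑ i, a i + 1)) := by
  -- Merging into the block and its complement leaves two Gamma variables; both shapes are positive,
  -- so the ratio is a Beta variable.
  let f : ι → Fin 2 := fun i => if i ∈ S then 0 else 1
  have h0 : ∀ g : ι → ℝ, ∑ i with f i = 0, g i = ∑ i ∈ S, g i := fun g => by
    congr 1; ext i; by_cases h : i ∈ S <;> simp [f, h]
  have h1 : ∀ g : ι → ℝ, ∑ i with f i = 1, g i = ∑ i ∈ Sᶜ, g i := fun g => by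
    congr 1; ext i; by_cases h : i ∈ S <;> simp [f, h]
  have hmap := map_fiberSum_dirichlet f ha
  have key : ∀ φ : ℝ → ℝ, Measurable φ → ∫ w, φ (∑ i ∈ S, w i) ∂(dirichlet a) =
      ∫ p, φ (p.1 / (p.1 + p.2)) ∂((gammaMeasure (∑ i ∈ S, a i) 1).prod
        (gammaMeasure (∑ i ∈ Sᶜ, a i) 1)) := by
    intro φ hφ
    have hm : Measurable fun u : Fin 2 → ℝ => φ (u 0) := hφ.comp (measurable_pi_apply 0)
    have e1 : ∫ w, φ (∑ i ∈ S, w i) ∂(dirichlet a) = ∫ u, φ (u 0) ∂((dirichlet a).map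
        (fun w (k : Fin 2) => ∑ i with f i = k, w i)) := by
      rw [integral_map (by fun_prop) hm.aestronglyMeasurable]
      simp only [h0]
    rw [e1, hmap, dirichlet, integral_map (by fun_prop)
      hm.aestronglyMeasurable]
    have hmp := measurePreserving_piFinTwo
      (fun k : Fin 2 => gammaLaw (∑ i with f i = k, a i))
    have e2 := hmp.integral_comp' (g := fun p : ℝ × ℝ => φ (p.1 / (p.1 + p.2)))
    simp only [h0, h1, gammaLaw_of_pos hS, gammaLaw_of_pos hS'] at e2
    rw [← e2]
    simp [Fin.sum_univ_two, MeasurableEquiv.piFinTwo]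
  have hsum : ∑ i, a i = ∑ i ∈ S, a i + ∑ i ∈ Sᶜ, a i := (Finset.sum_add_sum_compl S a).symm
  rw [hsum]
  have hb := integral_beta_ratio hS hS'
  exact ⟨(key id measurable_id).trans hb.1, (key (fun x => x ^ 2) (by fun_prop)).trans hb.2⟩

/-! ### Coupling of posterior masses with observation weights -/

lemma measurable_measureReal_apply {𝕏 : Type*} [MeasurableSpace 𝕏] {B : Set 𝕏}
    (hB : MeasurableSet B) : Measurable fun Q : Measure 𝕏 => Q.real B :=
  (Measure.measurable_coe hB).ennreal_toReal

/-- Reindexing is aggregation along a bijection, whose fibers are singletons. The form with an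
arbitrary finite index type allows `Option`, with one cell for the complement of the marked points.
-/
lemma IsDirichletProcess.map_fintype_partition {𝕏 : Type*} [MeasurableSpace 𝕏] {α : Measure 𝕏}
    {μ : Measure (Measure 𝕏)} (h : IsDirichletProcess α μ) {κ : Type*} [Fintype κ]
    (B : κ → Set 𝕏) (hB : ∀ k, MeasurableSet (B k))
    (hdisj : Pairwise fun i j => Disjoint (B i) (B j)) (hcover : (⋃ k, B k) = Set.univ) :
    μ.map (fun Q k => Q.real (B k)) = dirichlet fun k => α.real (B k) := by
  classical
  let e := Fintype.equivFin κ
  have h1 := h.map_partition _ (fun i => B (e.symm i)) (fun i => hB _)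
    (fun i j hij => hdisj (fun h => hij (e.symm.injective h)))
    (by rw [← hcover]; exact e.symm.surjective.iUnion_comp B)
  have h2 := map_fiberSum_dirichlet e.symm
    (a := fun i => α.real (B (e.symm i))) (fun i => measureReal_nonneg)
  have h3 : ∀ (k : κ) (u : Fin (Fintype.card κ) → ℝ),
      ∑ i with e.symm i = k, u i = u (e k) := fun k u => by
    rw [Finset.sum_eq_single_of_mem (e k) (by simp)]
    intro b hb hne
    exact absurd (by rw [← (Finset.mem_filter.1 hb).2, Equiv.apply_symm_apply]) hne
  rw [← h1, Measure.map_map (by fun_prop)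
    (measurable_pi_lambda _ fun i => measurable_measureReal_apply (hB _))] at h2
  simp only [h3, Equiv.symm_apply_apply] at h2
  rw [← h2]
  congr 1
  ext Q k
  simp

/-- Sums over sample points regrouped by value. -/
lemma sum_fiberSum_mul {ι κ ι' κ' : Type*} [Fintype ι] [Fintype κ] [DecidableEq κ] [Fintype ι']
    [Fintype κ'] [DecidableEq κ'] (r : ι → κ) (r' : ι' → κ') (w : ι → ℝ) (w' : ι' → ℝ)
    (k : κ → κ' → ℝ) :
    ∑ a, ∑ b, (∑ i with r i = a, w i) * (∑ j with r' j = b, w' j) * k a b =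
      ∑ i, ∑ j, w i * w' j * k (r i) (r' j) := by
  have h1 : ∀ a b, (∑ i with r i = a, w i) * (∑ j with r' j = b, w' j) * k a b =
      ∑ i with r i = a, ∑ j with r' j = b, w i * w' j * k (r i) (r' j) := fun a b => by
    rw [Finset.sum_mul_sum, Finset.sum_mul]
    refine Finset.sum_congr rfl fun i hi => ?_
    rw [Finset.sum_mul]
    refine Finset.sum_congr rfl fun j hj => ?_
    rw [(Finset.mem_filter.1 hi).2, (Finset.mem_filter.1 hj).2]
  simp only [h1]
  rw [← Finset.sum_fiberwise (s := Finset.univ) (g := r)]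
  refine Finset.sum_congr rfl fun a _ => ?_
  rw [Finset.sum_comm]
  refine Finset.sum_congr rfl fun i _ => ?_
  rw [Finset.sum_fiberwise]

/-- The masses of the posterior Dirichlet process at the observed values dominate the Dirichlet
weights of the observations. -/
lemma exists_coupling_posterior {s : ℝ} (hs : 0 < s) {n : ℕ} (x : Fin n → ℝ) {G : Measure ℝ}
    [IsProbabilityMeasure G] {μ : Measure (Measure ℝ)}
    (hμ : IsDirichletProcess (posteriorBase s G x) μ) {κ : Type*} [Fintype κ] [DecidableEq κ]
    (p : κ → ℝ) (hp : Function.Injective p) (r : Fin n → κ) (hr : ∀ i, p (r i) = x i) :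
    ∃ Λ : Measure ((Fin (n + 1) → ℝ) × (κ → ℝ)), IsProbabilityMeasure Λ ∧
      Λ.map Prod.fst = weightLaw s n ∧ Λ.map Prod.snd = μ.map (fun Q k => Q.real {p k}) ∧
      ∀ᵐ u ∂Λ, (∀ i, 0 ≤ u.1 i) ∧ ∀ k, ∑ i with r i = k, u.1 i.succ ≤ u.2 k := by
  classical
  let B : Option κ → Set ℝ := fun o => o.elim (Set.range p)ᶜ fun k => {p k}
  have hrange : MeasurableSet (Set.range p) := (Set.finite_range p).measurableSet
  have hB : ∀ o, MeasurableSet (B o) := by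
    rintro (_ | k)
    · exact hrange.compl
    · exact measurableSet_singleton _
  have hdisj : Pairwise fun i j => Disjoint (B i) (B j) := by
    rintro (_ | k) (_ | l) hne
    · exact absurd rfl hne
    · simp [B]
    · simp [B]
    · have : k ≠ l := fun h => hne (by rw [h])
      simpa [B] using fun h => this (hp h)
  have hcover : (⋃ o, B o) = Set.univ := by
    ext t
    simp only [Set.mem_iUnion, Set.mem_univ, iff_true]
    by_cases h : t ∈ Set.range p
    · obtain ⟨k, rfl⟩ := h
      exact ⟨some k, rfl⟩
    · exact ⟨none, h⟩
  have hpart := hμ.map_fintype_partition B hB hdisj hcover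
  -- The common refinement: a prior part for each cell, carrying `s` times its mass under `G`, and a
  -- unit part for each observation.
  let a : Option κ ⊕ Fin n → ℝ := Sum.elim (fun o => s * G.real (B o)) fun _ => 1
  have ha : ∀ i, 0 ≤ a i := by
    rintro (o | i)
    · exact mul_nonneg hs.le measureReal_nonneg
    · exact zero_le_one
  -- `f` puts every part into the cell where it lies, producing the posterior masses; `g` pools the
  -- prior parts in coordinate 0, producing the weights `Dir(s, 1, …, 1)`. Both are read off the
  -- same random vector.
  let f : Option κ ⊕ Fin n → Option κ := Sum.elim id fun i => some (r i)
  let g : Option κ ⊕ Fin n → Fin (n + 1) := Sum.elim (fun _ => 0) Fin.succ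
  have hfa : (fun o => ∑ i with f i = o, a i) = fun o => (posteriorBase s G x).real (B o) := by
    ext o
    have : IsFiniteMeasure (ENNReal.ofReal s • G) := G.smul_finite ENNReal.ofReal_ne_top
    have e1 : (posteriorBase s G x).real (B o) =
        s * G.real (B o) + ∑ i, (Measure.dirac (x i)).real (B o) := by
      rw [posteriorBase, measureReal_add_apply, measureReal_ennreal_smul_apply,
        ENNReal.toReal_ofReal hs.le]
      congr 1
      simp only [measureReal_def, Measure.finsetSum_apply]
      rw [ENNReal.toReal_sum (fun i _ => measure_ne_top _ _)]
    have e2 : ∑ i with f i = o, a i =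
        s * G.real (B o) + ∑ i, if some (r i) = o then (1 : ℝ) else 0 := by
      rw [Finset.sum_filter, Fintype.sum_sum_type]
      congr 1
      refine (Finset.sum_eq_single_of_mem o (Finset.mem_univ o) fun b _ hb => if_neg hb).trans ?_
      exact if_pos rfl
    rw [e1, e2]
    congr 1
    refine Finset.sum_congr rfl fun i _ => ?_
    have : x i ∈ B o ↔ some (r i) = o := by
      rw [← hr i]
      rcases o with _ | k
      · simp [B]
      · simp [B, hp.eq_iff]
    rw [measureReal_def, Measure.dirac_apply' _ (hB o)]
    by_cases h : some (r i) = o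
    · simp [h, this.2 h]
    · simp [h, mt this.1 h]
  have hga : (fun i => ∑ j with g j = i, a j) = (Fin.cons s fun _ => 1 : Fin (n + 1) → ℝ) := by
    ext i
    rw [Finset.sum_filter, Fintype.sum_sum_type]
    refine Fin.cases ?_ (fun j => ?_) i
    · simp only [g, a, Sum.elim_inl, Sum.elim_inr, Fin.succ_ne_zero, if_false, if_true,
        Finset.sum_const_zero, add_zero, Fin.cons_zero]
      rw [← Finset.mul_sum]
      have : ∑ o, G.real (B o) = 1 := by
        rw [← measureReal_iUnion_fintype hdisj hB, hcover, probReal_univ]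
      rw [this, mul_one]
    · simp [g, a, (Fin.succ_ne_zero j).symm]
  have hf := map_fiberSum_dirichlet f ha
  have hg := map_fiberSum_dirichlet g ha
  rw [hfa, ← hpart] at hf
  rw [hga] at hg
  have hm1 : Measurable fun (w : Option κ ⊕ Fin n → ℝ) i => ∑ j with g j = i, w j := by fun_prop
  have hm2 : Measurable fun (w : Option κ ⊕ Fin n → ℝ) (k : κ) => ∑ j with f j = some k, w j := by
    fun_prop
  refine ⟨(dirichlet a).map fun w =>
    (fun i => ∑ j with g j = i, w j, fun k => ∑ j with f j = some k, w j),
    Measure.isProbabilityMeasure_map (by fun_prop), ?_, ?_, ?_⟩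
  · rw [Measure.map_map measurable_fst (by fun_prop)]
    exact hg
  · rw [Measure.map_map measurable_snd (by fun_prop)]
    have := congrArg (Measure.map fun (u : Option κ → ℝ) (k : κ) => u (some k)) hf
    rw [Measure.map_map (by fun_prop) (by fun_prop), Measure.map_map (by fun_prop)
      (measurable_pi_lambda _ fun i => measurable_measureReal_apply (hB _))] at this
    exact this
  · rw [ae_map_iff (by fun_prop)]
    · filter_upwards [ae_nonneg_dirichlet a] with w hw
      refine ⟨fun i => Finset.sum_nonneg fun j _ => hw j, fun k => ?_⟩
      have e1 : ∀ i : Fin n, ∑ j with g j = i.succ, w j = w (Sum.inr i) := fun i => by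
        rw [Finset.sum_filter, Fintype.sum_sum_type]
        simp [g, (Fin.succ_ne_zero i).symm]
      simp only [e1]
      -- The cell of `p k` contains all observations at `p k`, plus a nonnegative prior part that is
      -- dropped here.
      refine (Finset.sum_map (Finset.univ.filter fun i => r i = k)
        (Function.Embedding.inr (α := Option κ)) w).symm.trans_le ?_
      refine Finset.sum_le_sum_of_subset_of_nonneg (fun j hj => ?_) fun j _ _ => hw j
      obtain ⟨i, hi, rfl⟩ := Finset.mem_map.1 hj
      simpa [f] using hi
    · measurability

/-- Couple each sample separately and take the product of the couplings. For a nonnegative kernel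
the bilinear form is monotone in both nonnegative mass vectors, hence the probability of every upper
set increases. Leaving the kernel general lets the same domination serve `leInd` and `1 - leInd`. -/
lemma weighted_sum_le_posterior {s : ℝ} (hs : 0 < s) {n : ℕ} (x y : Fin n → ℝ)
    {G₁ G₂ : Measure ℝ} [IsProbabilityMeasure G₁] [IsProbabilityMeasure G₂]
    {μ₁ μ₂ : Measure (Measure ℝ)} (h₁ : IsDirichletProcess (posteriorBase s G₁ x) μ₁)
    (h₂ : IsDirichletProcess (posteriorBase s G₂ y) μ₂)
    {κ κ' : Type*} [Fintype κ] [DecidableEq κ] [Fintype κ'] [DecidableEq κ']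
    {p : κ → ℝ} (hp : Function.Injective p) {r : Fin n → κ} (hr : ∀ i, p (r i) = x i)
    {q : κ' → ℝ} (hq : Function.Injective q) {t : Fin n → κ'} (ht : ∀ i, q (t i) = y i)
    {k : ℝ → ℝ → ℝ} (hk : ∀ a b, 0 ≤ k a b) {T : Set ℝ} (hT : MeasurableSet T)
    (hTup : IsUpperSet T) :
    ((weightLaw s n).prod (weightLaw s n)).real
        {w | ∑ i, ∑ j, w.1 (Fin.succ i) * w.2 (Fin.succ j) * k (x i) (y j) ∈ T} ≤
      (μ₁.prod μ₂).real
        {Q | ∑ a, ∑ b, Q.1.real {p a} * Q.2.real {q b} * k (p a) (q b) ∈ T} := by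
  have := h₁.isProbabilityMeasure
  have := h₂.isProbabilityMeasure
  obtain ⟨Λ, hΛ, hw, hm, hae⟩ := exists_coupling_posterior hs x h₁ p hp r hr
  obtain ⟨Λ', hΛ', hw', hm', hae'⟩ := exists_coupling_posterior hs y h₂ q hq t ht
  have hmp : Measurable fun (Q : Measure ℝ) (a : κ) => Q.real {p a} :=
    measurable_pi_lambda _ fun i => measurable_measureReal_apply (measurableSet_singleton _)
  have hmq : Measurable fun (Q : Measure ℝ) (a : κ') => Q.real {q a} :=
    measurable_pi_lambda _ fun i => measurable_measureReal_apply (measurableSet_singleton _)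
  let F : (κ → ℝ) × (κ' → ℝ) → ℝ := fun u => ∑ a, ∑ b, u.1 a * u.2 b * k (p a) (q b)
  let W : (Fin (n + 1) → ℝ) × (Fin (n + 1) → ℝ) → ℝ :=
    fun w => ∑ i, ∑ j, w.1 (Fin.succ i) * w.2 (Fin.succ j) * k (x i) (y j)
  have hF : Measurable F := by fun_prop
  have hW : Measurable W := by fun_prop
  have e1 : (μ₁.prod μ₂).real
        {Q | ∑ a, ∑ b, Q.1.real {p a} * Q.2.real {q b} * k (p a) (q b) ∈ T} =
      (Λ.prod Λ').real {u | F (u.1.2, u.2.2) ∈ T} := by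
    have h := (Measure.map_prod_map Λ Λ' measurable_snd measurable_snd).symm.trans
      ((congrArg₂ Measure.prod hm hm').trans (Measure.map_prod_map μ₁ μ₂ hmp hmq))
    have h' := congrArg (fun ν => ν.real (F ⁻¹' T)) h
    rw [map_measureReal_apply (by fun_prop) (hF hT),
      map_measureReal_apply (hmp.prodMap hmq) (hF hT)] at h'
    exact h'.symm
  have e2 : ((weightLaw s n).prod (weightLaw s n)).real {w | W w ∈ T} =
      (Λ.prod Λ').real {u | W (u.1.1, u.2.1) ∈ T} := by
    rw [← hw]
    nth_rewrite 2 [hw]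
    rw [← hw', Measure.map_prod_map Λ Λ' measurable_fst measurable_fst]
    exact map_measureReal_apply (by fun_prop) (hW hT)
  rw [e1]
  refine e2.trans_le ?_
  refine ENNReal.toReal_mono (measure_ne_top _ _) (measure_mono_ae ?_)
  filter_upwards [Measure.quasiMeasurePreserving_fst.ae hae,
    Measure.quasiMeasurePreserving_snd.ae hae'] with u hu hu' hmem
  refine hTup ?_ hmem
  simp only [F, W]
  simp only [← hr, ← ht]
  rw [← sum_fiberSum_mul r t (fun i => u.1.1 i.succ) (fun i => u.2.1 i.succ)
    (fun a b => k (p a) (q b))]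
  refine Finset.sum_le_sum fun a _ => Finset.sum_le_sum fun b _ => ?_
  refine mul_le_mul_of_nonneg_right ?_ (hk _ _)
  exact mul_le_mul (hu.2 a) (hu'.2 b) (Finset.sum_nonneg fun i _ => hu'.1 _)
    ((Finset.sum_nonneg fun i _ => hu.1 _).trans (hu.2 a))

/-! ### Bounding the posterior probabilities from both sides -/

lemma leInd_eq_ite (a b : ℝ) : leInd a b = if a ≤ b then 1 else 0 := by
  simp [leInd, Set.indicator_apply]

lemma leInd_nonneg (a b : ℝ) : 0 ≤ leInd a b := by rw [leInd_eq_ite]; split_ifs <;> norm_num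

lemma leInd_le_one (a b : ℝ) : leInd a b ≤ 1 := by rw [leInd_eq_ite]; split_ifs <;> norm_num

lemma sum_measureReal_singleton_le {κ : Type*} [Fintype κ] {p : κ → ℝ}
    (hp : Function.Injective p) (Q : Measure ℝ) [IsFiniteMeasure Q] {g : ℝ → ℝ}
    (hg : Measurable g) (hg0 : ∀ y, 0 ≤ g y) {C : ℝ} (hC : ∀ y, g y ≤ C) :
    ∑ a, Q.real {p a} * g (p a) ≤ ∫ y, g y ∂Q := by
  have hint : Integrable g Q := Integrable.of_bound hg.aestronglyMeasurable C
    (ae_of_all _ fun y => by rw [Real.norm_of_nonneg (hg0 y)]; exact hC y)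
  classical
  have h := setIntegral_le_integral (s := ((Finset.univ.image p : Finset ℝ) : Set ℝ)) hint
    (ae_of_all _ hg0)
  rw [setIntegral_finset _ hint.integrableOn, Finset.sum_image hp.injOn] at h
  simpa using h

lemma measurable_measureReal_Iic (Q : Measure ℝ) [IsFiniteMeasure Q] :
    Measurable fun y => Q.real (Set.Iic y) :=
  Monotone.measurable fun _ _ h => measureReal_mono (Set.Iic_subset_Iic.2 h)

/-- Discarding the mass away from the marked points can only decrease the integral, first in one
variable and then in the other. -/
lemma sum_atoms_le_probLE {κ κ' : Type*} [Fintype κ] [Fintype κ'] {p : κ → ℝ}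
    (hp : Function.Injective p) {q : κ' → ℝ} (hq : Function.Injective q)
    (Q₁ Q₂ : Measure ℝ) [IsProbabilityMeasure Q₁] [IsProbabilityMeasure Q₂] :
    ∑ a, ∑ b, Q₁.real {p a} * Q₂.real {q b} * leInd (p a) (q b) ≤ probLE Q₁ Q₂ := by
  refine le_trans ?_ (sum_measureReal_singleton_le hq Q₂ (measurable_measureReal_Iic Q₁)
    (fun _ => measureReal_nonneg) (fun _ => measureReal_le_one))
  rw [Finset.sum_comm]
  refine Finset.sum_le_sum fun b _ => ?_
  have h := sum_measureReal_singleton_le hp Q₁ (g := (Set.Iic (q b)).indicator 1)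
    (measurable_one.indicator measurableSet_Iic)
    (fun y => Set.indicator_nonneg (fun _ _ => zero_le_one) y) (C := 1)
    (fun y => Set.indicator_le_self' (fun _ _ => zero_le_one) y)
  rw [integral_indicator_one measurableSet_Iic] at h
  refine le_trans (le_of_eq ?_) (mul_le_mul_of_nonneg_left h measureReal_nonneg)
  rw [Finset.mul_sum]
  refine Finset.sum_congr rfl fun a _ => ?_
  rw [leInd_eq_ite, Set.indicator_apply]
  simp only [Set.mem_Iic, Pi.one_apply]
  ring

/-- Discarding mass outside the marked points, now for the complementary kernel: `1 - probLE` is the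
integral of the mass of `Q₁` strictly above `y`. -/
lemma probLE_le_sum_atoms {κ κ' : Type*} [Fintype κ] [Fintype κ'] {p : κ → ℝ}
    (hp : Function.Injective p) {q : κ' → ℝ} (hq : Function.Injective q)
    (Q₁ Q₂ : Measure ℝ) [IsProbabilityMeasure Q₁] [IsProbabilityMeasure Q₂] :
    probLE Q₁ Q₂ ≤
      1 - ∑ a, ∑ b, Q₁.real {p a} * Q₂.real {q b} * (1 - leInd (p a) (q b)) := by
  have hm : Measurable fun y => 1 - Q₁.real (Set.Iic y) :=
    (measurable_measureReal_Iic Q₁).const_sub 1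
  have h1 : probLE Q₁ Q₂ = 1 - ∫ y, (1 - Q₁.real (Set.Iic y)) ∂Q₂ := by
    rw [integral_sub (integrable_const _) (Integrable.of_bound
      (measurable_measureReal_Iic Q₁).aestronglyMeasurable 1 (ae_of_all _ fun y => by
        rw [Real.norm_of_nonneg measureReal_nonneg]; exact measureReal_le_one))]
    simp [probLE]
  rw [h1]
  refine sub_le_sub_left (le_trans ?_ (sum_measureReal_singleton_le hq Q₂ hm
    (fun _ => sub_nonneg.2 measureReal_le_one)
    (fun _ => sub_le_self 1 measureReal_nonneg))) 1
  rw [Finset.sum_comm]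
  refine Finset.sum_le_sum fun b _ => ?_
  have h := sum_measureReal_singleton_le hp Q₁ (g := (Set.Iic (q b))ᶜ.indicator 1)
    (measurable_one.indicator measurableSet_Iic.compl)
    (fun y => Set.indicator_nonneg (fun _ _ => zero_le_one) y) (C := 1)
    (fun y => Set.indicator_le_self' (fun _ _ => zero_le_one) y)
  rw [integral_indicator_one measurableSet_Iic.compl,
    probReal_compl_eq_one_sub measurableSet_Iic] at h
  refine le_trans (le_of_eq ?_) (mul_le_mul_of_nonneg_left h measureReal_nonneg)
  rw [Finset.mul_sum]
  refine Finset.sum_congr rfl fun a _ => ?_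
  rw [leInd_eq_ite, Set.indicator_apply]
  simp only [Set.mem_compl_iff, Set.mem_Iic, Pi.one_apply]
  split_ifs <;> simp_all
  ring

/-- Finitely supported Dirichlet processes: independent Dirichlet weights at fixed locations. -/
lemma isDirichletProcess_sum_dirac {ι 𝕏 : Type*} [Fintype ι] [MeasurableSpace 𝕏] {a : ι → ℝ}
    (ha : ∀ i, 0 ≤ a i) (hpos : ∃ i, 0 < a i) (z : ι → 𝕏) :
    Measurable (fun w : ι → ℝ => ∑ i, ENNReal.ofReal (w i) • Measure.dirac (z i)) ∧
    IsDirichletProcess (∑ i, ENNReal.ofReal (a i) • Measure.dirac (z i))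
      ((dirichlet a).map fun w => ∑ i, ENNReal.ofReal (w i) • Measure.dirac (z i)) := by
  classical
  have hmeas : Measurable
      (fun w : ι → ℝ => ∑ i, ENNReal.ofReal (w i) • Measure.dirac (z i)) := by
    refine Measure.measurable_of_measurable_coe _ fun B hB => ?_
    simp only [Measure.finsetSum_apply, Measure.smul_apply, smul_eq_mul]
    fun_prop
  refine ⟨hmeas, ?_⟩
  have hreal : ∀ {B : Set 𝕏}, MeasurableSet B → ∀ w : ι → ℝ, (∀ i, 0 ≤ w i) →
      (∑ i, ENNReal.ofReal (w i) • Measure.dirac (z i)).real B = ∑ i with z i ∈ B, w i := by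
    intro B hB w hw
    rw [measureReal_def, Measure.finsetSum_apply, ENNReal.toReal_sum, Finset.sum_filter]
    · refine Finset.sum_congr rfl fun i _ => ?_
      rw [Measure.smul_apply, smul_eq_mul, Measure.dirac_apply' _ hB]
      by_cases h : z i ∈ B <;> simp [h, hw i]
    · intro i _
      exact ENNReal.mul_ne_top ENNReal.ofReal_ne_top (measure_ne_top _ _)
  refine ⟨Measure.isProbabilityMeasure_map hmeas.aemeasurable, ?_, ?_⟩
  · have hset : MeasurableSet {Q : Measure 𝕏 | Q Set.univ = 1} :=
      Measure.measurable_coe MeasurableSet.univ (measurableSet_singleton 1)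
    have : ∀ᵐ Q ∂((dirichlet a).map fun w =>
        ∑ i, ENNReal.ofReal (w i) • Measure.dirac (z i)), Q Set.univ = 1 := by
      rw [ae_map_iff hmeas.aemeasurable hset]
      filter_upwards [ae_nonneg_dirichlet a, ae_sum_eq_one_dirichlet hpos] with w hw hw1
      simp only [Measure.finsetSum_apply, Measure.smul_apply, measure_univ, smul_eq_mul, mul_one]
      rw [← ENNReal.ofReal_sum_of_nonneg fun i _ => hw i, hw1, ENNReal.ofReal_one]
    exact this.mono fun Q hQ => ⟨hQ⟩
  · intro k B hB hdisj hcover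
    -- A partition assigns each location to exactly one cell, so the vector of cell masses is an
    -- aggregation of the Dirichlet weights.
    have hex : ∀ t : 𝕏, ∃ j, t ∈ B j := fun t => Set.mem_iUnion.1 (hcover ▸ Set.mem_univ t)
    choose f hf using fun i => hex (z i)
    have hfB : ∀ i j, z i ∈ B j ↔ f i = j := fun i j => by
      refine ⟨fun h => ?_, fun h => h ▸ hf i⟩
      by_contra hne
      exact Set.disjoint_left.1 (hdisj hne) (hf i) h
    have hR : (fun j => (∑ i, ENNReal.ofReal (a i) • Measure.dirac (z i)).real (B j)) =
        fun j => ∑ i with f i = j, a i := by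
      ext j
      simp only [hreal (hB j) a ha, hfB]
    rw [hR, ← map_fiberSum_dirichlet f ha, Measure.map_map
      (measurable_pi_lambda _ fun i => measurable_measureReal_apply (hB i)) hmeas]
    refine Measure.map_congr ?_
    filter_upwards [ae_nonneg_dirichlet a] with w hw
    ext j
    simp only [Function.comp_apply, hreal (hB j) w hw, hfB]

lemma cons_nonneg {s : ℝ} (hs : 0 ≤ s) (n : ℕ) (i : Fin (n + 1)) :
    0 ≤ (Fin.cons s fun _ => 1 : Fin (n + 1) → ℝ) i := by
  refine Fin.cases ?_ (fun j => ?_) i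
  · simpa using hs
  · simp

lemma ae_weightLaw {s : ℝ} (hs : 0 < s) (n : ℕ) :
    ∀ᵐ w ∂(weightLaw s n), (∀ i, 0 ≤ w i) ∧ ∑ i, w i = 1 :=
  (ae_nonneg_dirichlet _).and (ae_sum_eq_one_dirichlet ⟨0, by simpa using hs⟩)

instance weightLaw_isProbabilityMeasure (s : ℝ) (n : ℕ) : IsProbabilityMeasure (weightLaw s n) := by
  unfold weightLaw; infer_instance

lemma posteriorBase_dirac (s z₀ : ℝ) {n : ℕ} (x : Fin n → ℝ) :
    posteriorBase s (Measure.dirac z₀) x =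
      ∑ i, ENNReal.ofReal ((Fin.cons s fun _ => 1 : Fin (n + 1) → ℝ) i) •
        Measure.dirac ((Fin.cons z₀ x : Fin (n + 1) → ℝ) i) := by
  simp [posteriorBase, Fin.sum_univ_succ]

lemma posteriorProbs_mem_Icc {s : ℝ} {n : ℕ} {x y : Fin n → ℝ} {c p : ℝ}
    (hp : p ∈ posteriorProbs s x y c) : 0 ≤ p ∧ p ≤ 1 := by
  obtain ⟨G₁, G₂, _, _, μ₁, μ₂, h₁, h₂, rfl⟩ := hp
  have := h₁.isProbabilityMeasure
  have := h₂.isProbabilityMeasure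
  exact ⟨measureReal_nonneg, measureReal_le_one⟩

lemma measurable_weightedSum {n : ℕ} (k : Fin n → Fin n → ℝ) :
    Measurable fun w : (Fin (n + 1) → ℝ) × (Fin (n + 1) → ℝ) =>
      ∑ i, ∑ j, w.1 (Fin.succ i) * w.2 (Fin.succ j) * k i j := by fun_prop

lemma lowerDist_real_Ioi (s : ℝ) {n : ℕ} (x y : Fin n → ℝ) (c : ℝ) :
    (lowerDist s x y).real (Set.Ioi c) =
      ((weightLaw s n).prod (weightLaw s n)).real {w | c < weightedRankSum x y w} := by
  have hm : Measurable (weightedRankSum x y) :=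
    measurable_weightedSum fun i j => leInd (x i) (y j)
  rw [lowerDist, map_measureReal_apply hm measurableSet_Ioi]
  rfl

/-- The marked points are the distinct observed values; indexing by the range of the sample, and not
by the observations, takes care of ties. -/
lemma lowerDist_le_of_mem_posteriorProbs {s : ℝ} (hs : 0 < s) {n : ℕ} {x y : Fin n → ℝ} {c p : ℝ}
    (hp : p ∈ posteriorProbs s x y c) : (lowerDist s x y).real (Set.Ioi c) ≤ p := by
  obtain ⟨G₁, G₂, _, _, μ₁, μ₂, h₁, h₂, rfl⟩ := hp
  have := h₁.isProbabilityMeasure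
  have := h₂.isProbabilityMeasure
  classical
  rw [lowerDist_real_Ioi]
  refine (weighted_sum_le_posterior hs x y h₁ h₂ (κ := Set.range x) (κ' := Set.range y)
    Subtype.val_injective (r := fun i => ⟨x i, i, rfl⟩) (fun _ => rfl)
    Subtype.val_injective (t := fun i => ⟨y i, i, rfl⟩) (fun _ => rfl) leInd_nonneg
    (T := Set.Ioi c) measurableSet_Ioi (isUpperSet_Ioi c)).trans ?_
  refine ENNReal.toReal_mono (measure_ne_top _ _) (measure_mono_ae ?_)
  filter_upwards [Measure.quasiMeasurePreserving_fst.ae h₁.ae_isProbabilityMeasure,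
    Measure.quasiMeasurePreserving_snd.ae h₂.ae_isProbabilityMeasure] with Q hQ₁ hQ₂ hQ
  exact lt_of_lt_of_le hQ (sum_atoms_le_probLE Subtype.val_injective Subtype.val_injective Q.1 Q.2)

/-- Domination for the complementary kernel makes `1 - ∑ …` stochastically smaller under the
posterior than under the weights. The upper set is closed here because its complement must be the
strict event `c < 1 - …`. -/
lemma le_of_mem_posteriorProbs {s : ℝ} (hs : 0 < s) {n : ℕ} {x y : Fin n → ℝ} {c p : ℝ}
    (hp : p ∈ posteriorProbs s x y c) :
    p ≤ ((weightLaw s n).prod (weightLaw s n)).real {w | c < 1 - ∑ i, ∑ j,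
      w.1 (Fin.succ i) * w.2 (Fin.succ j) * (1 - leInd (x i) (y j))} := by
  obtain ⟨G₁, G₂, _, _, μ₁, μ₂, h₁, h₂, rfl⟩ := hp
  have := h₁.isProbabilityMeasure
  have := h₂.isProbabilityMeasure
  classical
  have key := weighted_sum_le_posterior hs x y h₁ h₂ (κ := Set.range x) (κ' := Set.range y)
    Subtype.val_injective (r := fun i => ⟨x i, i, rfl⟩) (fun _ => rfl)
    Subtype.val_injective (t := fun i => ⟨y i, i, rfl⟩) (fun _ => rfl)
    (k := fun a b => 1 - leInd a b) (fun a b => sub_nonneg.2 (leInd_le_one a b))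
    (T := Set.Ici (1 - c)) measurableSet_Ici (isUpperSet_Ici _)
  set F : Measure ℝ × Measure ℝ → ℝ := fun Q => ∑ a : Set.range x, ∑ b : Set.range y,
    Q.1.real {a.1} * Q.2.real {b.1} * (1 - leInd a b) with hF
  have hFm : Measurable F := by
    refine Finset.measurable_sum _ fun a _ => Finset.measurable_sum _ fun b _ => ?_
    exact (((measurable_measureReal_apply (measurableSet_singleton _)).comp measurable_fst).mul
      ((measurable_measureReal_apply (measurableSet_singleton _)).comp measurable_snd)).mul_const _
  set W : (Fin (n + 1) → ℝ) × (Fin (n + 1) → ℝ) → ℝ := fun w => ∑ i, ∑ j,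
    w.1 (Fin.succ i) * w.2 (Fin.succ j) * (1 - leInd (x i) (y j)) with hW
  have hWm : Measurable W := measurable_weightedSum _
  have e1 : {w | c < 1 - W w} = (W ⁻¹' Set.Ici (1 - c))ᶜ := by
    ext w; simp [← lt_sub_iff_add_lt, lt_sub_comm (a := c)]
  have e2 : (μ₁.prod μ₂).real {Q | c < probLE Q.1 Q.2} ≤
      (μ₁.prod μ₂).real (F ⁻¹' Set.Ici (1 - c))ᶜ := by
    refine ENNReal.toReal_mono (measure_ne_top _ _) (measure_mono_ae ?_)
    filter_upwards [Measure.quasiMeasurePreserving_fst.ae h₁.ae_isProbabilityMeasure,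
      Measure.quasiMeasurePreserving_snd.ae h₂.ae_isProbabilityMeasure] with Q hQ₁ hQ₂ hQ
    have h := lt_of_lt_of_le hQ (probLE_le_sum_atoms (p := ((↑) : Set.range x → ℝ))
      (q := ((↑) : Set.range y → ℝ)) Subtype.val_injective Subtype.val_injective Q.1 Q.2)
    change ¬ (1 - c ≤ F Q)
    rw [not_le]
    exact lt_sub_comm.1 h
  rw [e1, probReal_compl_eq_one_sub (hWm measurableSet_Ici)]
  rw [probReal_compl_eq_one_sub (hFm measurableSet_Ici)] at e2
  exact e2.trans (sub_le_sub_left key 1)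

/-- The least favourable base measures put the prior mass of `X` to the right of all observations
and that of `Y` to the left of everything. -/
lemma exists_mem_posteriorProbs_le {s : ℝ} (hs : 0 < s) {n : ℕ} (x y : Fin n → ℝ) (c : ℝ) :
    ∃ p ∈ posteriorProbs s x y c, p ≤ (lowerDist s x y).real (Set.Ioi c) := by
  classical
  obtain ⟨M, hM⟩ : ∃ M : ℝ, ∀ i, |x i| < M ∧ |y i| < M := by
    refine ⟨∑ i, (|x i| + |y i|) + 1, fun i => ?_⟩
    have := Finset.single_le_sum (f := fun i => |x i| + |y i|) (fun i _ => by positivity)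
      (Finset.mem_univ i)
    have h1 := abs_nonneg (x i)
    have h2 := abs_nonneg (y i)
    constructor <;> linarith
  -- Positivity of `M` is needed for the pair of prior atoms: `M ≤ -M` must fail.
  obtain ⟨M, hM0, hM⟩ : ∃ M : ℝ, 0 < M ∧ ∀ i, |x i| < M ∧ |y i| < M :=
    ⟨|M| + 1, by positivity, fun i => ⟨by linarith [(hM i).1, le_abs_self M],
      by linarith [(hM i).2, le_abs_self M]⟩⟩
  set z : Fin (n + 1) → ℝ := Fin.cons M x with hz
  set z' : Fin (n + 1) → ℝ := Fin.cons (-M) y with hz'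
  obtain ⟨hm₁, hD₁⟩ := isDirichletProcess_sum_dirac (cons_nonneg hs.le n) ⟨0, by simpa using hs⟩ z
  obtain ⟨hm₂, hD₂⟩ := isDirichletProcess_sum_dirac (cons_nonneg hs.le n) ⟨0, by simpa using hs⟩ z'
  set μ₁ := (dirichlet (Fin.cons s fun _ => 1 : Fin (n + 1) → ℝ)).map
    fun w => ∑ i, ENNReal.ofReal (w i) • Measure.dirac (z i) with hμ₁
  set μ₂ := (dirichlet (Fin.cons s fun _ => 1 : Fin (n + 1) → ℝ)).map
    fun w => ∑ i, ENNReal.ofReal (w i) • Measure.dirac (z' i) with hμ₂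
  have := hD₁.isProbabilityMeasure
  have := hD₂.isProbabilityMeasure
  refine ⟨(μ₁.prod μ₂).real {Q | c < probLE Q.1 Q.2}, ⟨Measure.dirac M, Measure.dirac (-M),
    inferInstance, inferInstance, μ₁, μ₂, ?_, ?_, rfl⟩, ?_⟩
  · rw [posteriorBase_dirac]; exact hD₁
  · rw [posteriorBase_dirac]; exact hD₂
  -- All mass now sits at marked points, so the upper bound for `probLE` given by the complementary
  -- kernel loses nothing.
  set F : Measure ℝ × Measure ℝ → ℝ := fun Q => ∑ a : Set.range z, ∑ b : Set.range z',
    Q.1.real {a.1} * Q.2.real {b.1} * (1 - leInd a b) with hF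
  have hFm : Measurable F := by
    refine Finset.measurable_sum _ fun a _ => Finset.measurable_sum _ fun b _ => ?_
    exact (((measurable_measureReal_apply (measurableSet_singleton _)).comp measurable_fst).mul
      ((measurable_measureReal_apply (measurableSet_singleton _)).comp measurable_snd)).mul_const _
  have hle : (μ₁.prod μ₂).real {Q | c < probLE Q.1 Q.2} ≤
      (μ₁.prod μ₂).real ((fun Q => 1 - F Q) ⁻¹' Set.Ioi c) := by
    refine ENNReal.toReal_mono (measure_ne_top _ _) (measure_mono_ae ?_)
    filter_upwards [Measure.quasiMeasurePreserving_fst.ae hD₁.ae_isProbabilityMeasure,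
      Measure.quasiMeasurePreserving_snd.ae hD₂.ae_isProbabilityMeasure] with Q hQ₁ hQ₂ hQ
    exact lt_of_lt_of_le hQ (probLE_le_sum_atoms (p := ((↑) : Set.range z → ℝ))
      (q := ((↑) : Set.range z' → ℝ)) Subtype.val_injective Subtype.val_injective Q.1 Q.2)
  refine hle.trans (le_of_eq ?_)
  rw [lowerDist_real_Ioi, hμ₁, hμ₂, Measure.map_prod_map _ _ hm₁ hm₂, map_measureReal_apply
    (hm₁.prodMap hm₂) ((hFm.const_sub 1) measurableSet_Ioi)]
  refine measureReal_congr ?_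
  filter_upwards [Measure.quasiMeasurePreserving_fst.ae (ae_weightLaw hs n),
    Measure.quasiMeasurePreserving_snd.ae (ae_weightLaw hs n)] with w hw hw'
  have hmass : ∀ (z : Fin (n + 1) → ℝ) (w : Fin (n + 1) → ℝ), (∀ i, 0 ≤ w i) →
      ∀ a : Set.range z, (∑ i, ENNReal.ofReal (w i) • Measure.dirac (z i)).real {a.1} =
        ∑ i with (⟨z i, i, rfl⟩ : Set.range z) = a, w i := by
    intro z w hw a
    rw [measureReal_def, Measure.finsetSum_apply, ENNReal.toReal_sum, Finset.sum_filter]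
    · refine Finset.sum_congr rfl fun i _ => ?_
      rw [Measure.smul_apply, smul_eq_mul, Measure.dirac_apply' _ (measurableSet_singleton _)]
      by_cases h : z i = a
      · simp [h, hw i]
      · have : ¬ (⟨z i, i, rfl⟩ : Set.range z) = a := fun h' => h (congrArg Subtype.val h')
        simp [h, this]
    · intro i _
      exact ENNReal.mul_ne_top ENNReal.ofReal_ne_top (measure_ne_top _ _)
  have hval : 1 - F (∑ i, ENNReal.ofReal (w.1 i) • Measure.dirac (z i),
      ∑ i, ENNReal.ofReal (w.2 i) • Measure.dirac (z' i)) = weightedRankSum x y w := by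
    simp only [hF, hmass z w.1 hw.1, hmass z' w.2 hw'.1]
    rw [sum_fiberSum_mul (fun i => (⟨z i, i, rfl⟩ : Set.range z))
      (fun i => (⟨z' i, i, rfl⟩ : Set.range z')) w.1 w.2
      (fun a b => 1 - leInd a b)]
    have h1 : ∑ i, ∑ j, w.1 i * w.2 j = 1 := by
      rw [← Finset.sum_mul_sum, hw.2, hw'.2, one_mul]
    simp only [mul_sub, mul_one, Finset.sum_sub_distrib, h1, sub_sub_cancel]
    -- Every pair that involves a prior atom contributes 0, including the pair of the two prior
    -- atoms.
    have hrow : ∀ j, leInd M (z' j) = 0 := fun j => by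
      rw [leInd_eq_ite, if_neg]
      refine Fin.cases ?_ (fun j => ?_) j
      · simp [hz']; linarith
      · simpa [hz'] using (le_abs_self _).trans_lt (hM j).2
    have hcol : ∀ i, leInd (z i) (-M) = 0 := fun i => by
      rw [leInd_eq_ite, if_neg]
      refine Fin.cases ?_ (fun i => ?_) i
      · simp [hz]; linarith
      · simpa [hz] using (abs_lt.1 (hM i).1).1
    rw [weightedRankSum, Fin.sum_univ_succ]
    simp only [Fin.sum_univ_succ (n := n)]
    simp only [hz, hz', Fin.cons_zero, Fin.cons_succ] at hrow hcol ⊢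
    have hrow0 := hrow 0
    have hrow' := fun j : Fin n => hrow j.succ
    have hcol' := fun j : Fin n => hcol j.succ
    simp only [Fin.cons_zero, Fin.cons_succ] at hrow0 hrow' hcol'
    simp [hrow0, hrow', hcol']
  have : (w ∈ (Prod.map (fun w => ∑ i, ENNReal.ofReal (w i) • Measure.dirac (z i))
      (fun w => ∑ i, ENNReal.ofReal (w i) • Measure.dirac (z' i)) ⁻¹'
        ((fun Q => 1 - F Q) ⁻¹' Set.Ioi c))) = (w ∈ {w | c < weightedRankSum x y w}) := by
    simp only [Set.mem_preimage, Prod.map, hval, Set.mem_Ioi, Set.mem_ofPred_eq]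
  exact this

/-! ### Lower and upper posterior probabilities -/

/-- The lower posterior probability is the upper tail of the lower distribution. -/
theorem lowerProb_eq {s : ℝ} (hs : 0 < s) {n : ℕ} (x y : Fin n → ℝ) (c : ℝ) :
    lowerProb s x y c = (lowerDist s x y).real (Set.Ioi c) := by
  obtain ⟨p, hp, hle⟩ := exists_mem_posteriorProbs_le hs x y c
  exact le_antisymm ((csInf_le ⟨0, fun q hq => (posteriorProbs_mem_Icc hq).1⟩ hp).trans hle)
    (le_csInf ⟨p, hp⟩ fun q hq => lowerDist_le_of_mem_posteriorProbs hs hq)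

lemma lowerProb_le_upperProb {s : ℝ} (hs : 0 < s) {n : ℕ} (x y : Fin n → ℝ) (c : ℝ) :
    lowerProb s x y c ≤ upperProb s x y c := by
  obtain ⟨p, hp, -⟩ := exists_mem_posteriorProbs_le hs x y c
  exact csInf_le_csSup (hb := ⟨0, fun q hq => (posteriorProbs_mem_Icc hq).1⟩)
    (ha := ⟨1, fun q hq => (posteriorProbs_mem_Icc hq).2⟩) ⟨p, hp⟩

/-- The prior weights `w₁₀`, `w₂₀` bound the gap between the upper and the lower distribution. -/
lemma upperProb_le {s : ℝ} (hs : 0 < s) {n : ℕ} (x y : Fin n → ℝ) (c : ℝ) :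
    upperProb s x y c ≤ ((weightLaw s n).prod (weightLaw s n)).real
      {w | c < weightedRankSum x y w + (w.1 0 + w.2 0)} := by
  obtain ⟨p, hp, -⟩ := exists_mem_posteriorProbs_le hs x y c
  refine csSup_le ⟨p, hp⟩ fun q hq => (le_of_mem_posteriorProbs hs hq).trans ?_
  refine ENNReal.toReal_mono (measure_ne_top _ _) (measure_mono_ae ?_)
  filter_upwards [Measure.quasiMeasurePreserving_fst.ae (ae_weightLaw hs n),
    Measure.quasiMeasurePreserving_snd.ae (ae_weightLaw hs n)] with w hw hw' h
  refine lt_of_lt_of_le h ?_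
  have h1 : ∑ i : Fin n, w.1 i.succ = 1 - w.1 0 := by rw [← hw.2, Fin.sum_univ_succ]; ring
  have h2 : ∑ i : Fin n, w.2 i.succ = 1 - w.2 0 := by rw [← hw'.2, Fin.sum_univ_succ]; ring
  simp only [mul_sub, mul_one, Finset.sum_sub_distrib]
  rw [← Finset.sum_mul_sum, h1, h2]
  change _ ≤ weightedRankSum x y w + _
  rw [weightedRankSum]
  -- The bound so far is `W + w₁₀ + w₂₀ - w₁₀ w₂₀`, with `W` the rank sum; the product is dropped.
  nlinarith [mul_nonneg (hw.1 0) (hw'.1 0)]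

/-! ### Mean and variance of the lower distribution -/

lemma integrable_weightLaw_of_bound {s : ℝ} (hs : 0 < s) {n : ℕ} {f : (Fin (n + 1) → ℝ) → ℝ}
    (hf : Measurable f) {C : ℝ} (hC : ∀ w, (∀ i, 0 ≤ w i) → (∀ i, w i ≤ 1) → |f w| ≤ C) :
    Integrable f (weightLaw s n) := by
  refine Integrable.of_bound hf.aestronglyMeasurable C ?_
  filter_upwards [ae_weightLaw hs n] with w hw
  exact hC w hw.1 fun i => hw.2 ▸ Finset.single_le_sum (fun j _ => hw.1 j) (Finset.mem_univ i)

lemma sum_cons_one (s : ℝ) (n : ℕ) :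
    ∑ i, (Fin.cons s fun _ => 1 : Fin (n + 1) → ℝ) i = n + s := by
  simp [Fin.sum_univ_succ, add_comm]

lemma integral_sum_weightLaw {s : ℝ} (hs : 0 < s) {n : ℕ} (S : Finset (Fin (n + 1)))
    (h0 : (0 : Fin (n + 1)) ∉ S) (hS : S.Nonempty) :
    ∫ w, ∑ i ∈ S, w i ∂(weightLaw s n) = S.card / (n + s) ∧
    ∫ w, (∑ i ∈ S, w i) ^ 2 ∂(weightLaw s n) =
      S.card * (S.card + 1) / ((n + s) * (n + s + 1)) := by
  have e1 : ∑ i ∈ S, (Fin.cons s fun _ => 1 : Fin (n + 1) → ℝ) i = S.card := by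
    rw [Finset.sum_congr rfl (g := fun _ => (1 : ℝ))]
    · simp
    · intro i hi
      obtain ⟨j, rfl⟩ := Fin.exists_succ_eq.2 (fun h : i = 0 => h0 (h ▸ hi))
      simp
  have e2 : 0 < ∑ i ∈ Sᶜ, (Fin.cons s fun _ => 1 : Fin (n + 1) → ℝ) i :=
    Finset.sum_pos' (fun i _ => cons_nonneg hs.le n i) ⟨0, by simpa using h0, by simpa using hs⟩
  have h := integral_sum_dirichlet (cons_nonneg hs.le n) S
    (by rw [e1]; exact_mod_cast hS.card_pos) e2
  rwa [e1, sum_cons_one] at h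

lemma integral_weightLaw {s : ℝ} (hs : 0 < s) {n : ℕ} (i : Fin n) :
    ∫ w, w i.succ ∂(weightLaw s n) = 1 / (n + s) := by
  simpa using (integral_sum_weightLaw hs {i.succ} (by simp [(Fin.succ_ne_zero i).symm])
    (by simp)).1

lemma integral_mul_weightLaw {s : ℝ} (hs : 0 < s) {n : ℕ} (i k : Fin n) :
    ∫ w, w i.succ * w k.succ ∂(weightLaw s n) =
      (1 + if i = k then 1 else 0) / ((n + s) * (n + s + 1)) := by
  have hsq : ∀ i : Fin n, ∫ w, w i.succ ^ 2 ∂(weightLaw s n) = 2 / ((n + s) * (n + s + 1)) := by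
    intro i
    have h := (integral_sum_weightLaw hs {i.succ} (by simp [(Fin.succ_ne_zero i).symm])
      (by simp)).2
    simp only [Finset.sum_singleton, Finset.card_singleton, Nat.cast_one, one_mul] at h
    rw [h]; norm_num
  have hint : ∀ i k : Fin n, Integrable (fun w => w i.succ * w k.succ) (weightLaw s n) :=
    fun i k => integrable_weightLaw_of_bound hs (by fun_prop) (C := 1) fun w h0 h1 => by
      rw [abs_of_nonneg (mul_nonneg (h0 _) (h0 _))]
      exact mul_le_one₀ (h1 _) (h0 _) (h1 _)
  by_cases hik : i = k
  · subst hik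
    rw [if_pos rfl, one_add_one_eq_two, ← hsq i]
    simp only [sq]
  · rw [if_neg hik, add_zero]
    -- Polarization: the mixed moment follows from the second moments of `w_i`, `w_k` and `w_i +
    -- w_k`, all of them Beta moments.
    have h := (integral_sum_weightLaw hs {i.succ, k.succ}
      (by simp [(Fin.succ_ne_zero i).symm, (Fin.succ_ne_zero k).symm]) (by simp)).2
    have hne : i.succ ≠ k.succ := fun h => hik (Fin.succ_injective n h)
    simp only [Finset.sum_pair hne, Finset.card_pair hne] at h
    have e : ∀ w : Fin (n + 1) → ℝ, (w i.succ + w k.succ) ^ 2 =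
        w i.succ * w i.succ + 2 * (w i.succ * w k.succ) + w k.succ * w k.succ := fun w => by ring
    simp only [e] at h
    have hadd : Integrable (fun w : Fin (n + 1) → ℝ =>
        w i.succ * w i.succ + 2 * (w i.succ * w k.succ)) (weightLaw s n) :=
      (hint i i).add ((hint i k).const_mul 2)
    rw [integral_add hadd (hint k k), integral_add (hint i i) ((hint i k).const_mul 2),
        integral_const_mul] at h
    simp only [← sq, hsq] at h
    have hA : (n + s) * (n + s + 1) ≠ 0 := by positivity
    field_simp at h ⊢
    push_cast at h
    linarith

lemma integrable_prod_of_ae_bound {s : ℝ} (hs : 0 < s) {n : ℕ}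
    {f : (Fin (n + 1) → ℝ) × (Fin (n + 1) → ℝ) → ℝ} (hf : Measurable f) {C : ℝ}
    (hC : ∀ w, (∀ i, 0 ≤ w.1 i ∧ w.1 i ≤ 1) → (∀ i, 0 ≤ w.2 i ∧ w.2 i ≤ 1) → |f w| ≤ C) :
    Integrable f ((weightLaw s n).prod (weightLaw s n)) := by
  have h1 : ∀ᵐ w ∂(weightLaw s n), ∀ i, 0 ≤ w i ∧ w i ≤ 1 := by
    filter_upwards [ae_weightLaw hs n] with w hw i
    exact ⟨hw.1 i, hw.2 ▸ Finset.single_le_sum (fun j _ => hw.1 j) (Finset.mem_univ i)⟩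
  refine Integrable.of_bound hf.aestronglyMeasurable C ?_
  filter_upwards [Measure.quasiMeasurePreserving_fst.ae h1,
    Measure.quasiMeasurePreserving_snd.ae h1] with w hw hw'
  exact hC w hw hw'

lemma measurable_weightedRankSum {n : ℕ} (x y : Fin n → ℝ) : Measurable (weightedRankSum x y) :=
  measurable_weightedSum fun i j => leInd (x i) (y j)

lemma integral_weightedRankSum {s : ℝ} (hs : 0 < s) {n : ℕ} (x y : Fin n → ℝ) :
    ∫ w, weightedRankSum x y w ∂((weightLaw s n).prod (weightLaw s n)) =
      (∑ i, ∑ j, leInd (x i) (y j)) / (n + s) ^ 2 := by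
  have hint : ∀ i j : Fin n, Integrable
      (fun w : (Fin (n + 1) → ℝ) × (Fin (n + 1) → ℝ) =>
        w.1 i.succ * w.2 j.succ * leInd (x i) (y j))
      ((weightLaw s n).prod (weightLaw s n)) := fun i j => by
    refine (integrable_prod_of_ae_bound hs (by fun_prop) (C := 1) fun w h h' => ?_).mul_const _
    rw [abs_of_nonneg (mul_nonneg (h _).1 (h' _).1)]
    exact mul_le_one₀ (h _).2 (h' _).1 (h' _).2
  simp only [weightedRankSum]
  rw [integral_finsetSum _ fun i _ => integrable_finsetSum _ fun j _ => hint i j, Finset.sum_div]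
  refine Finset.sum_congr rfl fun i _ => ?_
  rw [integral_finsetSum _ fun j _ => hint i j, Finset.sum_div]
  refine Finset.sum_congr rfl fun j _ => ?_
  rw [integral_mul_const, integral_prod_mul (fun w : Fin (n + 1) → ℝ => w i.succ)
    (fun w : Fin (n + 1) → ℝ => w j.succ), integral_weightLaw hs, integral_weightLaw hs]
  field_simp

/-- By independence each quadruple of indices contributes `(1 + δ_ik)(1 + δ_jl)` over a common
denominator. Expanding the product produces the squared total, the squared row sums, the squared
column sums and the diagonal. -/
lemma integral_weightedRankSum_sq {s : ℝ} (hs : 0 < s) {n : ℕ} (x y : Fin n → ℝ) :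
    ∫ w, weightedRankSum x y w ^ 2 ∂((weightLaw s n).prod (weightLaw s n)) =
      ((∑ i, ∑ j, leInd (x i) (y j)) ^ 2 + ∑ i, (∑ j, leInd (x i) (y j)) ^ 2 +
        ∑ j, (∑ i, leInd (x i) (y j)) ^ 2 + ∑ i, ∑ j, leInd (x i) (y j)) /
        ((n + s) * (n + s + 1)) ^ 2 := by
  have hint : ∀ i j k l : Fin n, Integrable
      (fun w : (Fin (n + 1) → ℝ) × (Fin (n + 1) → ℝ) =>
        (w.1 i.succ * w.1 k.succ) * (w.2 j.succ * w.2 l.succ) *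
          (leInd (x i) (y j) * leInd (x k) (y l)))
      ((weightLaw s n).prod (weightLaw s n)) := fun i j k l => by
    refine (integrable_prod_of_ae_bound hs (by fun_prop) (C := 1) fun w h h' => ?_).mul_const _
    rw [abs_of_nonneg (mul_nonneg (mul_nonneg (h _).1 (h _).1) (mul_nonneg (h' _).1 (h' _).1))]
    exact mul_le_one₀ (mul_le_one₀ (h _).2 (h _).1 (h _).2) (mul_nonneg (h' _).1 (h' _).1)
      (mul_le_one₀ (h' _).2 (h' _).1 (h' _).2)
  have hexp : ∀ w, weightedRankSum x y w ^ 2 = ∑ i, ∑ j, ∑ k, ∑ l,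
      (w.1 (Fin.succ i) * w.1 (Fin.succ k)) * (w.2 (Fin.succ j) * w.2 (Fin.succ l)) *
        (leInd (x i) (y j) * leInd (x k) (y l)) := fun w => by
    rw [sq, weightedRankSum, Finset.sum_mul]
    refine Finset.sum_congr rfl fun i _ => ?_
    rw [Finset.sum_mul]
    refine Finset.sum_congr rfl fun j _ => ?_
    rw [Finset.mul_sum]
    refine Finset.sum_congr rfl fun k _ => ?_
    rw [Finset.mul_sum]
    refine Finset.sum_congr rfl fun l _ => ?_
    ring
  have hval : ∀ i j k l : Fin n, ∫ w, (w.1 (Fin.succ i) * w.1 (Fin.succ k)) *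
      (w.2 (Fin.succ j) * w.2 (Fin.succ l)) * (leInd (x i) (y j) * leInd (x k) (y l))
        ∂((weightLaw s n).prod (weightLaw s n)) =
      (1 + if i = k then 1 else 0) * (1 + if j = l then 1 else 0) *
        (leInd (x i) (y j) * leInd (x k) (y l)) / ((n + s) * (n + s + 1)) ^ 2 := by
    intro i j k l
    rw [integral_mul_const, integral_prod_mul
      (fun w : Fin (n + 1) → ℝ => w i.succ * w k.succ)
      (fun w : Fin (n + 1) → ℝ => w j.succ * w l.succ), integral_mul_weightLaw hs,
      integral_mul_weightLaw hs]
    field_simp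
  simp only [hexp]
  rw [integral_finsetSum _ fun i _ => integrable_finsetSum _ fun j _ =>
    integrable_finsetSum _ fun k _ => integrable_finsetSum _ fun l _ => hint i j k l]
  have step : ∀ i, ∫ w : (Fin (n + 1) → ℝ) × (Fin (n + 1) → ℝ), ∑ j, ∑ k, ∑ l,
      (w.1 (Fin.succ i) * w.1 (Fin.succ k)) * (w.2 (Fin.succ j) * w.2 (Fin.succ l)) *
        (leInd (x i) (y j) * leInd (x k) (y l)) ∂((weightLaw s n).prod (weightLaw s n)) =
      ∑ j, ∑ k, ∑ l, (1 + if i = k then 1 else 0) * (1 + if j = l then 1 else 0) *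
        (leInd (x i) (y j) * leInd (x k) (y l)) / ((n + s) * (n + s + 1)) ^ 2 := by
    intro i
    rw [integral_finsetSum _ fun j _ => integrable_finsetSum _ fun k _ =>
      integrable_finsetSum _ fun l _ => hint i j k l]
    refine Finset.sum_congr rfl fun j _ => ?_
    rw [integral_finsetSum _ fun k _ => integrable_finsetSum _ fun l _ => hint i j k l]
    refine Finset.sum_congr rfl fun k _ => ?_
    rw [integral_finsetSum _ fun l _ => hint i j k l]
    exact Finset.sum_congr rfl fun l _ => hval i j k l
  simp only [step, ← Finset.sum_div]
  congr 1
  have e : ∀ i j k l : Fin n, (1 + if i = k then (1 : ℝ) else 0) * (1 + if j = l then 1 else 0) *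
      (leInd (x i) (y j) * leInd (x k) (y l)) =
      leInd (x i) (y j) * leInd (x k) (y l) +
      (if i = k then leInd (x i) (y j) * leInd (x k) (y l) else 0) +
      (if j = l then leInd (x i) (y j) * leInd (x k) (y l) else 0) +
      (if i = k then if j = l then leInd (x i) (y j) * leInd (x k) (y l) else 0 else 0) := by
    intro i j k l; split_ifs <;> ring
  simp only [e, Finset.sum_add_distrib]
  congr 1
  · congr 1
    · congr 1
      · rw [sq, Finset.sum_mul]
        refine Finset.sum_congr rfl fun i _ => ?_
        rw [Finset.sum_mul]
        refine Finset.sum_congr rfl fun j _ => ?_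
        simp only [Finset.mul_sum]
      · refine Finset.sum_congr rfl fun i _ => ?_
        rw [sq, Finset.sum_mul]
        refine Finset.sum_congr rfl fun j _ => ?_
        rw [Finset.mul_sum, Finset.sum_eq_single i]
        · simp
        · intro k _ hk; simp [hk.symm]
        · simp
    · rw [Finset.sum_comm]
      refine Finset.sum_congr rfl fun j _ => ?_
      rw [sq, Finset.sum_mul]
      refine Finset.sum_congr rfl fun i _ => ?_
      rw [Finset.mul_sum]
      refine Finset.sum_congr rfl fun k _ => ?_
      simp
  · refine Finset.sum_congr rfl fun i _ => Finset.sum_congr rfl fun j _ => ?_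
    rw [Finset.sum_eq_single i]
    · simp only [if_true, Finset.sum_ite_eq, Finset.mem_univ]
      -- An indicator equals its square.
      rw [leInd_eq_ite]; split_ifs <;> norm_num
    · intro k _ hk; simp [hk.symm]
    · simp

lemma integral_lowerDist {s : ℝ} (hs : 0 < s) {n : ℕ} (x y : Fin n → ℝ) :
    ∫ t, t ∂(lowerDist s x y) = (∑ i, ∑ j, leInd (x i) (y j)) / (n + s) ^ 2 := by
  rw [lowerDist, integral_map (measurable_weightedRankSum x y).aemeasurable
    (by fun_prop), integral_weightedRankSum hs]

lemma weightedRankSum_mem_Icc {s : ℝ} (hs : 0 < s) {n : ℕ} (x y : Fin n → ℝ) :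
    ∀ᵐ w ∂((weightLaw s n).prod (weightLaw s n)),
      0 ≤ weightedRankSum x y w ∧ weightedRankSum x y w ≤ 1 := by
  filter_upwards [Measure.quasiMeasurePreserving_fst.ae (ae_weightLaw hs n),
    Measure.quasiMeasurePreserving_snd.ae (ae_weightLaw hs n)] with w hw hw'
  constructor
  · exact Finset.sum_nonneg fun i _ => Finset.sum_nonneg fun j _ =>
      mul_nonneg (mul_nonneg (hw.1 _) (hw'.1 _)) (leInd_nonneg _ _)
  · calc weightedRankSum x y w ≤ ∑ i : Fin n, ∑ j : Fin n, w.1 i.succ * w.2 j.succ :=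
          Finset.sum_le_sum fun i _ => Finset.sum_le_sum fun j _ =>
            mul_le_of_le_one_right (mul_nonneg (hw.1 _) (hw'.1 _)) (leInd_le_one _ _)
      _ = (1 - w.1 0) * (1 - w.2 0) := by
          rw [← Finset.sum_mul_sum]
          congr 1
          · rw [← hw.2, Fin.sum_univ_succ]; ring
          · rw [← hw'.2, Fin.sum_univ_succ]; ring
      _ ≤ 1 := by
          have h1 : w.1 0 ≤ 1 :=
            hw.2 ▸ Finset.single_le_sum (fun j _ => hw.1 j) (Finset.mem_univ 0)
          have h2 : w.2 0 ≤ 1 :=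
            hw'.2 ▸ Finset.single_le_sum (fun j _ => hw'.1 j) (Finset.mem_univ 0)
          exact mul_le_one₀ (sub_le_self _ (hw.1 0)) (sub_nonneg.2 h2) (sub_le_self _ (hw'.1 0))

lemma variance_lowerDist {s : ℝ} (hs : 0 < s) {n : ℕ} (x y : Fin n → ℝ) :
    Var[id; lowerDist s x y] =
      ((∑ i, ∑ j, leInd (x i) (y j)) ^ 2 + ∑ i, (∑ j, leInd (x i) (y j)) ^ 2 +
        ∑ j, (∑ i, leInd (x i) (y j)) ^ 2 + ∑ i, ∑ j, leInd (x i) (y j)) /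
        ((n + s) * (n + s + 1)) ^ 2 - ((∑ i, ∑ j, leInd (x i) (y j)) / (n + s) ^ 2) ^ 2 := by
  have hm := measurable_weightedRankSum x y
  rw [lowerDist, variance_map aemeasurable_id hm.aemeasurable, variance_eq_sub]
  · simp only [Function.id_comp, Pi.pow_apply]
    rw [integral_weightedRankSum hs, integral_weightedRankSum_sq hs]
  · refine MemLp.of_bound (C := 1) hm.aestronglyMeasurable ?_
    filter_upwards [weightedRankSum_mem_Icc hs x y] with w hw
    simpa [abs_of_nonneg hw.1] using hw.2

lemma tendsto_natCast_div_add (s : ℝ) : Tendsto (fun n : ℕ => (n : ℝ) / (n + s)) atTop (𝓝 1) :=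
  tendsto_natCast_div_add_atTop s

lemma mannWhitney_mem_Icc {n : ℕ} (x y : Fin n → ℝ) :
    0 ≤ mannWhitney x y ∧ mannWhitney x y ≤ 1 := by
  constructor
  · exact div_nonneg (Finset.sum_nonneg fun i _ => Finset.sum_nonneg fun j _ => leInd_nonneg _ _)
      (by positivity)
  · refine div_le_one_of_le₀ ?_ (by positivity)
    calc ∑ i, ∑ j, leInd (x i) (y j) ≤ ∑ _i : Fin n, ∑ _j : Fin n, (1 : ℝ) :=
          Finset.sum_le_sum fun i _ => Finset.sum_le_sum fun j _ => leInd_le_one _ _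
      _ = (n : ℝ) ^ 2 := by simp [sq]

section Asymptotics

variable {x y : (n : ℕ) → Fin n → ℝ}

/-- The mean is `U/(n + s)²`. Replacing the denominator by `n²` costs at most `2s/n` because `U/n² ≤
1`; nothing is assumed about the data. -/
lemma tendsto_sqrt_mul_mean_sub {s : ℝ} (hs : 0 < s) :
    Tendsto (fun n : ℕ => √(n : ℝ) * ((∫ t, t ∂(lowerDist s (x n) (y n))) -
      mannWhitney (x n) (y n))) atTop (𝓝 0) := by
  have hlim : Tendsto (fun n : ℕ => 2 * s / √(n : ℝ)) atTop (𝓝 0) :=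
    tendsto_const_nhds.div_atTop (Real.tendsto_sqrt_atTop.comp tendsto_natCast_atTop_atTop)
  refine squeeze_zero_norm' ?_ hlim
  filter_upwards [eventually_gt_atTop 0] with n hn
  have hn : (0 : ℝ) < n := by exact_mod_cast hn
  have hm := mannWhitney_mem_Icc (x n) (y n)
  have hU : ∑ i, ∑ j, leInd (x n i) (y n j) = n ^ 2 * mannWhitney (x n) (y n) := by
    rw [mannWhitney]; field_simp
  rw [integral_lowerDist hs, hU]
  set m := mannWhitney (x n) (y n)
  have e : (n : ℝ) ^ 2 * m / (n + s) ^ 2 - m = -(m * (s * (2 * n + s) / (n + s) ^ 2)) := by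
    field_simp; ring
  have hb : s * (2 * n + s) / (n + s) ^ 2 ≤ 2 * s / n := by
    rw [div_le_div_iff₀ (by positivity) hn]
    nlinarith [mul_pos hs hn, mul_pos hs hs, mul_pos (mul_pos hs hs) hn, pow_pos hs 3]
  rw [e, norm_mul, norm_neg, Real.norm_of_nonneg (Real.sqrt_nonneg _),
    Real.norm_of_nonneg (mul_nonneg hm.1 (by positivity))]
  calc √(n : ℝ) * (m * (s * (2 * n + s) / (n + s) ^ 2)) ≤ √(n : ℝ) * (1 * (2 * s / n)) := by
        gcongr; exact hm.2
    _ = 2 * s / √(n : ℝ) := by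
        have := Real.sq_sqrt hn.le
        field_simp
        nlinarith

lemma tendsto_mean {s : ℝ} (hs : 0 < s) {θ : ℝ}
    (hθ : Tendsto (fun n => mannWhitney (x n) (y n)) atTop (𝓝 θ)) :
    Tendsto (fun n : ℕ => ∫ t, t ∂(lowerDist s (x n) (y n))) atTop (𝓝 θ) := by
  have h := (((tendsto_natCast_div_add s).pow 2).mul hθ)
  rw [one_pow, one_mul] at h
  refine h.congr' ?_
  filter_upwards [eventually_gt_atTop 0] with n hn
  have hn : (0 : ℝ) < n := by exact_mod_cast hn
  rw [integral_lowerDist hs, mannWhitney]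
  field_simp

/-- The squared totals in the second moment and in the squared mean nearly cancel; their difference
is of order `1/n` and supplies the term `-2 θ²`. -/
lemma tendsto_natCast_mul_variance {s : ℝ} (hs : 0 < s) {θ q₁ q₂ : ℝ}
    (hθ : Tendsto (fun n => mannWhitney (x n) (y n)) atTop (𝓝 θ))
    (h₁ : Tendsto (fun n : ℕ => (∑ i, (∑ j, leInd (x n i) (y n j)) ^ 2) / (n : ℝ) ^ 3)
      atTop (𝓝 q₁))
    (h₂ : Tendsto (fun n : ℕ => (∑ j, (∑ i, leInd (x n i) (y n j)) ^ 2) / (n : ℝ) ^ 3)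
      atTop (𝓝 q₂)) :
    Tendsto (fun n : ℕ => (n : ℝ) * Var[id; lowerDist s (x n) (y n)]) atTop
      (𝓝 (q₁ + q₂ - 2 * θ ^ 2)) := by
  have ha := tendsto_natCast_div_add s
  have hb := tendsto_natCast_div_add (s + 1)
  have hinv : Tendsto (fun n : ℕ => ((n : ℝ) + (s + 1))⁻¹) atTop (𝓝 0) :=
    tendsto_inv_atTop_zero.comp
      (tendsto_atTop_add_const_right _ _ tendsto_natCast_atTop_atTop)
  have hninv : Tendsto (fun n : ℕ => ((n : ℝ))⁻¹) atTop (𝓝 0) :=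
    tendsto_inv_atTop_zero.comp tendsto_natCast_atTop_atTop
  -- With `a = n/(n+s)`, `b = n/(n+s+1)` and `m = U/n²`, the scaled variance is exactly `a² b²`
  -- times the row and column terms, plus `a² b² m / n`, minus `m² a⁴ b (2 - 1/(n+s+1))`.
  have h := ((((ha.pow 2).mul (hb.pow 2)).mul (h₁.add h₂)).add
    ((((ha.pow 2).mul (hb.pow 2)).mul hθ).mul hninv)).sub
    ((((hθ.pow 2).mul (ha.pow 4)).mul hb).mul (hinv.const_sub 2))
  have e : (1 : ℝ) ^ 2 * 1 ^ 2 * (q₁ + q₂) + 1 ^ 2 * 1 ^ 2 * θ * 0 - θ ^ 2 * 1 ^ 4 * 1 * (2 - 0) =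
      q₁ + q₂ - 2 * θ ^ 2 := by ring
  rw [e] at h
  refine h.congr' ?_
  filter_upwards [eventually_gt_atTop 0] with n hn
  have hn : (0 : ℝ) < n := by exact_mod_cast hn
  rw [variance_lowerDist hs, mannWhitney]
  have hs1 : (0 : ℝ) < n + (s + 1) := by positivity
  have hs2 : (0 : ℝ) < n + s := by positivity
  rw [show (n : ℝ) + s + 1 = n + (s + 1) by ring]
  field_simp
  ring

end Asymptotics

/-! ### A central limit theorem for weighted sums -/

/-- Exchange the factors one at a time; all the others stay in the unit disc. This turns factorwise
Taylor errors into an error for the characteristic function of a sum. -/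
lemma norm_prod_sub_prod_le_sum {ι : Type*} (S : Finset ι) (z w : ι → ℂ)
    (hz : ∀ i ∈ S, ‖z i‖ ≤ 1) (hw : ∀ i ∈ S, ‖w i‖ ≤ 1) :
    ‖∏ i ∈ S, z i - ∏ i ∈ S, w i‖ ≤ ∑ i ∈ S, ‖z i - w i‖ := by
  classical
  induction S using Finset.induction_on with
  | empty => simp
  | insert i S hi ih =>
    rw [Finset.prod_insert hi, Finset.prod_insert hi, Finset.sum_insert hi]
    have h1 : ‖∏ j ∈ S, w j‖ ≤ 1 := by
      rw [norm_prod]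
      exact Finset.prod_le_one (fun _ _ => norm_nonneg _)
        fun j hj => hw j (Finset.mem_insert_of_mem hj)
    have e : z i * ∏ j ∈ S, z j - w i * ∏ j ∈ S, w j =
        (z i - w i) * ∏ j ∈ S, w j + z i * (∏ j ∈ S, z j - ∏ j ∈ S, w j) := by ring
    rw [e]
    refine (norm_add_le _ _).trans (add_le_add ?_ ?_)
    · rw [norm_mul]
      exact mul_le_of_le_one_right (norm_nonneg _) h1
    · rw [norm_mul]
      exact (mul_le_of_le_one_left (norm_nonneg _) (hz i (Finset.mem_insert_self i S))).trans
        (ih (fun j hj => hz j (Finset.mem_insert_of_mem hj))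
          fun j hj => hw j (Finset.mem_insert_of_mem hj))

/-- The characteristic function of a standardized law agrees with that of the standard normal law
to second order. -/
lemma charFun_sub_exp_isLittleO {Ω : Type*} [MeasurableSpace Ω] {P : Measure Ω}
    [IsProbabilityMeasure P] {ξ : Ω → ℝ} (hξ : AEMeasurable ξ P) (h0 : P[ξ] = 0)
    (h1 : P[ξ ^ 2] = 1) :
    (fun u : ℝ => charFun (P.map ξ) u - Complex.exp (-(u : ℂ) ^ 2 / 2)) =o[𝓝 0]
      fun u : ℝ => u ^ 2 := by
  have hA := taylor_charFun_two hξ h0 h1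
  -- The standard normal law satisfies the same second-order expansion, so subtracting the two
  -- leaves only the remainders.
  have hB := taylor_charFun_two (P := gaussianReal 0 1) (X := id) aemeasurable_id
    (by simp) (by
      have := variance_eq_sub (μ := gaussianReal 0 1) (X := id) (memLp_id_gaussianReal 2)
      rw [variance_id_gaussianReal] at this
      simp only [integral_id_gaussianReal, id] at this ⊢
      simpa using this.symm)
  refine (hA.sub hB).congr_left fun u => ?_
  rw [Measure.map_id, charFun_gaussianReal]
  simp only [Complex.ofReal_zero, mul_zero, zero_mul, NNReal.coe_one, Complex.ofReal_one, one_mul,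
    zero_sub]
  rw [neg_div]
  ring

/-- A central limit theorem for weighted sums of independent standardized variables with
asymptotically negligible weights. -/
theorem tendstoInDistribution_weighted_sum {ι Ω : Type*} [MeasurableSpace Ω] {P : Measure Ω}
    [IsProbabilityMeasure P] {ξ : ι → Ω → ℝ} (hξ : ∀ i, Measurable (ξ i)) (hind : iIndepFun ξ P)
    {ν : Measure ℝ} (hν : ∀ i, P.map (ξ i) = ν) (h0 : ∫ x, x ∂ν = 0) (h1 : ∫ x, x ^ 2 ∂ν = 1)
    (S : ℕ → Finset ι) (b : ℕ → ι → ℝ) {δ : ℕ → ℝ} (hδ : Tendsto δ atTop (𝓝 0))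
    (hb : ∀ n, ∀ i ∈ S n, |b n i| ≤ δ n) {v : ℝ≥0}
    (hv : Tendsto (fun n => ∑ i ∈ S n, b n i ^ 2) atTop (𝓝 v)) :
    TendstoInDistribution (fun n ω => ∑ i ∈ S n, b n i * ξ i ω) atTop id (fun _ => P)
      (gaussianReal 0 v) where
  forall_aemeasurable n := by fun_prop
  tendsto := by
    refine ProbabilityMeasure.tendsto_iff_tendsto_charFun.2 fun t => ?_
    simp only [ProbabilityMeasure.coe_mk, Measure.map_id]
    -- Without an index nothing identifies `ν` as a probability law; then all sums are empty and `v
    -- = 0`.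
    by_cases hι : IsEmpty ι
    · have hS : ∀ n, S n = ∅ := fun n => Finset.eq_empty_of_isEmpty _
      have hv0 : v = 0 := by
        have := tendsto_nhds_unique hv
          (by simp only [hS, Finset.sum_empty]; exact tendsto_const_nhds)
        exact_mod_cast this
      simp [hS, hv0]
    obtain ⟨i₀⟩ := not_isEmpty_iff.1 hι
    have : IsProbabilityMeasure ν := hν i₀ ▸ Measure.isProbabilityMeasure_map (hξ i₀).aemeasurable
    have hchar : ∀ n, charFun (P.map fun ω => ∑ i ∈ S n, b n i * ξ i ω) t =
        ∏ i ∈ S n, charFun ν (b n i * t) := fun n => by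
      have hind' : iIndepFun (fun i ω => b n i * ξ i ω) P :=
        hind.comp (fun i x => b n i * x) (fun i => by fun_prop)
      rw [(hind'.restrict (S n)).charFun_map_fun_finsetSum_eq_prod
        (fun i _ => by fun_prop), Finset.prod_apply]
      refine Finset.prod_congr rfl fun i _ => ?_
      rw [charFun_map_mul_comp (hξ i).aemeasurable, hν i]
    simp only [hchar]
    have hgauss : ∀ n, ∏ i ∈ S n, Complex.exp (-((b n i * t : ℝ) : ℂ) ^ 2 / 2) =
        Complex.exp (-((∑ i ∈ S n, b n i ^ 2 : ℝ) : ℂ) * t ^ 2 / 2) := fun n => by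
      rw [← Complex.exp_sum]
      congr 1
      push_cast
      rw [← Finset.sum_div, ← Finset.sum_neg_distrib, Finset.sum_mul]
      congr 1
      exact Finset.sum_congr rfl fun i _ => by ring
    have hlim : Tendsto (fun n => ∏ i ∈ S n, Complex.exp (-((b n i * t : ℝ) : ℂ) ^ 2 / 2)) atTop
        (𝓝 (charFun (gaussianReal 0 v) t)) := by
      simp only [hgauss]
      rw [charFun_gaussianReal]
      have : Complex.exp (t * (0 : ℝ) * Complex.I - v * t ^ 2 / 2) =
          Complex.exp (-((v : ℝ) : ℂ) * t ^ 2 / 2) := by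
        congr 1; simp; ring
      rw [this]
      have hc : Continuous fun r : ℝ => Complex.exp (-(r : ℂ) * t ^ 2 / 2) := by fun_prop
      exact (hc.tendsto _).comp hv
    -- Each factor differs from its Gaussian counterpart by at most `η (b t)²` once `δ n * |t|` is
    -- below the radius of the Taylor estimate. The uniform smallness of the coefficients replaces a
    -- Lindeberg condition.
    have hdiff : Tendsto (fun n => ∏ i ∈ S n, charFun ν (b n i * t) -
        ∏ i ∈ S n, Complex.exp (-((b n i * t : ℝ) : ℂ) ^ 2 / 2)) atTop (𝓝 0) := by
      have ho := charFun_sub_exp_isLittleO (P := ν) (ξ := id) aemeasurable_id h0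
        (by simpa using h1)
      rw [Measure.map_id] at ho
      obtain ⟨C, hC0, hC⟩ : ∃ C : ℝ, 0 < C ∧ ∀ᶠ n in atTop, ∑ i ∈ S n, b n i ^ 2 ≤ C :=
        ⟨v + 1, by positivity, (hv.eventually_lt_const (lt_add_one (v : ℝ))).mono
          fun _ h => h.le⟩
      rw [Metric.tendsto_nhds]
      intro ε hε
      set η := ε / (2 * C * (t ^ 2 + 1)) with hη
      have hη0 : 0 < η := by positivity
      obtain ⟨r, hr0, hr⟩ := Metric.eventually_nhds_iff.1 (ho.def hη0)
      have hδt : ∀ᶠ n in atTop, δ n * |t| < r := by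
        have := hδ.mul_const |t|
        rw [zero_mul] at this
        exact this.eventually_lt_const hr0
      filter_upwards [hC, hδt] with n hn hnr
      rw [dist_zero_right]
      calc ‖∏ i ∈ S n, charFun ν (b n i * t) -
            ∏ i ∈ S n, Complex.exp (-((b n i * t : ℝ) : ℂ) ^ 2 / 2)‖
          ≤ ∑ i ∈ S n, ‖charFun ν (b n i * t) -
            Complex.exp (-((b n i * t : ℝ) : ℂ) ^ 2 / 2)‖ := by
            refine norm_prod_sub_prod_le_sum _ _ _ (fun i _ => norm_charFun_le_one _) fun i _ => ?_
            rw [Complex.norm_exp, Real.exp_le_one_iff]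
            rw [show -((b n i * t : ℝ) : ℂ) ^ 2 / 2 = ((-(b n i * t) ^ 2 / 2 : ℝ) : ℂ) by
              push_cast; ring, Complex.ofReal_re]
            nlinarith [sq_nonneg (b n i * t)]
        _ ≤ ∑ i ∈ S n, η * (b n i * t) ^ 2 := by
            refine Finset.sum_le_sum fun i hi => ?_
            have hd : dist (b n i * t) 0 < r := by
              rw [dist_zero_right, norm_mul, Real.norm_eq_abs, Real.norm_eq_abs]
              exact (mul_le_mul_of_nonneg_right (hb n i hi) (abs_nonneg t)).trans_lt hnr
            have := hr hd
            rwa [Real.norm_of_nonneg (sq_nonneg _)] at this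
        _ = η * t ^ 2 * ∑ i ∈ S n, b n i ^ 2 := by
            rw [Finset.mul_sum]
            exact Finset.sum_congr rfl fun i _ => by ring
        _ ≤ η * t ^ 2 * C := by gcongr
        _ < ε := by
            rw [hη]
            have : t ^ 2 < t ^ 2 + 1 := lt_add_one _
            rw [div_mul_eq_mul_div, div_mul_eq_mul_div, div_lt_iff₀ (by positivity)]
            nlinarith [mul_pos hε hC0, mul_nonneg (mul_pos hε hC0).le (sq_nonneg t)]
    simpa using hdiff.add hlim

/-- The second moment of a sum of pairwise orthogonal variables. -/
lemma integral_sq_sum_of_orthogonal {ι Ω : Type*} [MeasurableSpace Ω] {P : Measure Ω}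
    (S : Finset ι) {ζ : ι → Ω → ℝ} (hint : ∀ p ∈ S, ∀ q ∈ S, Integrable (fun ω => ζ p ω * ζ q ω) P)
    (horth : ∀ p ∈ S, ∀ q ∈ S, p ≠ q → ∫ ω, ζ p ω * ζ q ω ∂P = 0) :
    Integrable (fun ω => (∑ p ∈ S, ζ p ω) ^ 2) P ∧
    ∫ ω, (∑ p ∈ S, ζ p ω) ^ 2 ∂P = ∑ p ∈ S, ∫ ω, ζ p ω ^ 2 ∂P := by
  have e : ∀ ω, (∑ p ∈ S, ζ p ω) ^ 2 = ∑ p ∈ S, ∑ q ∈ S, ζ p ω * ζ q ω := fun ω => by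
    rw [sq, Finset.sum_mul_sum]
  simp only [e]
  refine ⟨integrable_finsetSum _ fun p hp => integrable_finsetSum _ fun q hq => hint p hp q hq, ?_⟩
  rw [integral_finsetSum _ fun p hp => integrable_finsetSum _ fun q hq => hint p hp q hq]
  refine Finset.sum_congr rfl fun p hp => ?_
  rw [integral_finsetSum _ fun q hq => hint p hp q hq, Finset.sum_eq_single_of_mem p hp
    fun q hq hne => horth p hp q hq hne.symm]
  simp only [sq]

/-- Chebyshev's inequality. -/
lemma tendstoInMeasure_zero_of_integral_sq {Ω : Type*} [MeasurableSpace Ω] {P : Measure Ω}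
    [IsProbabilityMeasure P] {Z : ℕ → Ω → ℝ} (hint : ∀ n, Integrable (fun ω => Z n ω ^ 2) P)
    (h : Tendsto (fun n => ∫ ω, Z n ω ^ 2 ∂P) atTop (𝓝 0)) :
    TendstoInMeasure P Z atTop (fun _ => 0) := by
  rw [tendstoInMeasure_iff_measureReal_norm]
  intro ε hε
  have hlim : Tendsto (fun n => (∫ ω, Z n ω ^ 2 ∂P) / ε ^ 2) atTop (𝓝 0) := by
    simpa using h.div_const (ε ^ 2)
  refine squeeze_zero (fun _ => measureReal_nonneg) (fun n => ?_) hlim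
  rw [le_div_iff₀ (by positivity), mul_comm]
  refine le_trans (le_of_eq ?_) (mul_meas_ge_le_integral_of_nonneg
    (ae_of_all _ fun ω => sq_nonneg (Z n ω)) (hint n) (ε ^ 2))
  congr 2
  ext ω
  simp only [sub_zero, Set.mem_ofPred_eq, Real.norm_eq_abs]
  rw [← sq_abs (Z n ω)]
  exact (pow_le_pow_iff_left₀ hε.le (abs_nonneg _) two_ne_zero).symm

lemma iIndepFun.indepFun_sumElim {Ω β : Type*} [MeasurableSpace Ω] [MeasurableSpace β]
    {P : Measure Ω} {E F : ℕ → Ω → β} (h : iIndepFun (Sum.elim E F) P)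
    (hE : ∀ i, Measurable (E i)) (hF : ∀ i, Measurable (F i)) (n m : ℕ) :
    IndepFun (fun ω (i : Fin n) => E i ω) (fun ω (j : Fin m) => F j ω) P := by
  classical
  have h' := h.indepFun_finset ((Finset.range n).map Function.Embedding.inl)
    ((Finset.range m).map Function.Embedding.inr)
    (Finset.disjoint_left.2 fun a ha hb => by
      obtain ⟨i, -, rfl⟩ := Finset.mem_map.1 ha
      obtain ⟨j, -, hj⟩ := Finset.mem_map.1 hb
      cases hj) (by rintro (i | i); exacts [hE i, hF i])
  have h'' := h'.comp (φ := fun u (i : Fin n) => u ⟨Sum.inl i, Finset.mem_map.2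
      ⟨i, Finset.mem_range.2 i.2, rfl⟩⟩)
    (ψ := fun u (i : Fin m) => u ⟨Sum.inr i, Finset.mem_map.2
      ⟨i, Finset.mem_range.2 i.2, rfl⟩⟩) (by fun_prop) (by fun_prop)
  exact h''

/-! ### Gamma sequences generating the weights -/

/-- Two independent infinite sequences of Gamma variables generating all Dirichlet weights. -/
structure GammaSequences (s : ℝ) {Ω : Type*} [MeasurableSpace Ω] (P : Measure Ω)
    (E F : ℕ → Ω → ℝ) : Prop where
  measurable_left : ∀ i, Measurable (E i)
  measurable_right : ∀ i, Measurable (F i)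
  indep : iIndepFun (Sum.elim E F) P
  law_left_zero : P.map (E 0) = gammaLaw s
  law_right_zero : P.map (F 0) = gammaLaw s
  law_left : ∀ i, P.map (E (i + 1)) = gammaLaw 1
  law_right : ∀ i, P.map (F (i + 1)) = gammaLaw 1

lemma exists_gammaSequences (s : ℝ) : ∃ (Ω : Type) (_ : MeasurableSpace Ω) (P : Measure Ω)
    (E F : ℕ → Ω → ℝ), IsProbabilityMeasure P ∧ GammaSequences s P E F := by
  let a : ℕ → ℝ := fun i => if i = 0 then s else 1
  obtain ⟨Ω, m, P, X, hX, hlaw, hind, hP⟩ := exists_hasLaw_indepFun (fun _ : ℕ ⊕ ℕ => ℝ)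
    (fun k => gammaLaw (Sum.elim a a k))
  refine ⟨Ω, m, P, fun i => X (Sum.inl i), fun i => X (Sum.inr i), hP, fun i => hX _, fun i => hX _,
    ?_, (hlaw _).map_eq, (hlaw _).map_eq, fun i => ?_, fun i => ?_⟩
  · convert hind using 1
    ext (i | i) <;> rfl
  · simpa [a] using (hlaw (Sum.inl (i + 1))).map_eq
  · simpa [a] using (hlaw (Sum.inr (i + 1))).map_eq

namespace GammaSequences

variable {s : ℝ} {Ω : Type*} [MeasurableSpace Ω] {P : Measure Ω} {E F : ℕ → Ω → ℝ}

lemma symm (h : GammaSequences s P E F) : GammaSequences s P F E where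
  measurable_left := h.measurable_right
  measurable_right := h.measurable_left
  indep := by
    have := h.indep.precomp (g := Sum.swap) (Equiv.sumComm ℕ ℕ).injective
    convert this using 1
    ext (i | i) <;> rfl
  law_left_zero := h.law_right_zero
  law_right_zero := h.law_left_zero
  law_left := h.law_right
  law_right := h.law_left

lemma ae_nonneg_left (h : GammaSequences s P E F) : ∀ᵐ ω ∂P, ∀ i, 0 ≤ E i ω := by
  refine ae_all_iff.2 fun i => ?_
  have : ∀ a, P.map (E i) = gammaLaw a → ∀ᵐ ω ∂P, 0 ≤ E i ω := fun a ha =>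
    ae_of_ae_map (h.measurable_left i).aemeasurable (ha ▸ ae_nonneg_gammaLaw a)
  rcases i with _ | i
  · exact this s h.law_left_zero
  · exact this 1 (h.law_left i)

lemma map_pi (h : GammaSequences s P E F) (n : ℕ) :
    P.map (fun ω (i : Fin (n + 1)) => E i ω) =
      Measure.pi fun i => gammaLaw ((Fin.cons s fun _ => 1 : Fin (n + 1) → ℝ) i) := by
  have h1 : iIndepFun (fun i : Fin (n + 1) => E i) P :=
    h.indep.precomp (g := fun i : Fin (n + 1) => (Sum.inl (i : ℕ) : ℕ ⊕ ℕ))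
      (Sum.inl_injective.comp Fin.val_injective)
  rw [iIndepFun.map_fun_eq_pi_map (f := fun i : Fin (n + 1) => E i)
    (fun i => (h.measurable_left i).aemeasurable) h1]
  congr 1
  ext i : 1
  refine Fin.cases ?_ (fun j => ?_) i
  · simpa using h.law_left_zero
  · simpa using h.law_left j

lemma ae_sum_pos (hs : 0 < s) (h : GammaSequences s P E F) :
    ∀ᵐ ω ∂P, ∀ n, 0 < ∑ k ∈ Finset.range (n + 1), E k ω := by
  have h0 : ∀ᵐ ω ∂P, 0 < E 0 ω := ae_of_ae_map (h.measurable_left 0).aemeasurable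
    (h.law_left_zero ▸ ae_pos_gammaLaw hs)
  filter_upwards [h0, h.ae_nonneg_left] with ω h0 hω n
  exact Finset.sum_pos' (fun i _ => hω i) ⟨0, by simp, h0⟩

variable [IsProbabilityMeasure P]

/-- The weights for every `n` are realized on one probability space, so almost sure limits and
Slutsky's theorem become available although the weight laws live on different spaces. -/
lemma map_weights (h : GammaSequences s P E F) (n : ℕ) :
    P.map (fun ω => ((fun i : Fin (n + 1) => E i ω / ∑ k : Fin (n + 1), E k ω),
      fun i : Fin (n + 1) => F i ω / ∑ k : Fin (n + 1), F k ω)) =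
      (weightLaw s n).prod (weightLaw s n) := by
  have hE := h.measurable_left
  have hF := h.measurable_right
  have hind := iIndepFun.indepFun_sumElim h.indep hE hF (n + 1) (n + 1)
  rw [indepFun_iff_map_prod_eq_prod_map_map (by fun_prop) (by fun_prop), h.map_pi, h.symm.map_pi]
    at hind
  rw [weightLaw, dirichlet, Measure.map_prod_map _ _ measurable_dirichlet_normalize
    measurable_dirichlet_normalize, ← hind, Measure.map_map (by fun_prop) (by fun_prop)]
  rfl

/-- The first two moments come from size biasing; integrability from their being nonzero. -/
lemma integral_gammaLaw_one : ∫ x, x - 1 ∂(gammaLaw 1) = 0 ∧ ∫ x, (x - 1) ^ 2 ∂(gammaLaw 1) = 1 ∧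
    MemLp id 2 (gammaLaw 1) := by
  have h1 : ∫ x, x ∂(gammaLaw 1) = 1 := by
    have := isProbabilityMeasure_gammaMeasure (show (0 : ℝ) < 1 + 1 by norm_num) one_pos
    rw [gammaLaw_of_pos one_pos]
    simpa using integral_mul_gammaMeasure_one one_pos (fun _ => 1)
  have h2 : ∫ x, x ^ 2 ∂(gammaLaw 1) = 2 := by
    have := isProbabilityMeasure_gammaMeasure (show (0 : ℝ) < 1 + 1 + 1 by norm_num) one_pos
    rw [gammaLaw_of_pos one_pos]
    have e1 := integral_mul_gammaMeasure_one one_pos (fun x => x)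
    have e2 := integral_mul_gammaMeasure_one (show (0 : ℝ) < 1 + 1 by norm_num) (fun _ => 1)
    simp only [mul_one, one_mul, integral_const, probReal_univ, smul_eq_mul] at e1 e2
    simp only [sq, e1, e2]
    norm_num
  have i1 : Integrable (fun x : ℝ => x) (gammaLaw 1) := .of_integral_ne_zero (by simp [h1])
  have i2 : Integrable (fun x : ℝ => x ^ 2) (gammaLaw 1) := .of_integral_ne_zero (by simp [h2])
  refine ⟨?_, ?_, (memLp_two_iff_integrable_sq aestronglyMeasurable_id).2 i2⟩
  · rw [integral_sub i1 (integrable_const _), h1]; simp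
  · have e : ∀ x : ℝ, (x - 1) ^ 2 = x ^ 2 - (2 * x - 1) := fun x => by ring
    have i3 : Integrable (fun x : ℝ => 2 * x - 1) (gammaLaw 1) :=
      (i1.const_mul 2).sub (integrable_const _)
    simp only [e]
    rw [integral_sub i2 i3, integral_sub (i1.const_mul 2) (integrable_const _),
      integral_const_mul, h1, h2]
    simp

/-- The centered exponential variables. -/
lemma centered_left (h : GammaSequences s P E F) (i : ℕ) :
    ∫ ω, E (i + 1) ω - 1 ∂P = 0 ∧ ∫ ω, (E (i + 1) ω - 1) ^ 2 ∂P = 1 ∧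
      MemLp (fun ω => E (i + 1) ω - 1) 2 P := by
  obtain ⟨h1, h2, h3⟩ := integral_gammaLaw_one
  rw [← h.law_left i] at h1 h2 h3
  have hm := (h.measurable_left (i + 1)).aemeasurable (μ := P)
  rw [integral_map hm (by fun_prop)] at h1 h2
  rw [memLp_map_measure_iff (by fun_prop) hm] at h3
  exact ⟨h1, h2, h3.sub (memLp_const 1)⟩

/-- The variable of index 0 has its own law, so the strong law is applied to the shifted sequence
and the first term vanishes after division by `n`. -/
lemma ae_tendsto_sum_div (h : GammaSequences s P E F) :
    ∀ᵐ ω ∂P, Tendsto (fun n : ℕ => (∑ k ∈ Finset.range (n + 1), E k ω) / n) atTop (𝓝 1) := by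
  have hint : Integrable (E 1) P := by
    have := ((h.centered_left 0).2.2.integrable one_le_two).add (integrable_const (1 : ℝ))
    refine this.congr (ae_of_all _ fun ω => ?_)
    simp
  have hmean : ∫ ω, E 1 ω ∂P = 1 := by
    have h1 := (h.centered_left 0).1
    rw [integral_sub hint (integrable_const _)] at h1
    simp only [integral_const, probReal_univ, smul_eq_mul, mul_one] at h1
    linarith
  have hlaw : ∀ i, IdentDistrib (E (i + 1)) (E 1) P P := fun i =>
    ⟨(h.measurable_left _).aemeasurable, (h.measurable_left _).aemeasurable,
      (h.law_left i).trans (h.law_left 0).symm⟩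
  have hind : Pairwise fun i j => IndepFun (E (i + 1)) (E (j + 1)) P := fun i j hij =>
    h.indep.indepFun (i := Sum.inl (i + 1)) (j := Sum.inl (j + 1)) (by simpa using hij)
  filter_upwards [strong_law_ae_real (fun i => E (i + 1)) hint hind hlaw] with ω hω
  simp only [zero_add, hmean] at hω
  have h0 : Tendsto (fun n : ℕ => E 0 ω / n) atTop (𝓝 0) :=
    tendsto_const_nhds.div_atTop tendsto_natCast_atTop_atTop
  have := hω.add h0
  rw [add_zero] at this
  refine this.congr fun n => ?_
  rw [Finset.sum_range_succ', add_div]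

/-- Weighted sums of products of the centered variables of the two sequences are orthogonal. -/
lemma integral_bilinear_sq (h : GammaSequences s P E F) (n : ℕ) (c : ℕ → ℕ → ℝ) :
    Integrable (fun ω => (∑ i ∈ Finset.range n, ∑ j ∈ Finset.range n,
      (E (i + 1) ω - 1) * (F (j + 1) ω - 1) * c i j) ^ 2) P ∧
    ∫ ω, (∑ i ∈ Finset.range n, ∑ j ∈ Finset.range n,
      (E (i + 1) ω - 1) * (F (j + 1) ω - 1) * c i j) ^ 2 ∂P =
      ∑ i ∈ Finset.range n, ∑ j ∈ Finset.range n, c i j ^ 2 := by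
  have hE := h.measurable_left
  have hF := h.measurable_right
  let ζ : ℕ × ℕ → Ω → ℝ := fun p ω => (E (p.1 + 1) ω - 1) * (F (p.2 + 1) ω - 1) * c p.1 p.2
  have hmeas : ∀ k, Measurable (Sum.elim E F k) := by rintro (i | i); exacts [hE i, hF i]
  have hindep : ∀ i j k l : ℕ, IndepFun (fun ω => (E (i + 1) ω - 1) * (E (k + 1) ω - 1))
      (fun ω => (F (j + 1) ω - 1) * (F (l + 1) ω - 1)) P := fun i j k l =>
    (h.indep.indepFun_prodMk_prodMk hmeas (Sum.inl (i + 1)) (Sum.inl (k + 1)) (Sum.inr (j + 1))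
      (Sum.inr (l + 1)) (by simp) (by simp) (by simp) (by simp)).comp
      (φ := fun u : ℝ × ℝ => (u.1 - 1) * (u.2 - 1)) (ψ := fun u : ℝ × ℝ => (u.1 - 1) * (u.2 - 1))
      (by fun_prop) (by fun_prop)
  have hiE : ∀ {E F : ℕ → Ω → ℝ} (_ : GammaSequences s P E F) (i k : ℕ),
      Integrable (fun ω => (E (i + 1) ω - 1) * (E (k + 1) ω - 1)) P ∧
      ∫ ω, (E (i + 1) ω - 1) * (E (k + 1) ω - 1) ∂P = if i = k then 1 else 0 := by
    intro E F h i k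
    have hE := h.measurable_left
    refine ⟨(h.centered_left i).2.2.integrable_mul (h.centered_left k).2.2, ?_⟩
    split_ifs with hik
    · subst hik
      simpa only [sq] using (h.centered_left i).2.1
    · have hind : IndepFun (fun ω => E (i + 1) ω - 1) (fun ω => E (k + 1) ω - 1) P :=
        (h.indep.indepFun (i := Sum.inl (i + 1)) (j := Sum.inl (k + 1)) (by simpa using hik)).comp
          (φ := fun x : ℝ => x - 1) (ψ := fun x : ℝ => x - 1) (by fun_prop) (by fun_prop)
      rw [hind.integral_fun_mul_eq_mul_integral
        (Measurable.aestronglyMeasurable ((hE _).sub_const 1))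
        (Measurable.aestronglyMeasurable ((hE _).sub_const 1)), (h.centered_left i).1, zero_mul]
  have e : ∀ p q : ℕ × ℕ, (fun ω => ζ p ω * ζ q ω) = fun ω =>
      ((E (p.1 + 1) ω - 1) * (E (q.1 + 1) ω - 1)) * ((F (p.2 + 1) ω - 1) * (F (q.2 + 1) ω - 1)) *
        (c p.1 p.2 * c q.1 q.2) := fun p q => by ext ω; simp only [ζ]; ring
  have hint : ∀ p q : ℕ × ℕ, Integrable (fun ω => ζ p ω * ζ q ω) P := fun p q => by
    rw [e]
    exact ((hindep _ _ _ _).integrable_mul (hiE h _ _).1 (hiE h.symm _ _).1).mul_const _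
  have hval : ∀ p q : ℕ × ℕ, ∫ ω, ζ p ω * ζ q ω ∂P =
      (if p.1 = q.1 then 1 else 0) * (if p.2 = q.2 then 1 else 0) * (c p.1 p.2 * c q.1 q.2) := by
    intro p q
    rw [e, integral_mul_const, (hindep _ _ _ _).integral_fun_mul_eq_mul_integral
      (hiE h _ _).1.aestronglyMeasurable (hiE h.symm _ _).1.aestronglyMeasurable,
      (hiE h _ _).2, (hiE h.symm _ _).2]
  have key := integral_sq_sum_of_orthogonal (P := P) (Finset.range n ×ˢ Finset.range n) (ζ := ζ)
    (fun p _ q _ => hint p q) (fun p _ q _ hne => by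
      rw [hval]
      by_cases h1 : p.1 = q.1
      · have h2 : p.2 ≠ q.2 := fun h2 => hne (Prod.ext h1 h2)
        simp [h2]
      · simp [h1])
  simp only [Finset.sum_product] at key
  refine ⟨key.1, key.2.trans ?_⟩
  refine Finset.sum_congr rfl fun i _ => Finset.sum_congr rfl fun j _ => ?_
  simp only [sq (ζ _ _), hval]
  simp [sq]

end GammaSequences

/-! ### Asymptotic normality for fixed data -/

/-- Hoeffding decomposition of the weighted rank sum. -/
lemma weighted_rank_sum_decomposition (n : ℕ) (c : ℕ → ℕ → ℝ) (e f : ℕ → ℝ) (g h θ : ℝ)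
    (hθ : ∑ i ∈ Finset.range n, ∑ j ∈ Finset.range n, c i j = (n : ℝ) ^ 2 * θ) :
    ∑ i ∈ Finset.range n, ∑ j ∈ Finset.range n, e i * f j * c i j -
      θ * ((∑ i ∈ Finset.range n, e i + g) * (∑ j ∈ Finset.range n, f j + h)) =
    ∑ i ∈ Finset.range n, (∑ j ∈ Finset.range n, c i j - n * θ) * (e i - 1) +
    ∑ j ∈ Finset.range n, (∑ i ∈ Finset.range n, c i j - n * θ) * (f j - 1) +
    ∑ i ∈ Finset.range n, ∑ j ∈ Finset.range n, (e i - 1) * (f j - 1) * (c i j - θ) -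
    θ * (g * (∑ j ∈ Finset.range n, f j + h) + h * (∑ i ∈ Finset.range n, e i + g) - g * h) := by
  have h1 : ∑ i ∈ Finset.range n, (∑ j ∈ Finset.range n, c i j - n * θ) * (e i - 1) =
      ∑ i ∈ Finset.range n, ∑ j ∈ Finset.range n, (c i j - θ) * (e i - 1) := by
    refine Finset.sum_congr rfl fun i _ => ?_
    rw [← Finset.sum_mul, Finset.sum_sub_distrib]; simp
  have h2 : ∑ j ∈ Finset.range n, (∑ i ∈ Finset.range n, c i j - n * θ) * (f j - 1) =
      ∑ i ∈ Finset.range n, ∑ j ∈ Finset.range n, (c i j - θ) * (f j - 1) := by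
    rw [Finset.sum_comm]
    refine Finset.sum_congr rfl fun i _ => ?_
    rw [← Finset.sum_mul, Finset.sum_sub_distrib]; simp
  -- Here `θ` is the exact average of the finite matrix, hence the centred matrix has total 0 and
  -- the constant term disappears.
  have h3 : ∑ i ∈ Finset.range n, ∑ j ∈ Finset.range n, (c i j - θ) = 0 := by
    simp only [Finset.sum_sub_distrib, hθ]
    simp; ring
  have h4 : ∑ i ∈ Finset.range n, ∑ j ∈ Finset.range n, e i * f j * θ =
      (∑ i ∈ Finset.range n, e i) * (∑ j ∈ Finset.range n, f j) * θ := by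
    rw [Finset.sum_mul_sum, Finset.sum_mul]
    exact Finset.sum_congr rfl fun i _ => by rw [Finset.sum_mul]
  rw [h1, h2]
  have h5 : ∑ i ∈ Finset.range n, ∑ j ∈ Finset.range n, e i * f j * c i j =
      ∑ i ∈ Finset.range n, ∑ j ∈ Finset.range n, (c i j - θ) * (e i - 1) +
      ∑ i ∈ Finset.range n, ∑ j ∈ Finset.range n, (c i j - θ) * (f j - 1) +
      ∑ i ∈ Finset.range n, ∑ j ∈ Finset.range n, (e i - 1) * (f j - 1) * (c i j - θ) +
      ∑ i ∈ Finset.range n, ∑ j ∈ Finset.range n, (c i j - θ) +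
      ∑ i ∈ Finset.range n, ∑ j ∈ Finset.range n, e i * f j * θ := by
    simp only [← Finset.sum_add_distrib]
    exact Finset.sum_congr rfl fun i _ => Finset.sum_congr rfl fun j _ => by ring
  rw [h5, h3, h4]
  ring

lemma tendsto_sqrt_div_natCast : Tendsto (fun n : ℕ => √(n : ℝ) / n) atTop (𝓝 0) := by
  have h : Tendsto (fun n : ℕ => (√(n : ℝ))⁻¹) atTop (𝓝 0) :=
    tendsto_inv_atTop_zero.comp (Real.tendsto_sqrt_atTop.comp tendsto_natCast_atTop_atTop)
  exact h.congr fun n => by rw [Real.sqrt_div_self']; simp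

lemma tendstoInMeasure_const_of_ae {Ω : Type*} [MeasurableSpace Ω] {P : Measure Ω}
    [IsProbabilityMeasure P] {Z : ℕ → Ω → ℝ} {c : ℝ} (hm : ∀ n, Measurable (Z n))
    (h : ∀ᵐ ω ∂P, Tendsto (fun n => Z n ω) atTop (𝓝 c)) :
    TendstoInMeasure P Z atTop (fun _ => c) :=
  tendstoInMeasure_of_tendsto_ae (fun n => (hm n).aestronglyMeasurable) h

namespace GammaSequences

variable {s : ℝ} {Ω : Type*} [MeasurableSpace Ω] {P : Measure Ω} {E F : ℕ → Ω → ℝ}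
  [IsProbabilityMeasure P]

/-- The central limit theorem for the linear part of the weighted rank sum. -/
lemma tendstoInDistribution_linear (h : GammaSequences s P E F) {c : ℕ → ℕ → ℝ}
    (hc : ∀ i j, 0 ≤ c i j ∧ c i j ≤ 1) {m : ℕ → ℝ} (hm : ∀ n, 0 ≤ m n ∧ m n ≤ 1)
    (hcm : ∀ n : ℕ, ∑ i ∈ Finset.range n, ∑ j ∈ Finset.range n, c i j = (n : ℝ) ^ 2 * m n)
    {θ q₁ q₂ : ℝ} (hθ : Tendsto m atTop (𝓝 θ))
    (h₁ : Tendsto (fun n : ℕ => (∑ i ∈ Finset.range n, (∑ j ∈ Finset.range n, c i j) ^ 2) /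
      (n : ℝ) ^ 3) atTop (𝓝 q₁))
    (h₂ : Tendsto (fun n : ℕ => (∑ j ∈ Finset.range n, (∑ i ∈ Finset.range n, c i j) ^ 2) /
      (n : ℝ) ^ 3) atTop (𝓝 q₂)) {v : ℝ≥0} (hv : (v : ℝ) = q₁ + q₂ - 2 * θ ^ 2) :
    TendstoInDistribution (fun (n : ℕ) ω => √(n : ℝ) / n ^ 2 *
        (∑ i ∈ Finset.range n, (∑ j ∈ Finset.range n, c i j - n * m n) * (E (i + 1) ω - 1) +
        ∑ j ∈ Finset.range n, (∑ i ∈ Finset.range n, c i j - n * m n) * (F (j + 1) ω - 1)))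
      atTop id (fun _ => P) (gaussianReal 0 v) := by
  have hE := h.measurable_left
  have hF := h.measurable_right
  let ξ : ℕ ⊕ ℕ → Ω → ℝ := Sum.elim (fun i ω => E (i + 1) ω - 1) (fun i ω => F (i + 1) ω - 1)
  let b : ℕ → ℕ ⊕ ℕ → ℝ := fun n => Sum.elim
    (fun i => √(n : ℝ) / n ^ 2 * (∑ j ∈ Finset.range n, c i j - n * m n))
    (fun j => √(n : ℝ) / n ^ 2 * (∑ i ∈ Finset.range n, c i j - n * m n))
  let ν := (gammaLaw 1).map (fun x => x - 1)
  have hξ : ∀ i, Measurable (ξ i) := by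
    rintro (i | i) <;> simp only [ξ, Sum.elim_inl, Sum.elim_inr] <;> fun_prop
  have hind : iIndepFun ξ P := by
    have := (h.indep.precomp (g := Sum.map (· + 1) (· + 1)) (by
      exact Sum.map_injective.2 ⟨add_left_injective 1, add_left_injective 1⟩)).comp
        (fun _ x => x - 1) (fun _ => by fun_prop)
    convert this using 1
    ext (i | i) ω <;> rfl
  have hν : ∀ i, P.map (ξ i) = ν := by
    rintro (i | i)
    · simp only [ν]
      rw [← h.law_left i, Measure.map_map (by fun_prop) (hE _)]
      rfl
    · simp only [ν]
      rw [← h.law_right i, Measure.map_map (by fun_prop) (hF _)]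
      rfl
  have h0 : ∫ x, x ∂ν = 0 := by
    simp only [ν]
    rw [integral_map (by fun_prop) (by fun_prop)]
    exact integral_gammaLaw_one.1
  have h1 : ∫ x, x ^ 2 ∂ν = 1 := by
    simp only [ν]
    rw [integral_map (by fun_prop) (by fun_prop)]
    exact integral_gammaLaw_one.2.1
  -- Centred row and column sums are at most `n` in absolute value, so all coefficients are at most
  -- `√n / n`, which tends to 0.
  have hbound : ∀ (n : ℕ) (t : ℝ), |t| ≤ n → |√(n : ℝ) / n ^ 2 * t| ≤ √(n : ℝ) / n :=
      fun n t ht => by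
    rw [abs_mul, abs_of_nonneg (by positivity)]
    rcases Nat.eq_zero_or_pos n with rfl | hn
    · simp
    have hn : (0 : ℝ) < n := by exact_mod_cast hn
    calc √(n : ℝ) / n ^ 2 * |t| ≤ √(n : ℝ) / n ^ 2 * n := by gcongr
      _ = √(n : ℝ) / n := by field_simp
  have hsum : ∀ (n : ℕ) (a : ℕ → ℝ), (∀ i, 0 ≤ a i ∧ a i ≤ 1) →
      |∑ i ∈ Finset.range n, a i - n * m n| ≤ n := fun n a ha => by
    have u1 : 0 ≤ ∑ i ∈ Finset.range n, a i := Finset.sum_nonneg fun i _ => (ha i).1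
    have u2 : ∑ i ∈ Finset.range n, a i ≤ n := by
      simpa using Finset.sum_le_sum fun i (_ : i ∈ Finset.range n) => (ha i).2
    have hn : (0 : ℝ) ≤ n := by positivity
    rw [abs_le]
    constructor <;> nlinarith [hm n, mul_nonneg hn (hm n).1, mul_le_of_le_one_right hn (hm n).2]
  have hsq : ∀ n : ℕ, (√(n : ℝ) / n ^ 2) ^ 2 = 1 / n ^ 3 := fun n => by
    rcases Nat.eq_zero_or_pos n with rfl | hn
    · simp
    have hn : (0 : ℝ) < n := by exact_mod_cast hn
    rw [div_pow, Real.sq_sqrt hn.le]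
    field_simp
  -- The factor `n / n` is 1 except at `n = 0`, where it makes the identity true.
  have hexp : ∀ (n : ℕ) (r : ℕ → ℝ), ∑ i ∈ Finset.range n, r i = n ^ 2 * m n →
      ∑ i ∈ Finset.range n, (√(n : ℝ) / n ^ 2 * (r i - n * m n)) ^ 2 =
        (∑ i ∈ Finset.range n, r i ^ 2) / n ^ 3 - m n ^ 2 * (n / n) := fun n r hr => by
    simp only [mul_pow, hsq, ← Finset.mul_sum, sub_sq, Finset.sum_add_distrib,
      Finset.sum_sub_distrib, ← Finset.sum_mul, hr, Finset.sum_const, Finset.card_range,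
      nsmul_eq_mul]
    rcases Nat.eq_zero_or_pos n with rfl | hn
    · simp
    have hn : (0 : ℝ) < n := by exact_mod_cast hn
    field_simp
    ring
  have hone : Tendsto (fun n : ℕ => (n : ℝ) / n) atTop (𝓝 1) :=
    tendsto_const_nhds.congr' (by
      filter_upwards [eventually_gt_atTop 0] with n hn
      rw [div_self (by positivity)])
  have key := tendstoInDistribution_weighted_sum hξ hind hν h0 h1
    (fun n => (Finset.range n).disjSum (Finset.range n)) b tendsto_sqrt_div_natCast
    (by
      rintro n (i | i) -
      · exact hbound n _ (hsum n _ fun j => hc i j)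
      · exact hbound n _ (hsum n _ fun j => hc j i)) (v := v) (by
      have hl := ((h₁.sub ((hθ.pow 2).mul hone)).add (h₂.sub ((hθ.pow 2).mul hone)))
      rw [show q₁ - θ ^ 2 * 1 + (q₂ - θ ^ 2 * 1) = v by rw [hv]; ring] at hl
      refine hl.congr fun n => ?_
      rw [Finset.sum_disjSum]
      simp only [b, Sum.elim_inl, Sum.elim_inr]
      rw [hexp n _ (hcm n), hexp n _ (by rw [Finset.sum_comm]; exact hcm n)])
  refine key.congr (fun n => ae_of_all _ fun ω => ?_) (ae_of_all _ fun _ => rfl)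
  simp only [Finset.sum_disjSum, b, ξ, Sum.elim_inl, Sum.elim_inr, mul_add, Finset.mul_sum,
      mul_assoc]

/-- The central limit theorem for the weighted rank sum on the space of the Gamma variables. -/
lemma tendstoInDistribution_rankSum (hs : 0 < s) (h : GammaSequences s P E F) {c : ℕ → ℕ → ℝ}
    (hc : ∀ i j, 0 ≤ c i j ∧ c i j ≤ 1) {m : ℕ → ℝ} (hm : ∀ n, 0 ≤ m n ∧ m n ≤ 1)
    (hcm : ∀ n : ℕ, ∑ i ∈ Finset.range n, ∑ j ∈ Finset.range n, c i j = (n : ℝ) ^ 2 * m n)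
    {θ q₁ q₂ : ℝ} (hθ : Tendsto m atTop (𝓝 θ))
    (h₁ : Tendsto (fun n : ℕ => (∑ i ∈ Finset.range n, (∑ j ∈ Finset.range n, c i j) ^ 2) /
      (n : ℝ) ^ 3) atTop (𝓝 q₁))
    (h₂ : Tendsto (fun n : ℕ => (∑ j ∈ Finset.range n, (∑ i ∈ Finset.range n, c i j) ^ 2) /
      (n : ℝ) ^ 3) atTop (𝓝 q₂)) {v : ℝ≥0} (hv : (v : ℝ) = q₁ + q₂ - 2 * θ ^ 2) (d : ℝ)
    {a : ℕ → ℝ} (ha : Tendsto (fun n : ℕ => √(n : ℝ) * (a n - m n)) atTop (𝓝 0)) :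
    TendstoInDistribution (fun (n : ℕ) ω => √(n : ℝ) *
        (∑ i ∈ Finset.range n, ∑ j ∈ Finset.range n,
          (E (i + 1) ω / ∑ k ∈ Finset.range (n + 1), E k ω) *
          (F (j + 1) ω / ∑ k ∈ Finset.range (n + 1), F k ω) * c i j +
        d * (E 0 ω / ∑ k ∈ Finset.range (n + 1), E k ω +
          F 0 ω / ∑ k ∈ Finset.range (n + 1), F k ω) - a n))
      atTop id (fun _ => P) (gaussianReal 0 v) := by
  have hE := h.measurable_left
  have hF := h.measurable_right
  let S₁ : ℕ → Ω → ℝ := fun n ω => ∑ k ∈ Finset.range (n + 1), E k ω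
  let S₂ : ℕ → Ω → ℝ := fun n ω => ∑ k ∈ Finset.range (n + 1), F k ω
  have mS₁ : ∀ n, Measurable (S₁ n) := fun n => by fun_prop
  have mS₂ : ∀ n, Measurable (S₂ n) := fun n => by fun_prop
  -- the quadratic part
  have hA : TendstoInMeasure P (fun (n : ℕ) ω => √(n : ℝ) / n ^ 2 *
      ∑ i ∈ Finset.range n, ∑ j ∈ Finset.range n,
        (E (i + 1) ω - 1) * (F (j + 1) ω - 1) * (c i j - m n)) atTop (fun _ => 0) := by
    refine tendstoInMeasure_zero_of_integral_sq (fun n => ?_) ?_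
    · simp only [mul_pow]
      exact (h.integral_bilinear_sq n fun i j => c i j - m n).1.const_mul _
    · simp only [mul_pow, integral_const_mul]
      have hb : ∀ n : ℕ, ∫ ω, (∑ i ∈ Finset.range n, ∑ j ∈ Finset.range n,
          (E (i + 1) ω - 1) * (F (j + 1) ω - 1) * (c i j - m n)) ^ 2 ∂P ≤ n ^ 2 := fun n => by
        rw [(h.integral_bilinear_sq n fun i j => c i j - m n).2]
        calc _ ≤ ∑ i ∈ Finset.range n, ∑ j ∈ Finset.range n, (1 : ℝ) :=
              Finset.sum_le_sum fun i _ => Finset.sum_le_sum fun j _ => by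
                have := hc i j; have := hm n
                rw [sq_le_one_iff_abs_le_one, abs_le]; constructor <;> linarith
          _ = _ := by simp [sq]
      refine squeeze_zero (fun n => by positivity) (fun n => ?_)
        (tendsto_inv_atTop_nhds_zero_nat (𝕜 := ℝ))
      rcases Nat.eq_zero_or_pos n with rfl | hn
      · simp
      have hn : (0 : ℝ) < n := by exact_mod_cast hn
      calc _ ≤ (√(n : ℝ) / n ^ 2) ^ 2 * n ^ 2 := by gcongr; exact hb n
        _ = _ := by rw [div_pow, Real.sq_sqrt hn.le]; field_simp
  -- the contribution of the prior weights
  have hB : ∀ᵐ ω ∂P, Tendsto (fun n : ℕ => -(√(n : ℝ) / n ^ 2 * (m n *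
      (E 0 ω * S₂ n ω + F 0 ω * S₁ n ω - E 0 ω * F 0 ω)))) atTop (𝓝 0) := by
    filter_upwards [h.ae_tendsto_sum_div, h.symm.ae_tendsto_sum_div] with ω l₁ l₂
    have hinv : Tendsto (fun n : ℕ => ((n : ℝ))⁻¹) atTop (𝓝 0) :=
      tendsto_inv_atTop_zero.comp tendsto_natCast_atTop_atTop
    have := (tendsto_sqrt_div_natCast.mul (hθ.mul (((l₂.const_mul (E 0 ω)).add
      (l₁.const_mul (F 0 ω))).sub (hinv.const_mul (E 0 ω * F 0 ω))))).neg
    rw [zero_mul, neg_zero] at this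
    refine this.congr fun n => ?_
    simp only [S₁, S₂, div_eq_mul_inv]
    ring
  have hQ : ∀ᵐ ω ∂P, Tendsto (fun n : ℕ => (n : ℝ) ^ 2 / (S₁ n ω * S₂ n ω)) atTop (𝓝 1) := by
    filter_upwards [h.ae_tendsto_sum_div, h.symm.ae_tendsto_sum_div] with ω l₁ l₂
    have := (l₁.mul l₂).inv₀ (by norm_num)
    simp only [mul_one, inv_one] at this
    refine this.congr fun n => ?_
    simp only [S₁, S₂]
    rw [div_mul_div_comm, inv_div, sq]
  -- The prior weights are of order `1/n` almost surely, so neither they nor the change of centring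
  -- from `m n` to `a n` survives multiplication by `√n`.
  have hD : ∀ᵐ ω ∂P, Tendsto (fun n : ℕ => √(n : ℝ) * (d * (E 0 ω / S₁ n ω + F 0 ω / S₂ n ω))
      - √(n : ℝ) * (a n - m n)) atTop (𝓝 0) := by
    filter_upwards [h.ae_tendsto_sum_div, h.symm.ae_tendsto_sum_div] with ω l₁ l₂
    have i₁ := (l₁.inv₀ one_ne_zero).const_mul (E 0 ω)
    have i₂ := (l₂.inv₀ one_ne_zero).const_mul (F 0 ω)
    have := (tendsto_sqrt_div_natCast.mul ((i₁.add i₂).const_mul d)).sub ha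
    rw [zero_mul, sub_zero] at this
    refine this.congr fun n => ?_
    simp only [S₁, S₂]
    rcases Nat.eq_zero_or_pos n with rfl | hn
    · simp
    have hn : (0 : ℝ) < n := by exact_mod_cast hn
    congr 1
    rw [inv_div, inv_div]
    field_simp
  have hlin := h.tendstoInDistribution_linear hc hm hcm hθ h₁ h₂ hv
  -- Slutsky three times: add the bilinear and prior parts, multiply by `n²/(S₁ S₂)`, add the shift
  -- by prior weights and centring.
  have t1 := (hlin.add_of_tendstoInMeasure_const hA (fun n =>
      by fun_prop)).add_of_tendstoInMeasure_const
    (tendstoInMeasure_const_of_ae (fun n => by fun_prop) hB) (fun n => by fun_prop)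
  have t2 := t1.continuous_comp_prodMk_of_tendstoInMeasure_const (g := fun p : ℝ × ℝ => p.1 * p.2)
    (by fun_prop) (tendstoInMeasure_const_of_ae (fun n => by fun_prop) hQ) (fun n => by fun_prop)
  have t3 := t2.add_of_tendstoInMeasure_const
    (tendstoInMeasure_const_of_ae (fun n => by fun_prop) hD) (fun n => by fun_prop)
  refine t3.congr (fun n => ?_) (ae_of_all _ fun _ => by simp)
  filter_upwards [h.ae_sum_pos hs, h.symm.ae_sum_pos hs] with ω p₁ p₂
  rcases Nat.eq_zero_or_pos n with rfl | hn
  · simp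
  have hn : (0 : ℝ) < n := by exact_mod_cast hn
  have p₁ : 0 < S₁ n ω := p₁ n
  have p₂ : 0 < S₂ n ω := p₂ n
  have hdec := weighted_rank_sum_decomposition n c (fun i => E (i + 1) ω) (fun i => F (i + 1) ω)
    (E 0 ω) (F 0 ω) (m n) (hcm n)
  rw [← Finset.sum_range_succ' (fun i => E i ω), ← Finset.sum_range_succ' (fun i => F i ω)] at hdec
  have hV : ∑ i ∈ Finset.range n, ∑ j ∈ Finset.range n,
      (E (i + 1) ω / S₁ n ω) * (F (j + 1) ω / S₂ n ω) * c i j =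
      (∑ i ∈ Finset.range n, ∑ j ∈ Finset.range n, E (i + 1) ω * F (j + 1) ω * c i j) /
        (S₁ n ω * S₂ n ω) := by
    simp only [Finset.sum_div]
    refine Finset.sum_congr rfl fun i _ => Finset.sum_congr rfl fun j _ => ?_
    rw [div_mul_div_comm, div_mul_eq_mul_div]
  change _ = √(n : ℝ) * (∑ i ∈ Finset.range n, ∑ j ∈ Finset.range n,
      (E (i + 1) ω / S₁ n ω) * (F (j + 1) ω / S₂ n ω) * c i j + _ - a n)
  rw [hV]
  have hdec' := eq_add_of_sub_eq hdec
  simp only [Pi.add_apply]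
  rw [hdec']
  simp only [S₁, S₂] at p₁ p₂ ⊢
  field_simp
  ring

end GammaSequences

/-- The central limit theorem for the lower distribution; the term with the factor `d` is the total
weight of the two prior atoms. -/
theorem tendstoInDistribution_weightedRankSum {s : ℝ} (hs : 0 < s) {x y : ℕ → ℝ} {θ q₁ q₂ : ℝ}
    (hθ : Tendsto (fun n => mannWhitney (fun i : Fin n => x i) (fun j : Fin n => y j)) atTop (𝓝 θ))
    (h₁ : Tendsto (fun n : ℕ => (∑ i : Fin n, (∑ j : Fin n, leInd (x i) (y j)) ^ 2) / (n : ℝ) ^ 3)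
      atTop (𝓝 q₁))
    (h₂ : Tendsto (fun n : ℕ => (∑ j : Fin n, (∑ i : Fin n, leInd (x i) (y j)) ^ 2) / (n : ℝ) ^ 3)
      atTop (𝓝 q₂)) {v : ℝ≥0} (hv : (v : ℝ) = q₁ + q₂ - 2 * θ ^ 2) (d : ℝ) :
    TendstoInDistribution (fun (n : ℕ) w => √(n : ℝ) *
        (weightedRankSum (fun i : Fin n => x i) (fun j : Fin n => y j) w + d * (w.1 0 + w.2 0) -
          ∫ t, t ∂lowerDist s (fun i : Fin n => x i) (fun j : Fin n => y j)))
      atTop id (fun n => (weightLaw s n).prod (weightLaw s n)) (gaussianReal 0 v) := by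
  obtain ⟨Ω, _, P, E, F, _, h⟩ := exists_gammaSequences s
  have hE := h.measurable_left
  have hF := h.measurable_right
  have hsum : ∀ n : ℕ, ∑ i ∈ Finset.range n, ∑ j ∈ Finset.range n, leInd (x i) (y j) =
      (n : ℝ) ^ 2 * mannWhitney (fun i : Fin n => x i) (fun j : Fin n => y j) := fun n => by
    rcases Nat.eq_zero_or_pos n with rfl | hn
    · simp
    have hn : (0 : ℝ) < n := by exact_mod_cast hn
    rw [mannWhitney]
    simp only [Finset.sum_range]
    field_simp
  have key := h.tendstoInDistribution_rankSum hs (c := fun i j => leInd (x i) (y j))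
    (fun i j => ⟨leInd_nonneg _ _, leInd_le_one _ _⟩)
    (fun n => mannWhitney_mem_Icc (fun i : Fin n => x i) (fun j : Fin n => y j)) hsum hθ
    (by simpa only [Finset.sum_range] using h₁) (by simpa only [Finset.sum_range] using h₂) hv d
    (tendsto_sqrt_mul_mean_sub hs)
  have hmeas : ∀ n : ℕ, Measurable fun w : (Fin (n + 1) → ℝ) × (Fin (n + 1) → ℝ) => √(n : ℝ) *
        (weightedRankSum (fun i : Fin n => x i) (fun j : Fin n => y j) w + d * (w.1 0 + w.2 0) -
          ∫ t, t ∂lowerDist s (fun i : Fin n => x i) (fun j : Fin n => y j)) := fun n => by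
    have := measurable_weightedRankSum (fun i : Fin n => x i) (fun j : Fin n => y j)
    fun_prop
  refine ⟨fun n => (hmeas n).aemeasurable, aemeasurable_id, ?_⟩
  -- Only the laws for each `n` enter convergence in distribution, so the limit passes from the
  -- Gamma space to the weight spaces.
  refine key.tendsto.congr fun n => ?_
  apply Subtype.ext
  simp only
  rw [← h.map_weights n, Measure.map_map (hmeas n) (by fun_prop)]
  congr 1
  ext ω
  simp only [Function.comp_apply, weightedRankSum, Finset.sum_range, Fin.val_succ, Fin.val_zero]

/-! ### Strong laws for the matrix of comparisons -/

/-- Fourth moment bound for sums of independent centered variables bounded by one. -/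
lemma integral_sum_pow_four_le {Ω : Type*} [MeasurableSpace Ω] {P : Measure Ω}
    [IsProbabilityMeasure P] {ξ : ℕ → Ω → ℝ} (hm : ∀ i, Measurable (ξ i)) (hind : iIndepFun ξ P)
    (h0 : ∀ i, ∫ ω, ξ i ω ∂P = 0) (hb : ∀ i ω, |ξ i ω| ≤ 1) (n : ℕ) :
    ∫ ω, (∑ i ∈ Finset.range n, ξ i ω) ^ 2 ∂P ≤ n ∧
      ∫ ω, (∑ i ∈ Finset.range n, ξ i ω) ^ 4 ∂P ≤ 3 * (n : ℝ) ^ 2 := by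
  induction n with
  | zero => simp
  | succ n ih =>
    let S : Ω → ℝ := fun ω => ∑ i ∈ Finset.range n, ξ i ω
    have hS : Measurable S := by fun_prop
    have hSb : ∀ ω, |S ω| ≤ n := fun ω => by
      simpa using (Finset.abs_sum_le_sum_abs _ _).trans
        (Finset.sum_le_sum fun i (_ : i ∈ Finset.range n) => hb i ω)
    have hSξ : IndepFun S (ξ n) P := by
      have := hind.indepFun_finsetSum_of_notMem hm (s := Finset.range n) (i := n) (by simp)
      convert this using 1
      ext ω; simp [S]
    have hi : ∀ p q : ℕ, Integrable (fun ω => S ω ^ p * ξ n ω ^ q) P := fun p q => by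
      refine Integrable.of_bound (by fun_prop) ((n : ℝ) ^ p) (ae_of_all _ fun ω => ?_)
      rw [norm_mul, norm_pow, norm_pow]
      exact (mul_le_of_le_one_right (by positivity) (pow_le_one₀ (norm_nonneg _) (hb n ω))).trans
        (pow_le_pow_left₀ (norm_nonneg _) (hSb ω) p)
    have hprod : ∀ p q : ℕ, ∫ ω, S ω ^ p * ξ n ω ^ q ∂P =
        (∫ ω, S ω ^ p ∂P) * ∫ ω, ξ n ω ^ q ∂P := fun p q =>
      (hSξ.comp (measurable_id.pow_const p) (measurable_id.pow_const
        q)).integral_fun_mul_eq_mul_integral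
        (by fun_prop) (by fun_prop)
    have hS0 : ∫ ω, S ω ∂P = 0 := by
      simp only [S]
      rw [integral_finsetSum _ fun i _ => Integrable.of_bound (by fun_prop) 1
        (ae_of_all _ fun ω => hb i ω)]
      simp [h0]
    have hle : ∀ q : ℕ, ∫ ω, ξ n ω ^ q ∂P ≤ 1 := fun q => by
      have := integral_mono (μ := P) (by simpa using hi 0 q) (integrable_const (1 : ℝ)) fun ω =>
        (le_abs_self _).trans (by rw [abs_pow]; exact pow_le_one₀ (abs_nonneg _) (hb n ω))
      simpa using this
    have hpos : 0 ≤ ∫ ω, S ω ^ 2 ∂P := integral_nonneg fun ω => sq_nonneg _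
    have hpow : ∀ N : ℕ, ∫ ω, (S ω + ξ n ω) ^ N ∂P = ∑ m ∈ Finset.range (N + 1),
        (∫ ω, S ω ^ m ∂P) * (∫ ω, ξ n ω ^ (N - m) ∂P) * (N.choose m : ℝ) := fun N => by
      simp only [add_pow]
      rw [integral_finsetSum _ fun m _ => (hi _ _).mul_const _]
      simp only [integral_mul_const, hprod]
    have c2 : ∫ ω, (S ω + ξ n ω) ^ 2 ∂P = ∫ ω, S ω ^ 2 ∂P + ∫ ω, ξ n ω ^ 2 ∂P := by
      rw [hpow]
      simp [Finset.sum_range_succ, h0, add_comm]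
    -- The odd terms vanish because `S` and `ξ n` are centred and independent. The induction closes
    -- since `3 n² + 6 n + 1 ≤ 3 (n + 1)²`.
    have c4 : ∫ ω, (S ω + ξ n ω) ^ 4 ∂P = ∫ ω, S ω ^ 4 ∂P +
        6 * ((∫ ω, S ω ^ 2 ∂P) * ∫ ω, ξ n ω ^ 2 ∂P) + ∫ ω, ξ n ω ^ 4 ∂P := by
      rw [hpow]
      simp [Finset.sum_range_succ, h0, hS0, show Nat.choose 4 2 = 6 from rfl]
      ring
    simp only [Finset.sum_range_succ]
    change ∫ ω, (S ω + ξ n ω) ^ 2 ∂P ≤ _ ∧ ∫ ω, (S ω + ξ n ω) ^ 4 ∂P ≤ _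
    obtain ⟨ih2, ih4⟩ := ih
    change ∫ ω, S ω ^ 2 ∂P ≤ _ at ih2
    change ∫ ω, S ω ^ 4 ∂P ≤ _ at ih4
    rw [c2, c4]
    push_cast
    refine ⟨by linarith [hle 2], ?_⟩
    nlinarith [hle 2, hle 4, mul_le_mul_of_nonneg_left (hle 2) hpos]

/-- Nonnegative variables with summable expectations tend to zero almost surely. -/
lemma ae_tendsto_zero_of_integral_le {Ω : Type*} [MeasurableSpace Ω] {P : Measure Ω}
    {Z : ℕ → Ω → ℝ} (hint : ∀ n, Integrable (Z n) P) (h0 : ∀ n ω, 0 ≤ Z n ω) {u : ℕ → ℝ}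
    (hu : Summable u) (h : ∀ n, ∫ ω, Z n ω ∂P ≤ u n) :
    ∀ᵐ ω ∂P, Tendsto (fun n => Z n ω) atTop (𝓝 0) := by
  -- The series has finite expectation, so it converges almost surely and its terms tend to 0.
  have hfin : ∫⁻ ω, ∑' n, ENNReal.ofReal (Z n ω) ∂P ≠ ∞ := by
    rw [lintegral_tsum fun n => (hint n).aemeasurable.ennreal_ofReal]
    refine ne_top_of_le_ne_top hu.tsum_ofReal_ne_top (ENNReal.tsum_le_tsum fun n => ?_)
    rw [← ofReal_integral_eq_lintegral_ofReal (hint n) (ae_of_all _ (h0 n))]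
    exact ENNReal.ofReal_le_ofReal (h n)
  filter_upwards [ae_lt_top' (AEMeasurable.tsum fun n =>
    (hint n).aemeasurable.ennreal_ofReal) hfin] with ω hω
  have := (ENNReal.tendsto_toReal ENNReal.zero_ne_top).comp
    (ENNReal.tendsto_atTop_zero_of_tsum_ne_top hω.ne)
  exact this.congr fun n => ENNReal.toReal_ofReal (h0 n ω)

/-- The mean absolute value tends to zero if the mean fourth power does. -/
lemma tendsto_mean_abs_of_pow_four {d : ℕ → ℕ → ℝ}
    (h : Tendsto (fun n : ℕ => (∑ i ∈ Finset.range n, d n i ^ 4) / n) atTop (𝓝 0)) :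
    Tendsto (fun n : ℕ => (∑ i ∈ Finset.range n, |d n i|) / n) atTop (𝓝 0) := by
  have hs : Tendsto (fun n : ℕ => √√((∑ i ∈ Finset.range n, d n i ^ 4) / n)) atTop (𝓝 0) := by
    simpa using h.sqrt.sqrt
  refine squeeze_zero (fun n => by positivity) (fun n => ?_) hs
  refine Real.le_sqrt_of_sq_le (Real.le_sqrt_of_sq_le ?_)
  rcases Nat.eq_zero_or_pos n with rfl | hn
  · simp
  have hn : (0 : ℝ) < n := by exact_mod_cast hn
  -- Cauchy–Schwarz twice bounds the mean absolute value by the fourth root of the mean fourth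
  -- power.
  have a := sq_sum_le_card_mul_sum_sq (s := Finset.range n) (f := fun i => |d n i|)
  have b := sq_sum_le_card_mul_sum_sq (s := Finset.range n) (f := fun i => d n i ^ 2)
  simp only [Finset.card_range, sq_abs, ← pow_mul] at a b
  have hA : 0 ≤ ∑ i ∈ Finset.range n, d n i ^ 2 := by positivity
  rw [div_pow, div_pow, div_le_div_iff₀ (by positivity) hn]
  have a2 := pow_le_pow_left₀ (sq_nonneg _) a 2
  calc _ ≤ (n * ∑ i ∈ Finset.range n, d n i ^ 2) ^ 2 * n := by gcongr
    _ = n ^ 3 * (∑ i ∈ Finset.range n, d n i ^ 2) ^ 2 := by ring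
    _ ≤ n ^ 3 * (n * ∑ i ∈ Finset.range n, d n i ^ (2 * 2)) := by gcongr
    _ = _ := by ring

/-- Two independent sequences, each of identically distributed independent variables. -/
structure TwoSample {Ω : Type*} [MeasurableSpace Ω] (P : Measure Ω) (X Y : ℕ → Ω → ℝ) : Prop where
  measurable_left : ∀ i, Measurable (X i)
  measurable_right : ∀ j, Measurable (Y j)
  indep : iIndepFun (Sum.elim X Y) P
  ident_left : ∀ i, IdentDistrib (X i) (X 0) P P
  ident_right : ∀ j, IdentDistrib (Y j) (Y 0) P P

/-- The conditional mean of the kernel `k` given its first argument. -/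
noncomputable def rowMean {Ω : Type*} [MeasurableSpace Ω] (P : Measure Ω) (Y : ℕ → Ω → ℝ)
    (k : ℝ → ℝ → ℝ) (a : ℝ) : ℝ := ∫ ω, k a (Y 0 ω) ∂P

namespace TwoSample

variable {Ω : Type*} [MeasurableSpace Ω] {P : Measure Ω} {X Y : ℕ → Ω → ℝ} {k : ℝ → ℝ → ℝ}

lemma symm (h : TwoSample P X Y) : TwoSample P Y X where
  measurable_left := h.measurable_right
  measurable_right := h.measurable_left
  indep := by
    have := h.indep.precomp (g := Sum.swap) Sum.swap_leftInverse.injective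
    convert this using 1
    ext (i | i) ω <;> rfl
  ident_left := h.ident_right
  ident_right := h.ident_left

lemma measurable_kernel (h : TwoSample P X Y) (hk : Measurable (Function.uncurry k)) (a : ℝ)
    (j : ℕ) : Measurable fun ω => k a (Y j ω) :=
  hk.comp (measurable_const.prodMk (h.measurable_right j))

lemma integral_kernel (h : TwoSample P X Y) (hk : Measurable (Function.uncurry k)) (a : ℝ)
    (j : ℕ) : ∫ ω, k a (Y j ω) ∂P = rowMean P Y k a :=
  ((h.ident_right j).comp (u := k a) (hk.comp measurable_prodMk_left)).integral_eq

lemma iIndepFun_left (h : TwoSample P X Y) : iIndepFun X P :=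
  h.indep.precomp (g := Sum.inl) Sum.inl_injective

lemma iIndepFun_right (h : TwoSample P X Y) : iIndepFun Y P := h.symm.iIndepFun_left

variable [IsProbabilityMeasure P]

/-- Integration of a bounded function of the two samples, one sample after the other. -/
lemma integral_eq (h : TwoSample P X Y) (n : ℕ) {f : (Fin n → ℝ) → (Fin n → ℝ) → ℝ}
    (hf : Measurable (Function.uncurry f)) {C : ℝ} (hC : ∀ x y, |f x y| ≤ C) :
    ∫ ω, f (fun i => X i ω) (fun j => Y j ω) ∂P =
      ∫ ω, ∫ ω', f (fun i => X i ω) (fun j => Y j ω') ∂P ∂P := by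
  have hX := h.measurable_left
  have hY := h.measurable_right
  have hind := iIndepFun.indepFun_sumElim h.indep hX hY n n
  rw [indepFun_iff_map_prod_eq_prod_map_map (by fun_prop) (by fun_prop)] at hind
  have mX : Measurable fun ω (i : Fin n) => X i ω := by fun_prop
  have mY : Measurable fun ω (i : Fin n) => Y i ω := by fun_prop
  have : IsProbabilityMeasure (P.map fun ω (i : Fin n) => X i ω) :=
    Measure.isProbabilityMeasure_map mX.aemeasurable
  have : IsProbabilityMeasure (P.map fun ω (i : Fin n) => Y i ω) :=
    Measure.isProbabilityMeasure_map mY.aemeasurable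
  calc _ = ∫ z, Function.uncurry f z ∂(P.map fun ω => ((fun i : Fin n => X i ω), fun i : Fin n =>
      Y i ω)) := by
        rw [integral_map (by fun_prop) hf.aestronglyMeasurable]
        rfl
    _ = ∫ x, ∫ y, f x y ∂(P.map fun ω (i : Fin n) => Y i ω) ∂(P.map fun ω (i : Fin n) => X i ω)
        := by
        rw [hind, integral_prod _ (Integrable.of_bound hf.aestronglyMeasurable C
          (ae_of_all _ fun z => hC z.1 z.2))]
        rfl
    _ = _ := by
        have hm := hf.stronglyMeasurable.integral_prod_right'
          (ν := P.map fun ω (i : Fin n) => Y i ω)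
        simp only [Function.uncurry_apply_pair] at hm
        rw [integral_map mX.aemeasurable hm.aestronglyMeasurable]
        refine integral_congr_ae (ae_of_all _ fun ω => ?_)
        exact integral_map mY.aemeasurable (hf.comp measurable_prodMk_left).aestronglyMeasurable

lemma measurable_rowMean (h : TwoSample P X Y) (hk : Measurable (Function.uncurry k)) :
    Measurable (rowMean P Y k) := by
  have hY := h.measurable_right 0
  have : Measurable fun z : ℝ × Ω => k z.1 (Y 0 z.2) :=
    hk.comp (measurable_fst.prodMk (hY.comp measurable_snd))
  exact this.stronglyMeasurable.integral_prod_right'.measurable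

lemma rowMean_mem (h : TwoSample P X Y) (hk : Measurable (Function.uncurry k))
    (hk01 : ∀ a b, 0 ≤ k a b ∧ k a b ≤ 1) (a : ℝ) : 0 ≤ rowMean P Y k a ∧ rowMean P Y k a ≤ 1 := by
  refine ⟨integral_nonneg fun ω => (hk01 _ _).1, ?_⟩
  have := integral_mono (μ := P) (Integrable.of_bound (h.measurable_kernel hk a
      0).aestronglyMeasurable 1
    (ae_of_all _ fun ω => by simpa [abs_of_nonneg (hk01 a (Y 0 ω)).1] using (hk01 a (Y 0 ω)).2))
    (integrable_const (1 : ℝ)) (fun ω => (hk01 a (Y 0 ω)).2)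
  simpa [rowMean] using this

/-- Fourth moment bound for the deviation of the row means of the kernel matrix. -/
lemma integral_row_pow_four_le (h : TwoSample P X Y) (hk : Measurable (Function.uncurry k))
    (hk01 : ∀ a b, 0 ≤ k a b ∧ k a b ≤ 1) (n i : ℕ) :
    ∫ ω, (∑ j ∈ Finset.range n, (k (X i ω) (Y j ω) - rowMean P Y k (X i ω))) ^ 4 ∂P ≤
      3 * (n : ℝ) ^ 2 := by
  have hr := h.measurable_rowMean hk
  have hb : ∀ a b, |k a b - rowMean P Y k a| ≤ 1 := fun a b => by
    have := hk01 a b; have := h.rowMean_mem hk hk01 a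
    rw [abs_le]; constructor <;> linarith
  have hrow : ∀ a, ∫ ω, (∑ j ∈ Finset.range n, (k a (Y j ω) - rowMean P Y k a)) ^ 4 ∂P ≤
      3 * (n : ℝ) ^ 2 := fun a => by
    refine (integral_sum_pow_four_le (ξ := fun j ω => k a (Y j ω) - rowMean P Y k a)
      (fun j => (h.measurable_kernel hk a j).sub_const _) ?_ (fun j => ?_)
      (fun j ω => hb _ _) n).2
    · exact h.iIndepFun_right.comp (fun _ b => k a b - rowMean P Y k a)
        (fun _ => (hk.comp measurable_prodMk_left).sub_const _)
    · rw [integral_sub (Integrable.of_bound (h.measurable_kernel hk a j).aestronglyMeasurable 1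
        (ae_of_all _ fun ω => by simpa [abs_of_nonneg (hk01 a (Y j ω)).1] using (hk01 a (Y j ω)).2))
        (integrable_const _), h.integral_kernel hk]
      simp
  -- A common length for both samples, large enough to contain the index `i` on the left and the
  -- first `n` indices on the right; `X i` can then be frozen while integrating over `Y`.
  let N := max n (i + 1)
  have hiN : i < N := lt_of_lt_of_le (Nat.lt_succ_self i) (le_max_right _ _)
  let f : (Fin N → ℝ) → (Fin N → ℝ) → ℝ := fun x y => (∑ j ∈ Finset.univ.filter (fun j : Fin N =>
      (j : ℕ) < n),
    (k (x ⟨i, hiN⟩) (y j) - rowMean P Y k (x ⟨i, hiN⟩))) ^ 4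
  have hf : ∀ ω ω', f (fun i => X i ω) (fun j => Y j ω') =
      (∑ j ∈ Finset.range n, (k (X i ω) (Y j ω') - rowMean P Y k (X i ω))) ^ 4 := fun ω ω' => by
    simp only [f]
    congr 1
    rw [Finset.sum_filter, ← Finset.sum_range
      (fun j => if j < n then k (X i ω) (Y j ω') - rowMean P Y k (X i ω) else 0),
      ← Finset.sum_filter]
    congr 1
    ext j
    simp only [Finset.mem_filter, Finset.mem_range]
    exact ⟨fun q => q.2, fun q => ⟨lt_of_lt_of_le q (le_max_left _ _), q⟩⟩
  have key := h.integral_eq N (f := f) (C := (N : ℝ) ^ 4) (by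
    refine Measurable.pow_const (Finset.measurable_sum _ fun j _ => ?_) 4
    exact (hk.comp (f := fun z : (Fin N → ℝ) × (Fin N → ℝ) => (z.1 ⟨i, hiN⟩, z.2 j))
        (by fun_prop)).sub
      (hr.comp (by fun_prop))) (fun x y => by
    simp only [f]
    rw [abs_pow]
    refine pow_le_pow_left₀ (abs_nonneg _) ((Finset.abs_sum_le_sum_abs _ _).trans ?_) 4
    refine (Finset.sum_le_sum fun j _ => hb _ _).trans ?_
    simpa using Finset.card_filter_le (Finset.univ : Finset (Fin N)) (fun j => (j : ℕ) < n))
  simp only [hf] at key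
  rw [key]
  have hdom := integral_mono_of_nonneg (μ := P) (f := fun ω => ∫ ω', (∑ j ∈ Finset.range n,
    (k (X i ω) (Y j ω') - rowMean P Y k (X i ω))) ^ 4 ∂P) (g := fun _ => 3 * (n : ℝ) ^ 2)
    (ae_of_all _ fun ω => integral_nonneg fun ω' => by positivity) (integrable_const _)
    (ae_of_all _ fun ω => hrow _)
  simpa using hdom

/-- Strong laws for the mean of the kernel matrix and for the squares of its row sums. -/
theorem ae_tendsto (h : TwoSample P X Y) (hk : Measurable (Function.uncurry k))
    (hk01 : ∀ a b, 0 ≤ k a b ∧ k a b ≤ 1) :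
    ∀ᵐ ω ∂P,
      Tendsto (fun n : ℕ => (∑ i ∈ Finset.range n, ∑ j ∈ Finset.range n, k (X i ω) (Y j ω)) /
        (n : ℝ) ^ 2) atTop (𝓝 (∫ ω, rowMean P Y k (X 0 ω) ∂P)) ∧
      Tendsto (fun n : ℕ => (∑ i ∈ Finset.range n, (∑ j ∈ Finset.range n, k (X i ω) (Y j ω)) ^ 2) /
        (n : ℝ) ^ 3) atTop (𝓝 (∫ ω, rowMean P Y k (X 0 ω) ^ 2 ∂P)) := by
  have hX := h.measurable_left
  have hr := h.measurable_rowMean hk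
  have hrm := h.rowMean_mem hk hk01
  have hkm : ∀ i j, Measurable fun ω => k (X i ω) (Y j ω) := fun i j =>
    hk.comp ((hX i).prodMk (h.measurable_right j))
  have hslln : ∀ p : ℕ, ∀ᵐ ω ∂P, Tendsto (fun n : ℕ =>
      (∑ i ∈ Finset.range n, rowMean P Y k (X i ω) ^ p) / n) atTop
      (𝓝 (∫ ω, rowMean P Y k (X 0 ω) ^ p ∂P)) := fun p => by
    refine strong_law_ae_real (fun i ω => rowMean P Y k (X i ω) ^ p) ?_ (fun i j hij => ?_)
        fun i => ?_
    · refine Integrable.of_bound ((hr.comp (hX 0)).pow_const p).aestronglyMeasurable 1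
        (ae_of_all _ fun ω => ?_)
      rw [norm_pow, Real.norm_of_nonneg (hrm _).1]
      exact pow_le_one₀ (hrm _).1 (hrm _).2
    · exact (h.iIndepFun_left.indepFun hij).comp (hr.pow_const p) (hr.pow_const p)
    · exact (h.ident_left i).comp (hr.pow_const p)
  let d : ℕ → ℕ → Ω → ℝ := fun n i ω =>
    (∑ j ∈ Finset.range n, k (X i ω) (Y j ω)) / n - rowMean P Y k (X i ω)
  have hd : ∀ n : ℕ, 0 < n → ∀ i ω, d n i ω ^ 4 =
      (∑ j ∈ Finset.range n, (k (X i ω) (Y j ω) - rowMean P Y k (X i ω))) ^ 4 / (n : ℝ) ^ 4 :=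
    fun n hn i ω => by
    have hn : (0 : ℝ) < n := by exact_mod_cast hn
    simp only [d]
    rw [← div_pow, Finset.sum_sub_distrib, Finset.sum_const, Finset.card_range, nsmul_eq_mul]
    congr 1
    field_simp
  have hdm : ∀ n i, Measurable (d n i) := fun n i =>
    ((Finset.measurable_sum _ fun j _ => hkm i j).div_const _).sub (hr.comp (hX i))
  have hd1 : ∀ n i ω, |d n i ω| ≤ 1 := fun n i ω => by
    have a : (∑ j ∈ Finset.range n, k (X i ω) (Y j ω)) / n ≤ 1 := by
      refine div_le_one_of_le₀ ?_ (by positivity)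
      simpa using Finset.sum_le_sum fun j (_ : j ∈ Finset.range n) => (hk01 (X i ω) (Y j ω)).2
    have b : 0 ≤ (∑ j ∈ Finset.range n, k (X i ω) (Y j ω)) / n :=
      div_nonneg (Finset.sum_nonneg fun j _ => (hk01 _ _).1) (by positivity)
    have c := hrm (X i ω)
    simp only [d]
    rw [abs_le]; constructor <;> linarith
  have hdint : ∀ n i, Integrable (fun ω => d n i ω ^ 4) P := fun n i =>
    Integrable.of_bound ((hdm n i).pow_const 4).aestronglyMeasurable 1 (ae_of_all _ fun ω => by
      rw [norm_pow]; exact pow_le_one₀ (norm_nonneg _) (hd1 n i ω))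
  have hdev : ∀ᵐ ω ∂P, Tendsto (fun n : ℕ => (∑ i ∈ Finset.range n, d n i ω ^ 4) / n) atTop (𝓝 0)
      := by
    -- Fourth moments make the expected average deviation `O(1/n²)`, which is summable; second
    -- moments would give only `O(1/n)`.
    refine ae_tendsto_zero_of_integral_le (u := fun n : ℕ => 3 * (1 / (n : ℝ) ^ 2))
      (fun n => (integrable_finsetSum _ fun i _ => hdint n i).div_const _)
      (fun n ω => by positivity) ((Real.summable_one_div_nat_pow.2 one_lt_two).mul_left 3)
        fun n => ?_
    rcases Nat.eq_zero_or_pos n with rfl | hn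
    · simp
    rw [integral_div, integral_finsetSum _ fun i _ => hdint n i]
    have hb : ∀ i, ∫ ω, d n i ω ^ 4 ∂P ≤ 3 * (n : ℝ) ^ 2 / n ^ 4 := fun i => by
      simp only [hd n hn, integral_div]
      gcongr
      exact h.integral_row_pow_four_le hk hk01 n i
    have hn : (0 : ℝ) < n := by exact_mod_cast hn
    calc _ ≤ (∑ _i ∈ Finset.range n, 3 * (n : ℝ) ^ 2 / (n : ℝ) ^ 4) / (n : ℝ) :=
          div_le_div_of_nonneg_right (Finset.sum_le_sum fun i _ => hb i) hn.le
      _ = _ := by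
          rw [Finset.sum_const, Finset.card_range, nsmul_eq_mul]
          field_simp
  filter_upwards [hslln 1, hslln 2, hdev] with ω s₁ s₂ hω
  simp only [pow_one] at s₁
  have habs := tendsto_mean_abs_of_pow_four (d := fun n i => d n i ω) hω
  have hRow : ∀ (n i : ℕ), (∑ j ∈ Finset.range n, k (X i ω) (Y j ω)) / n =
      rowMean P Y k (X i ω) + d n i ω := fun n i => by simp only [d]; ring
  constructor
  · have : Tendsto (fun n : ℕ => (∑ i ∈ Finset.range n, d n i ω) / n) atTop (𝓝 0) := by
      refine squeeze_zero_norm (fun n => ?_) habs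
      rw [norm_div, Real.norm_natCast]
      gcongr
      exact Finset.abs_sum_le_sum_abs _ _
    have := s₁.add this
    rw [add_zero] at this
    refine this.congr fun n => ?_
    rw [← add_div, ← Finset.sum_add_distrib, ← Finset.sum_congr rfl fun i _ => hRow n i,
      ← Finset.sum_div, div_div, sq]
  -- The squared normalized row sum exceeds the squared row mean by `d (2 κ + d)`, and the second
  -- factor is at most 3 in absolute value.
  · have : Tendsto (fun n : ℕ => (∑ i ∈ Finset.range n, d n i ω * (2 * rowMean P Y k (X i ω)
      + d n i ω)) / n)
        atTop (𝓝 0) := by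
      have h3 : Tendsto (fun n : ℕ => 3 * ((∑ i ∈ Finset.range n, |d n i ω|) / n)) atTop (𝓝 0) := by
        simpa using habs.const_mul 3
      refine squeeze_zero_norm (fun n => ?_) h3
      rw [norm_div, Real.norm_natCast, ← mul_div_assoc, Finset.mul_sum]
      gcongr
      refine (Finset.abs_sum_le_sum_abs _ _).trans (Finset.sum_le_sum fun i _ => ?_)
      rw [abs_mul, mul_comm]
      gcongr
      have := abs_le.1 (hd1 n i ω)
      have := hrm (X i ω)
      rw [abs_le]; constructor <;> linarith
    have := s₂.add this
    rw [add_zero] at this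
    refine this.congr fun n => ?_
    rw [← add_div, ← Finset.sum_add_distrib, pow_succ (n : ℝ) 2, ← div_div,
      Finset.sum_div _ _ ((n : ℝ) ^ 2)]
    congr 1
    refine Finset.sum_congr rfl fun i _ => ?_
    rw [← div_pow, hRow]
    ring

end TwoSample

/-! ### Central limit theorem for the mean of a kernel matrix -/

/-- Sums of independent asymptotically normal sequences are asymptotically normal. -/
lemma TendstoInDistribution.add_gaussianReal_of_indepFun {Ω : Type*} [MeasurableSpace Ω]
    {P : Measure Ω} [IsProbabilityMeasure P] {A B : ℕ → Ω → ℝ} {v w : ℝ≥0}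
    (hA : TendstoInDistribution A atTop id (fun _ => P) (gaussianReal 0 v))
    (hB : TendstoInDistribution B atTop id (fun _ => P) (gaussianReal 0 w))
    (hind : ∀ n, IndepFun (A n) (B n) P) :
    TendstoInDistribution (fun n ω => A n ω + B n ω) atTop id (fun _ => P)
      (gaussianReal 0 (v + w)) where
  forall_aemeasurable n := (hA.forall_aemeasurable n).add (hB.forall_aemeasurable n)
  tendsto := by
    refine ProbabilityMeasure.tendsto_iff_tendsto_charFun.2 fun t => ?_
    have a := ProbabilityMeasure.tendsto_iff_tendsto_charFun.1 hA.tendsto t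
    have b := ProbabilityMeasure.tendsto_iff_tendsto_charFun.1 hB.tendsto t
    simp only [ProbabilityMeasure.coe_mk, Measure.map_id] at a b ⊢
    have hlim : charFun (gaussianReal 0 (v + w)) t =
        charFun (gaussianReal 0 v) t * charFun (gaussianReal 0 w) t := by
      simp only [charFun_gaussianReal, ← Complex.exp_add]
      congr 1
      push_cast
      ring
    rw [hlim]
    refine (a.mul b).congr fun n => ?_
    rw [(hind n).charFun_map_fun_add_eq_mul (hA.forall_aemeasurable n) (hB.forall_aemeasurable n)]
    rfl

namespace TwoSample

variable {Ω : Type*} [MeasurableSpace Ω] {P : Measure Ω} {X Y : ℕ → Ω → ℝ} {k : ℝ → ℝ → ℝ}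
  [IsProbabilityMeasure P]

lemma integral_kernel_pair (h : TwoSample P X Y) (hk : Measurable (Function.uncurry k)) {C : ℝ}
    (hC : ∀ a b, |k a b| ≤ C) :
    ∫ ω, k (X 0 ω) (Y 0 ω) ∂P = ∫ ω, rowMean P Y k (X 0 ω) ∂P :=
  h.integral_eq 1 (f := fun x y => k (x 0) (y 0)) (C := C)
    (hk.comp (f := fun z : (Fin 1 → ℝ) × (Fin 1 → ℝ) => (z.1 0, z.2 0)) (by fun_prop))
    fun x y => hC _ _

lemma integral_rowMean_swap (h : TwoSample P X Y) (hk : Measurable (Function.uncurry k)) {C : ℝ}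
    (hC : ∀ a b, |k a b| ≤ C) :
    ∫ ω, rowMean P X (fun b a => k a b) (Y 0 ω) ∂P = ∫ ω, rowMean P Y k (X 0 ω) ∂P := by
  rw [← h.integral_kernel_pair hk hC, ← h.symm.integral_kernel_pair (k := fun b a => k a b)
    (hk.comp measurable_swap) fun _ _ => hC _ _]

/-- Two entries of the kernel matrix in different columns are conditionally independent given the
first sample. -/
lemma integral_kernel_mul_kernel (h : TwoSample P X Y) (hk : Measurable (Function.uncurry k))
    {C : ℝ} (hC : ∀ a b, |k a b| ≤ C) (i m : ℕ) {j l : ℕ} (hjl : j ≠ l) :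
    ∫ ω, k (X i ω) (Y j ω) * k (X m ω) (Y l ω) ∂P =
      ∫ ω, rowMean P Y k (X i ω) * rowMean P Y k (X m ω) ∂P := by
  let N := i + m + j + l + 1
  have hf : Measurable (Function.uncurry fun x y : Fin N → ℝ =>
      k (x ⟨i, by omega⟩) (y ⟨j, by omega⟩) * k (x ⟨m, by omega⟩) (y ⟨l, by omega⟩)) :=
    (hk.comp (f := fun z : (Fin N → ℝ) × (Fin N → ℝ) =>
      (z.1 ⟨i, by omega⟩, z.2 ⟨j, by omega⟩)) (by fun_prop)).mul
    (hk.comp (f := fun z : (Fin N → ℝ) × (Fin N → ℝ) =>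
      (z.1 ⟨m, by omega⟩, z.2 ⟨l, by omega⟩)) (by fun_prop))
  have key := h.integral_eq N hf (C := C * C) (fun x y => by
    rw [abs_mul]
    exact mul_le_mul (hC _ _) (hC _ _) (abs_nonneg _) ((abs_nonneg _).trans (hC 0 0)))
  simp only at key
  rw [key]
  refine integral_congr_ae (ae_of_all _ fun ω => ?_)
  have hind : IndepFun (fun ω' => k (X i ω) (Y j ω')) (fun ω' => k (X m ω) (Y l ω')) P :=
    (h.iIndepFun_right.indepFun hjl).comp (hk.comp measurable_prodMk_left)
      (hk.comp measurable_prodMk_left)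
  simp only
  rw [hind.integral_fun_mul_eq_mul_integral (h.measurable_kernel hk _ _).aestronglyMeasurable
    (h.measurable_kernel hk _ _).aestronglyMeasurable, h.integral_kernel hk, h.integral_kernel hk]

/-- The degenerate part of the kernel has a negligible contribution. -/
lemma tendstoInMeasure_degenerate (h : TwoSample P X Y) (hk : Measurable (Function.uncurry k))
    {C : ℝ} (hC : ∀ a b, |k a b| ≤ C) (h₁ : ∀ a, rowMean P Y k a = 0)
    (h₂ : ∀ b, rowMean P X (fun b a => k a b) b = 0) :
    TendstoInMeasure P (fun (n : ℕ) ω => √(n : ℝ) / n ^ 2 *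
      ∑ i ∈ Finset.range n, ∑ j ∈ Finset.range n, k (X i ω) (Y j ω)) atTop (fun _ => 0) := by
  have hkm : ∀ i j, Measurable fun ω => k (X i ω) (Y j ω) := fun i j =>
    hk.comp ((h.measurable_left i).prodMk (h.measurable_right j))
  have hC0 : 0 ≤ C := (abs_nonneg _).trans (hC 0 0)
  have hsq := fun n : ℕ => integral_sq_sum_of_orthogonal (P := P)
    (Finset.range n ×ˢ Finset.range n) (ζ := fun p ω => k (X p.1 ω) (Y p.2 ω))
    (fun p _ q _ => Integrable.of_bound ((hkm _ _).mul (hkm _ _)).aestronglyMeasurable (C * C)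
      (ae_of_all _ fun ω => by
        rw [norm_mul]
        exact mul_le_mul (hC _ _) (hC _ _) (abs_nonneg _) hC0))
    (fun p _ q _ hpq => by
      -- Distinct entries differ in a row or in a column. Conditioning on the other sample factors
      -- their product into conditional means, which vanish.
      by_cases hj : p.2 = q.2
      · have hi : p.1 ≠ q.1 := fun hi => hpq (Prod.ext hi hj)
        have := h.symm.integral_kernel_mul_kernel (k := fun b a => k a b)
          (hk.comp measurable_swap) (fun _ _ => hC _ _) p.2 q.2 hi
        rw [this]
        simp [h₂]
      · rw [h.integral_kernel_mul_kernel hk hC p.1 q.1 hj]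
        simp [h₁])
  simp only [Finset.sum_product] at hsq
  refine tendstoInMeasure_zero_of_integral_sq (fun n => ?_) ?_
  · simp only [mul_pow]
    exact (hsq n).1.const_mul _
  · simp only [mul_pow, integral_const_mul]
    have hb : ∀ n : ℕ, ∫ ω, (∑ i ∈ Finset.range n, ∑ j ∈ Finset.range n,
        k (X i ω) (Y j ω)) ^ 2 ∂P ≤ n ^ 2 * C ^ 2 := fun n => by
      rw [(hsq n).2]
      calc _ ≤ ∑ i ∈ Finset.range n, ∑ j ∈ Finset.range n, C ^ 2 := by
            refine Finset.sum_le_sum fun i _ => Finset.sum_le_sum fun j _ => ?_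
            have := integral_mono_of_nonneg (μ := P) (f := fun ω => k (X i ω) (Y j ω) ^ 2)
              (g := fun _ => C ^ 2) (ae_of_all _ fun ω => sq_nonneg _) (integrable_const _)
              (ae_of_all _ fun ω => sq_le_sq' (abs_le.1 (hC _ _)).1 (abs_le.1 (hC _ _)).2)
            simpa using this
        _ = _ := by simp; ring
    have hlim := (tendsto_inv_atTop_nhds_zero_nat (𝕜 := ℝ)).mul_const (C ^ 2)
    rw [zero_mul] at hlim
    refine squeeze_zero (fun n => by positivity) (fun n => ?_) hlim
    rcases Nat.eq_zero_or_pos n with rfl | hn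
    · simp
    have hn : (0 : ℝ) < n := by exact_mod_cast hn
    calc _ ≤ (√(n : ℝ) / n ^ 2) ^ 2 * (n ^ 2 * C ^ 2) := by gcongr; exact hb n
      _ = _ := by rw [div_pow, Real.sq_sqrt hn.le]; field_simp

lemma variance_rowMean (h : TwoSample P X Y) (hk : Measurable (Function.uncurry k))
    (hk01 : ∀ a b, 0 ≤ k a b ∧ k a b ≤ 1) :
    MemLp (fun ω => rowMean P Y k (X 0 ω)) 2 P ∧
    Var[fun ω => rowMean P Y k (X 0 ω); P] = ∫ ω, rowMean P Y k (X 0 ω) ^ 2 ∂P -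
      (∫ ω, rowMean P Y k (X 0 ω) ∂P) ^ 2 := by
  have hr := h.measurable_rowMean hk
  have hrm := h.rowMean_mem hk hk01
  have hL : MemLp (fun ω => rowMean P Y k (X 0 ω)) 2 P :=
    MemLp.of_bound (hr.comp (h.measurable_left 0)).aestronglyMeasurable 1
      (ae_of_all _ fun ω => by simpa [abs_of_nonneg (hrm (X 0 ω)).1] using (hrm (X 0 ω)).2)
  exact ⟨hL, variance_eq_sub hL⟩

/-- The central limit theorem for the mean of the kernel matrix. -/
theorem tendstoInDistribution_mean (h : TwoSample P X Y) (hk : Measurable (Function.uncurry k))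
    (hk01 : ∀ a b, 0 ≤ k a b ∧ k a b ≤ 1) {θ : ℝ} (hθ : ∫ ω, rowMean P Y k (X 0 ω) ∂P = θ)
    {v : ℝ≥0} (hv : (v : ℝ) = ∫ ω, rowMean P Y k (X 0 ω) ^ 2 ∂P +
      ∫ ω, rowMean P X (fun b a => k a b) (Y 0 ω) ^ 2 ∂P - 2 * θ ^ 2) :
    TendstoInDistribution (fun (n : ℕ) ω => √(n : ℝ) *
        ((∑ i ∈ Finset.range n, ∑ j ∈ Finset.range n, k (X i ω) (Y j ω)) / (n : ℝ) ^ 2 - θ))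
      atTop id (fun _ => P) (gaussianReal 0 v) := by
  have hX := h.measurable_left
  have hY := h.measurable_right
  have hk' : Measurable (Function.uncurry fun b a => k a b) := hk.comp measurable_swap
  set κ := rowMean P Y k with hκ
  set ψ := rowMean P X (fun b a => k a b) with hψ
  have mκ : Measurable κ := h.measurable_rowMean hk
  have mψ : Measurable ψ := h.symm.measurable_rowMean hk'
  have κ01 := h.rowMean_mem hk hk01
  have ψ01 := h.symm.rowMean_mem hk' fun _ _ => hk01 _ _
  have kabs : ∀ a b, |k a b| ≤ 1 := fun a b => by
    rw [abs_of_nonneg (hk01 a b).1]; exact (hk01 a b).2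
  obtain ⟨Lκ, vκ⟩ := h.variance_rowMean hk hk01
  obtain ⟨Lψ, vψ⟩ := h.symm.variance_rowMean hk' fun _ _ => hk01 _ _
  have hψθ : ∫ ω, ψ (Y 0 ω) ∂P = θ := by rw [hψ, h.integral_rowMean_swap hk kabs, hθ]
  have hclt : ∀ {Z : ℕ → Ω → ℝ} {g : ℝ → ℝ} (_ : iIndepFun Z P)
      (_ : ∀ i, IdentDistrib (Z i) (Z 0) P P) (_ : Measurable g)
      (_ : MemLp (fun ω => g (Z 0 ω)) 2 P) (_ : ∫ ω, g (Z 0 ω) ∂P = θ),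
      TendstoInDistribution (fun (n : ℕ) ω =>
        (√(n : ℝ))⁻¹ * (∑ i ∈ Finset.range n, g (Z i ω) - n * θ)) atTop id (fun _ => P)
        (gaussianReal 0 Var[fun ω => g (Z 0 ω); P].toNNReal) := fun {Z g} hi hid hg hL hm => by
    have := tendstoInDistribution_inv_sqrt_mul_sum_sub (X := fun i ω => g (Z i ω)) (P := P)
      (Y := id) HasLaw.id hL (hi.comp (fun _ => g) fun _ => hg) fun i => (hid i).comp hg
    rwa [hm] at this
  -- The Hoeffding projection: the sums of `κ (X i)` and of `ψ (Y j)` are independent and each obeys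
  -- the classical central limit theorem.
  have hsum := TendstoInDistribution.add_gaussianReal_of_indepFun
    (hclt h.iIndepFun_left h.ident_left mκ Lκ hθ)
    (hclt h.iIndepFun_right h.ident_right mψ Lψ hψθ) fun n => by
      have := (iIndepFun.indepFun_sumElim h.indep hX hY n n).comp
        (φ := fun z : Fin n → ℝ => (√(n : ℝ))⁻¹ * (∑ i, κ (z i) - n * θ))
        (ψ := fun z : Fin n → ℝ => (√(n : ℝ))⁻¹ * (∑ i, ψ (z i) - n * θ))
        (by fun_prop) (by fun_prop)
      simpa only [Finset.sum_range, Function.comp_def] using this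
  have hvar : Var[fun ω => κ (X 0 ω); P].toNNReal + Var[fun ω => ψ (Y 0 ω); P].toNNReal = v := by
    rw [← Real.toNNReal_add (variance_nonneg _ _) (variance_nonneg _ _), vκ, vψ, hθ, hψθ,
      ← Real.toNNReal_coe (r := v), hv]
    congr 1
    ring
  rw [hvar] at hsum
  -- The remainder after projection; both of its conditional means are 0, so it is negligible at
  -- this scale.
  let H : ℝ → ℝ → ℝ := fun a b => k a b - κ a - ψ b + θ
  have mH : Measurable (Function.uncurry H) :=
    ((hk.sub (mκ.comp measurable_fst)).sub (mψ.comp measurable_snd)).add_const _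
  have θ01 : 0 ≤ θ ∧ θ ≤ 1 := by
    have a := integral_mono (Lκ.integrable one_le_two) (integrable_const (μ := P) (1 : ℝ))
      fun ω => (κ01 (X 0 ω)).2
    rw [hθ] at a
    exact ⟨hθ ▸ integral_nonneg fun ω => (κ01 (X 0 ω)).1, by simpa using a⟩
  have hH : ∀ a b, |H a b| ≤ 2 := fun a b => by
    have := hk01 a b; have := κ01 a; have := ψ01 b
    simp only [H]
    rw [abs_le]; constructor <;> linarith
  have kint : ∀ a, Integrable (fun ω => k a (Y 0 ω)) P := fun a =>
    Integrable.of_bound (h.measurable_kernel hk a 0).aestronglyMeasurable 1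
      (ae_of_all _ fun ω => kabs _ _)
  have kint' : ∀ b, Integrable (fun ω => k (X 0 ω) b) P := fun b =>
    Integrable.of_bound (h.symm.measurable_kernel hk' b 0).aestronglyMeasurable 1
      (ae_of_all _ fun ω => kabs _ _)
  have hlin : ∀ {f g : Ω → ℝ} (_ : Integrable f P) (_ : Integrable g P) (c : ℝ),
      ∫ ω, (f ω - g ω + c) ∂P = ∫ ω, f ω ∂P - ∫ ω, g ω ∂P + c := fun {f g} hf hg c => by
    have := integral_add (hf.sub hg) (integrable_const (μ := P) c)
    simp only [Pi.sub_apply, integral_sub hf hg, integral_const, probReal_univ, one_smul] at this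
    exact this
  have hdeg := h.tendstoInMeasure_degenerate mH hH (fun a => by
    have := hlin (kint a) (Lψ.integrable one_le_two) (θ - κ a)
    rw [hψθ] at this
    have e : ∫ ω, k a (Y 0 ω) ∂P = κ a := rfl
    calc rowMean P Y H a = ∫ ω, (k a (Y 0 ω) - ψ (Y 0 ω) + (θ - κ a)) ∂P :=
          integral_congr_ae (ae_of_all _ fun ω => by simp only [H]; ring)
      _ = 0 := by rw [this, e]; ring) (fun b => by
    have := hlin (kint' b) (Lκ.integrable one_le_two) (θ - ψ b)
    rw [hθ] at this
    have e : ∫ ω, k (X 0 ω) b ∂P = ψ b := rfl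
    calc rowMean P X (fun b a => H a b) b = ∫ ω, (k (X 0 ω) b - κ (X 0 ω) + (θ - ψ b)) ∂P :=
          integral_congr_ae (ae_of_all _ fun ω => by simp only [H]; ring)
      _ = 0 := by rw [this, e]; ring)
  have key := hsum.add_of_tendstoInMeasure_const hdeg fun n =>
    (Measurable.const_mul (Finset.measurable_sum _ fun i _ => Finset.measurable_sum _ fun j _ =>
      mH.comp ((hX i).prodMk (hY j))) _).aemeasurable
  refine key.congr (fun n => ae_of_all _ fun ω => ?_) (ae_of_all _ fun _ => by simp)
  simp only [Pi.add_apply]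
  rcases Nat.eq_zero_or_pos n with rfl | hn
  · simp
  have hn : (0 : ℝ) < n := by exact_mod_cast hn
  simp only [H, Finset.sum_add_distrib, Finset.sum_sub_distrib, Finset.sum_const,
    Finset.card_range, nsmul_eq_mul, ← Finset.mul_sum]
  rw [show (√(n : ℝ))⁻¹ = √(n : ℝ) / n by rw [Real.sqrt_div_self']; simp]
  field_simp
  ring

end TwoSample

/-! ### The comparison kernel and the variance `σ²` -/

lemma measurable_leInd : Measurable (Function.uncurry leInd) := by
  have : Function.uncurry leInd = fun z : ℝ × ℝ => if z.1 ≤ z.2 then (1 : ℝ) else 0 := by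
    ext z; exact leInd_eq_ite _ _
  rw [this]
  exact Measurable.ite (measurableSet_le measurable_fst measurable_snd) measurable_const
    measurable_const

lemma leInd_mem (a b : ℝ) : 0 ≤ leInd a b ∧ leInd a b ≤ 1 := ⟨leInd_nonneg _ _, leInd_le_one _ _⟩

lemma abs_leInd_le (a b : ℝ) : |leInd a b| ≤ 1 := by
  rw [abs_of_nonneg (leInd_nonneg _ _)]; exact leInd_le_one _ _

/-- Special to the order: lying above two points means lying above their maximum. Positivity of the
variance rests on this. -/
lemma leInd_mul_leInd (a b c : ℝ) : leInd a c * leInd b c = leInd (max a b) c := by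
  simp only [leInd_eq_ite, max_le_iff, ite_and]
  split_ifs <;> norm_num

namespace TwoSample

variable {Ω : Type*} [MeasurableSpace Ω] {P : Measure Ω} {X Y : ℕ → Ω → ℝ}
  [IsProbabilityMeasure P]

/-- The asymptotic variance is positive in the non-degenerate case. -/
lemma asymptotic_variance (h : TwoSample P X Y) {θ : ℝ}
    (hθ : ∫ ω, rowMean P Y leInd (X 0 ω) ∂P = θ) :
    0 ≤ ∫ ω, rowMean P Y leInd (X 0 ω) ^ 2 ∂P +
      ∫ ω, rowMean P X (fun b a => leInd a b) (Y 0 ω) ^ 2 ∂P - 2 * θ ^ 2 ∧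
    (0 < θ → θ < 1 → 0 < ∫ ω, rowMean P Y leInd (X 0 ω) ^ 2 ∂P +
      ∫ ω, rowMean P X (fun b a => leInd a b) (Y 0 ω) ^ 2 ∂P - 2 * θ ^ 2) := by
  have hk' : Measurable (Function.uncurry fun b a => leInd a b) :=
    measurable_leInd.comp measurable_swap
  have mκ := h.measurable_rowMean measurable_leInd
  obtain ⟨Lκ, vκ⟩ := h.variance_rowMean measurable_leInd leInd_mem
  obtain ⟨Lψ, vψ⟩ := h.symm.variance_rowMean hk' fun _ _ => leInd_mem _ _
  rw [h.integral_rowMean_swap measurable_leInd abs_leInd_le] at vψ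
  rw [hθ] at vκ vψ
  have pκ := variance_nonneg (fun ω => rowMean P Y leInd (X 0 ω)) P
  have pψ := variance_nonneg (fun ω => rowMean P X (fun b a => leInd a b) (Y 0 ω)) P
  refine ⟨by linarith, fun h0 h1 => ?_⟩
  by_contra! hcon
  -- The quantity is a sum of two variances. If it vanished, `κ(X)` would equal `θ` almost surely
  -- and `ψ(Y)` would have second moment `θ²`. That second moment is the probability that `X 0` and
  -- `X 1` both lie at or below `Y 0`, which is now computed in another way.
  have hκ := ae_eq_integral_of_variance_eq_zero Lκ (by linarith)
  have hψ0 : ∫ ω, rowMean P X (fun b a => leInd a b) (Y 0 ω) ^ 2 ∂P = θ ^ 2 := by linarith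
  rw [hθ] at hκ
  have hκ1 := (h.ident_left 1).symm.ae_snd (p := fun a => rowMean P Y leInd a = θ)
    (mκ (measurableSet_singleton θ)) hκ
  have e1 := h.symm.integral_kernel_mul_kernel hk' (C := 1) (fun _ _ => abs_leInd_le _ _) 0 0
    (zero_ne_one (α := ℕ))
  simp only [← sq] at e1
  rw [hψ0] at e1
  have e2 := h.integral_eq 2 (f := fun x y => leInd (x 0) (y 0) * leInd (x 1) (y 0)) (C := 1)
    ((measurable_leInd.comp (f := fun z : (Fin 2 → ℝ) × (Fin 2 → ℝ) => (z.1 0, z.2 0))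
      (by fun_prop)).mul (measurable_leInd.comp
      (f := fun z : (Fin 2 → ℝ) × (Fin 2 → ℝ) => (z.1 1, z.2 0)) (by fun_prop)))
    (fun x y => by rw [leInd_mul_leInd]; exact abs_leInd_le _ _)
  have e3 : ∫ ω, ∫ ω', leInd (X 0 ω) (Y 0 ω') * leInd (X 1 ω) (Y 0 ω') ∂P ∂P = θ := by
    have : ∀ᵐ ω ∂P, ∫ ω', leInd (X 0 ω) (Y 0 ω') * leInd (X 1 ω) (Y 0 ω') ∂P = θ := by
      filter_upwards [hκ, hκ1] with ω a b
      simp only [leInd_mul_leInd]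
      -- The maximum is one of the two points and `κ` equals `θ` at both. So the probability is `θ`,
      -- whence `θ² = θ`, excluded for `0 < θ < 1`.
      rcases max_choice (X 0 ω) (X 1 ω) with m | m <;> rw [m]
      exacts [a, b]
    rw [integral_congr_ae this]
    simp
  have e4 : θ ^ 2 = θ := by
    rw [← e1]
    exact e2.trans e3
  nlinarith

/-- Entries sharing a row are conditionally independent given the `X` sample, so their mixed moment
is that of the squared row mean; columns are symmetric. -/
lemma cov_eq (h : TwoSample P X Y) {θ : ℝ} (hθ : ∫ ω, rowMean P Y leInd (X 0 ω) ∂P = θ) :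
    cov[fun ω => leInd (X 0 ω) (Y 0 ω), fun ω => leInd (X 0 ω) (Y 1 ω); P] =
      ∫ ω, rowMean P Y leInd (X 0 ω) ^ 2 ∂P - θ ^ 2 ∧
    cov[fun ω => leInd (X 0 ω) (Y 0 ω), fun ω => leInd (X 1 ω) (Y 0 ω); P] =
      ∫ ω, rowMean P X (fun b a => leInd a b) (Y 0 ω) ^ 2 ∂P - θ ^ 2 := by
  have hX := h.measurable_left
  have hY := h.measurable_right
  have hk' : Measurable (Function.uncurry fun b a => leInd a b) :=
    measurable_leInd.comp measurable_swap
  have hL : ∀ i j, MemLp (fun ω => leInd (X i ω) (Y j ω)) 2 P := fun i j =>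
    MemLp.of_bound (measurable_leInd.comp ((hX i).prodMk (hY j))).aestronglyMeasurable 1
      (ae_of_all _ fun ω => abs_leInd_le _ _)
  have hpair : ∀ i j, IndepFun (X i) (Y j) P := fun i j =>
    h.indep.indepFun (i := Sum.inl i) (j := Sum.inr j) (by simp)
  have hmean : ∀ i j, ∫ ω, leInd (X i ω) (Y j ω) ∂P = θ := fun i j => by
    rw [← hθ, ← h.integral_kernel_pair measurable_leInd abs_leInd_le]
    exact (((h.ident_left i).prodMk (h.ident_right j) (hpair i j) (hpair 0 0)).comp
      measurable_leInd).integral_eq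
  have e1 := h.integral_kernel_mul_kernel measurable_leInd abs_leInd_le 0 0 (zero_ne_one (α := ℕ))
  have e2 := h.symm.integral_kernel_mul_kernel hk' (C := 1) (fun _ _ => abs_leInd_le _ _) 0 0
    (zero_ne_one (α := ℕ))
  simp only [← sq] at e1 e2
  rw [covariance_eq_sub (hL 0 0) (hL 0 1), covariance_eq_sub (hL 0 0) (hL 1 0), hmean, hmean, hmean]
  simp only [Pi.mul_apply, e1, e2, sq, and_self]

/-- The almost sure limits of the statistics that determine the lower distribution. -/
lemma ae_tendsto_mannWhitney (h : TwoSample P X Y) {θ : ℝ}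
    (hθ : ∫ ω, rowMean P Y leInd (X 0 ω) ∂P = θ) :
    ∀ᵐ ω ∂P,
      Tendsto (fun n => mannWhitney (sample X n ω) (sample Y n ω)) atTop (𝓝 θ) ∧
      Tendsto (fun n : ℕ => (∑ i : Fin n, (∑ j : Fin n, leInd (X i ω) (Y j ω)) ^ 2) / (n : ℝ) ^ 3)
        atTop (𝓝 (∫ ω, rowMean P Y leInd (X 0 ω) ^ 2 ∂P)) ∧
      Tendsto (fun n : ℕ => (∑ j : Fin n, (∑ i : Fin n, leInd (X i ω) (Y j ω)) ^ 2) / (n : ℝ) ^ 3)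
        atTop (𝓝 (∫ ω, rowMean P X (fun b a => leInd a b) (Y 0 ω) ^ 2 ∂P)) := by
  filter_upwards [h.ae_tendsto measurable_leInd leInd_mem,
    h.symm.ae_tendsto (k := fun b a => leInd a b) (measurable_leInd.comp measurable_swap)
      fun _ _ => leInd_mem _ _] with ω h₁ h₂
  simp only [Finset.sum_range] at h₁ h₂
  exact ⟨hθ ▸ h₁.1, h₁.2, h₂.2⟩

end TwoSample

/-! ### Normal tails and the limit at the boundary -/

section Tail

variable {Ω : ℕ → Type*} [∀ n, MeasurableSpace (Ω n)] {μ : (n : ℕ) → Measure (Ω n)}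
  [∀ n, IsProbabilityMeasure (μ n)] {T : (n : ℕ) → Ω n → ℝ} {v : ℝ≥0}

lemma tendsto_measureReal_gt (hT : TendstoInDistribution T atTop id μ (gaussianReal 0 v)) {t : ℝ}
    (ht : gaussianReal 0 v {t} = 0) :
    Tendsto (fun n => (μ n).real {ω | t < T n ω}) atTop (𝓝 (1 - cdf (gaussianReal 0 v) t)) := by
  have key := ProbabilityMeasure.tendsto_measure_of_null_frontier_of_tendsto' hT.tendsto
    (E := Set.Ioi t) (by simpa [frontier_Ioi] using ht)
  simp only [ProbabilityMeasure.coe_mk, Measure.map_id] at key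
  have key' := (ENNReal.tendsto_toReal (measure_ne_top _ _)).comp key
  rw [cdf_eq_real, ← probReal_compl_eq_one_sub measurableSet_Iic, Set.compl_Iic]
  refine key'.congr fun n => ?_
  simp only [Function.comp_apply]
  rw [Measure.map_apply_of_aemeasurable (hT.forall_aemeasurable n) measurableSet_Ioi]
  rfl

/-- Excluding `t = 0` covers the degenerate case `v = 0`, where the law is the point mass at 0.
Consistency can thus be proved without assuming positive variance. -/
lemma gaussianReal_singleton_eq_zero {t : ℝ} (ht : t ≠ 0) (v : ℝ≥0) :
    gaussianReal 0 v {t} = 0 := by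
  by_cases hv : v = 0
  · subst hv
    simp [ht.symm]
  · have := nullSingletonClass_gaussianReal (μ := 0) hv
    exact measure_singleton t

lemma tendsto_measureReal_gt_atTop
    (hT : TendstoInDistribution T atTop id μ (gaussianReal 0 v)) {t : ℕ → ℝ}
    (ht : Tendsto t atTop atTop) :
    Tendsto (fun n => (μ n).real {ω | t n < T n ω}) atTop (𝓝 0) := by
  refine tendsto_order.2 ⟨fun a ha => Eventually.of_forall fun n =>
    lt_of_lt_of_le ha measureReal_nonneg, fun a ha => ?_⟩
  -- A fixed level `K`, eventually below `t n`, where the limiting tail is already smaller than `a`;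
  -- it is positive so as to avoid a possible atom at 0.
  obtain ⟨K, hK0, hK⟩ := ((eventually_gt_atTop (0 : ℝ)).and
    ((tendsto_cdf_atTop (gaussianReal 0 v)).eventually (lt_mem_nhds (by linarith : 1 - a <
      1)))).exists
  have h1 := tendsto_measureReal_gt hT (gaussianReal_singleton_eq_zero hK0.ne' v)
  filter_upwards [h1.eventually (gt_mem_nhds (by linarith : _ < a)),
    ht.eventually_ge_atTop K] with n hn htn
  exact lt_of_le_of_lt (measureReal_mono fun ω (hω : t n < T n ω) => lt_of_le_of_lt htn hω) hn

lemma tendsto_measureReal_gt_atBot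
    (hT : TendstoInDistribution T atTop id μ (gaussianReal 0 v)) {t : ℕ → ℝ}
    (ht : Tendsto t atTop atBot) :
    Tendsto (fun n => (μ n).real {ω | t n < T n ω}) atTop (𝓝 1) := by
  refine tendsto_order.2 ⟨fun a ha => ?_, fun a ha => Eventually.of_forall fun n =>
    lt_of_le_of_lt measureReal_le_one ha⟩
  obtain ⟨K, hK0, hK⟩ := ((eventually_lt_atBot (0 : ℝ)).and
    ((tendsto_cdf_atBot (gaussianReal 0 v)).eventually (gt_mem_nhds (by linarith : 0 < 1 -
      a)))).exists
  have h1 := tendsto_measureReal_gt hT (gaussianReal_singleton_eq_zero hK0.ne v)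
  filter_upwards [h1.eventually (lt_mem_nhds (by linarith : a < _)),
    ht.eventually_le_atBot K] with n hn htn
  exact lt_of_lt_of_le hn (measureReal_mono fun ω (hω : K < T n ω) => lt_of_le_of_lt htn hω)

end Tail

lemma strictMono_cdf_gaussianReal {v : ℝ≥0} (hv : v ≠ 0) : StrictMono (cdf (gaussianReal 0 v)) := by
  intro a b hab
  have hpos : 0 < (gaussianReal 0 v).real (Set.Ioc a b) := by
    refine ENNReal.toReal_pos (fun h0 => ?_) (measure_ne_top _ _)
    have := gaussianReal_absolutelyContinuous' 0 hv h0
    simp at this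
    linarith
  rw [cdf_eq_real, cdf_eq_real, ← Set.Iic_union_Ioc_eq_Iic hab.le,
    measureReal_union (Set.Iic_disjoint_Ioc le_rfl) measurableSet_Ioc]
  linarith

/-- The mass of a point is the left jump of the distribution function there, and a nondegenerate
normal law has no atoms. -/
lemma continuous_cdf_gaussianReal {v : ℝ≥0} (hv : v ≠ 0) : Continuous (cdf (gaussianReal 0 v)) := by
  have := nullSingletonClass_gaussianReal (μ := 0) hv
  refine continuous_iff_continuousAt.2 fun t => ?_
  have h0 : (cdf (gaussianReal 0 v)).measure {t} = 0 :=
      by rw [measure_cdf]; exact measure_singleton t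
  rw [StieltjesFunction.measure_singleton, ENNReal.ofReal_eq_zero] at h0
  refine continuousAt_iff_continuous_left'_right'.2 ⟨?_, ?_⟩
  · refine (monotone_cdf _).continuousWithinAt_Iio_iff_leftLim_eq.2 ?_
    exact le_antisymm ((monotone_cdf _).leftLim_le le_rfl) (by linarith)
  · exact ((cdf (gaussianReal 0 v)).right_continuous t).mono Set.Ioi_subset_Ici_self

lemma cdf_gaussianReal_neg {v : ℝ≥0} (hv : v ≠ 0) (u : ℝ) :
    1 - cdf (gaussianReal 0 v) (-u) = cdf (gaussianReal 0 v) u := by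
  have := nullSingletonClass_gaussianReal (μ := 0) hv
  rw [cdf_eq_real, cdf_eq_real, ← probReal_compl_eq_one_sub measurableSet_Iic, Set.compl_Iic]
  conv_rhs => rw [← neg_zero, ← gaussianReal_map_neg, map_measureReal_apply (by fun_prop)
    measurableSet_Iic]
  have : (fun x : ℝ => -x) ⁻¹' Set.Iic u = Set.Ici (-u) := by ext; simp
  rw [this]
  exact measureReal_congr Ioi_ae_eq_Ici

lemma exists_cdf_gaussianReal_eq {v : ℝ≥0} (hv : v ≠ 0) {γ : ℝ} (h0 : 0 < γ) (h1 : γ < 1) :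
    ∃ q, cdf (gaussianReal 0 v) q = γ := by
  obtain ⟨a, ha⟩ := ((tendsto_cdf_atBot (gaussianReal 0 v)).eventually (gt_mem_nhds h0)).exists
  obtain ⟨b, hb⟩ := ((tendsto_cdf_atTop (gaussianReal 0 v)).eventually (lt_mem_nhds h1)).exists
  exact mem_range_of_exists_le_of_exists_ge (continuous_cdf_gaussianReal hv) ⟨a, ha.le⟩ ⟨b, hb.le⟩

/-- If random tail functions converge almost surely to the tail function of a centered normal law
and `T n` has that law as limit, the tail functions at `-T n` are asymptotically uniform. -/
theorem tendsto_measureReal_tail_gt {Ω : Type*} [MeasurableSpace Ω] {P : Measure Ω}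
    [IsProbabilityMeasure P] {H : ℕ → Ω → ℝ → ℝ} (hanti : ∀ n ω, Antitone (H n ω))
    (hmeas : ∀ n t, Measurable fun ω => H n ω t) {v : ℝ≥0} (hv : v ≠ 0)
    (hlim : ∀ t, ∀ᵐ ω ∂P, Tendsto (fun n => H n ω t) atTop (𝓝 (1 - cdf (gaussianReal 0 v) t)))
    {T : ℕ → Ω → ℝ} (hT : TendstoInDistribution T atTop id (fun _ => P) (gaussianReal 0 v))
    {γ : ℝ} (h0 : 0 < γ) (h1 : γ < 1) :
    Tendsto (fun n => P.real {ω | 1 - γ < H n ω (-T n ω)}) atTop (𝓝 γ) := by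
  have := nullSingletonClass_gaussianReal (μ := 0) hv
  obtain ⟨q, hq⟩ := exists_cdf_gaussianReal_eq hv h0 h1
  have hmono := strictMono_cdf_gaussianReal hv
  have hcont := (continuous_cdf_gaussianReal hv).tendsto q
  rw [hq] at hcont
  have hTail : ∀ u, Tendsto (fun n => P.real {ω | -u < T n ω}) atTop
      (𝓝 (cdf (gaussianReal 0 v) u)) := fun u => by
    rw [← cdf_gaussianReal_neg hv]
    exact tendsto_measureReal_gt hT (measure_singleton _)
  -- Events that almost surely occur only finitely often have probability tending to 0, by dominated
  -- convergence.
  have hnull : ∀ {B : ℕ → Set Ω} (_ : ∀ n, MeasurableSet (B n)) (_ : ∀ᵐ ω ∂P, ∀ᶠ n in atTop,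
      ω ∉ B n),
      Tendsto (fun n => P.real (B n)) atTop (𝓝 0) := fun {B} hB hev => by
    have := tendsto_measure_of_ae_tendsto_indicator_of_isFiniteMeasure (μ := P) atTop
      MeasurableSet.empty hB (by
        filter_upwards [hev] with ω hω
        filter_upwards [hω] with n hn
        simpa using hn)
    rw [measure_empty] at this
    exact (ENNReal.tendsto_toReal ENNReal.zero_ne_top).comp this
  refine tendsto_order.2 ⟨fun a ha => ?_, fun a ha => ?_⟩
  -- For `u < q` the limiting tail at `u` exceeds `1 - γ`. If `-u < T n`, monotonicity places `H` at
  -- `-T n` above `H` at `u`, so the event fails only on a negligible set. Only a deterministic `u`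
  -- is inserted, hence no joint law of `H` and `T` is needed.
  · obtain ⟨u, huq, hu⟩ := (((hcont.mono_left nhdsWithin_le_nhds).eventually
      (lt_mem_nhds ha)).and self_mem_nhdsWithin : ∀ᶠ u in 𝓝[<] q, _ ∧ u ∈ Set.Iio q).exists
    have hB := hnull (B := fun n => {ω | H n ω u ≤ 1 - γ})
      (fun n => measurableSet_le (hmeas n u) measurable_const) (by
        filter_upwards [hlim u] with ω hω
        filter_upwards [hω.eventually (lt_mem_nhds (a := 1 - γ)
          (sub_lt_sub_left (hq ▸ hmono hu) 1))] with n hn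
        exact not_le.2 hn)
    have hl := (hTail u).sub hB
    rw [sub_zero] at hl
    filter_upwards [hl.eventually (lt_mem_nhds huq)] with n hn
    refine lt_of_lt_of_le hn ?_
    rw [sub_le_iff_le_add]
    refine (measureReal_mono (fun ω (hω : -u < T n ω) => ?_) (measure_ne_top _ _)).trans
      (measureReal_union_le _ _)
    by_cases hb : H n ω u ≤ 1 - γ
    · exact Or.inr hb
    · exact Or.inl (lt_of_lt_of_le (not_le.1 hb) (hanti n ω (by linarith)))
  · obtain ⟨u, huq, hu⟩ := (((hcont.mono_left nhdsWithin_le_nhds).eventually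
      (gt_mem_nhds ha)).and self_mem_nhdsWithin : ∀ᶠ u in 𝓝[>] q, _ ∧ u ∈ Set.Ioi q).exists
    have hB := hnull (B := fun n => {ω | 1 - γ < H n ω u})
      (fun n => measurableSet_lt measurable_const (hmeas n u)) (by
        filter_upwards [hlim u] with ω hω
        filter_upwards [hω.eventually (gt_mem_nhds
          (show _ < 1 - γ from sub_lt_sub_left (hq ▸ hmono hu) 1))] with n hn
        exact not_lt.2 hn.le)
    have hl := (hTail u).add hB
    rw [add_zero] at hl
    filter_upwards [hl.eventually (gt_mem_nhds huq)] with n hn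
    refine lt_of_le_of_lt ?_ hn
    refine (measureReal_mono (fun ω (hω : 1 - γ < H n ω (-T n ω)) => ?_) (measure_ne_top _ _)).trans
      (measureReal_union_le _ _)
    by_cases hb : -u < T n ω
    · exact Or.inl hb
    · exact Or.inr (lt_of_lt_of_le hω (hanti n ω (by linarith)))

/-! ### Tails of the weighted rank sum -/

/-- Upper tail of the weighted rank sum, with `d` times the weight of the prior atoms added. -/
noncomputable def weightedTail (s d : ℝ) {n : ℕ} (x y : Fin n → ℝ) (c : ℝ) : ℝ :=
  ((weightLaw s n).prod (weightLaw s n)).real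
    {w | c < weightedRankSum x y w + d * (w.1 0 + w.2 0)}

lemma lowerProb_eq_weightedTail {s : ℝ} (hs : 0 < s) {n : ℕ} (x y : Fin n → ℝ) (c : ℝ) :
    lowerProb s x y c = weightedTail s 0 x y c := by
  rw [lowerProb_eq hs, lowerDist_real_Ioi, weightedTail]
  simp

lemma upperProb_le_weightedTail {s : ℝ} (hs : 0 < s) {n : ℕ} (x y : Fin n → ℝ) (c : ℝ) :
    upperProb s x y c ≤ weightedTail s 1 x y c := by
  simpa [weightedTail] using upperProb_le hs x y c

lemma weightedTail_eq (s d : ℝ) {n : ℕ} (hn : 0 < n) (x y : Fin n → ℝ) (c : ℝ) :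
    weightedTail s d x y c = ((weightLaw s n).prod (weightLaw s n)).real
      {w | √(n : ℝ) * (c - ∫ t, t ∂lowerDist s x y) < √(n : ℝ) *
        (weightedRankSum x y w + d * (w.1 0 + w.2 0) - ∫ t, t ∂lowerDist s x y)} := by
  have : (0 : ℝ) < √(n : ℝ) := Real.sqrt_pos.2 (by exact_mod_cast hn)
  simp only [mul_lt_mul_iff_right₀ this, sub_lt_sub_iff_right]
  rfl

section FixedData

variable {s : ℝ} {x y : ℕ → ℝ} {θ q₁ q₂ : ℝ} {v : ℝ≥0}

/-- The lower distribution is asymptotically normal. -/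
theorem tendstoInDistribution_lowerDist (hs : 0 < s)
    (hθ : Tendsto (fun n => mannWhitney (fun i : Fin n => x i) (fun j : Fin n => y j)) atTop (𝓝 θ))
    (h₁ : Tendsto (fun n : ℕ => (∑ i : Fin n, (∑ j : Fin n, leInd (x i) (y j)) ^ 2) / (n : ℝ) ^ 3)
      atTop (𝓝 q₁))
    (h₂ : Tendsto (fun n : ℕ => (∑ j : Fin n, (∑ i : Fin n, leInd (x i) (y j)) ^ 2) / (n : ℝ) ^ 3)
      atTop (𝓝 q₂)) (hv : (v : ℝ) = q₁ + q₂ - 2 * θ ^ 2) :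
    TendstoInDistribution (fun (n : ℕ) (u : ℝ) => √(n : ℝ) *
        (u - ∫ t, t ∂lowerDist s (fun i : Fin n => x i) (fun j : Fin n => y j)))
      atTop id (fun n => lowerDist s (fun i : Fin n => x i) (fun j : Fin n => y j))
      (gaussianReal 0 v) where
  forall_aemeasurable n := by fun_prop
  tendsto := by
    refine (tendstoInDistribution_weightedRankSum hs hθ h₁ h₂ hv 0).tendsto.congr fun n => ?_
    apply Subtype.ext
    simp only [lowerDist]
    rw [Measure.map_map (by fun_prop) (measurable_weightedRankSum _ _)]
    congr 1
    ext w
    simp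

/-- The tails of the weighted rank sum are consistent. -/
lemma tendsto_weightedTail (hs : 0 < s)
    (hθ : Tendsto (fun n => mannWhitney (fun i : Fin n => x i) (fun j : Fin n => y j)) atTop (𝓝 θ))
    (h₁ : Tendsto (fun n : ℕ => (∑ i : Fin n, (∑ j : Fin n, leInd (x i) (y j)) ^ 2) / (n : ℝ) ^ 3)
      atTop (𝓝 q₁))
    (h₂ : Tendsto (fun n : ℕ => (∑ j : Fin n, (∑ i : Fin n, leInd (x i) (y j)) ^ 2) / (n : ℝ) ^ 3)
      atTop (𝓝 q₂)) (hv : (v : ℝ) = q₁ + q₂ - 2 * θ ^ 2) (d c : ℝ) :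
    (c < θ → Tendsto (fun n => weightedTail s d (fun i : Fin n => x i) (fun j : Fin n => y j) c)
      atTop (𝓝 1)) ∧
    (θ < c → Tendsto (fun n => weightedTail s d (fun i : Fin n => x i) (fun j : Fin n => y j) c)
      atTop (𝓝 0)) := by
  have hT := tendstoInDistribution_weightedRankSum hs hθ h₁ h₂ hv d
  have hm := tendsto_mean (x := fun n (i : Fin n) => x i) (y := fun n (i : Fin n) => y i) hs hθ
  have hsqrt : Tendsto (fun n : ℕ => √(n : ℝ)) atTop atTop :=
    Real.tendsto_sqrt_atTop.comp tendsto_natCast_atTop_atTop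
  have hev := eventually_gt_atTop (0 : ℕ)
  constructor <;> intro hc
  -- The standardized threshold `√n (c - μ_n)` diverges because `c - μ_n` has a nonzero limit.
  · refine (tendsto_measureReal_gt_atBot hT
      (hsqrt.atTop_mul_neg (sub_neg.2 hc) (hm.const_sub c))).congr' ?_
    filter_upwards [hev] with n hn
    exact (weightedTail_eq s d hn _ _ c).symm
  · refine (tendsto_measureReal_gt_atTop hT
      (hsqrt.atTop_mul_pos (sub_pos.2 hc) (hm.const_sub c))).congr' ?_
    filter_upwards [hev] with n hn
    exact (weightedTail_eq s d hn _ _ c).symm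

end FixedData

namespace TwoSample

variable {Ω : Type*} [MeasurableSpace Ω] {P : Measure Ω} {X Y : ℕ → Ω → ℝ}

lemma measurable_sum_leInd (h : TwoSample P X Y) (n : ℕ) :
    Measurable fun ω => ∑ i : Fin n, ∑ j : Fin n, leInd (sample X n ω i) (sample Y n ω j) :=
  Finset.measurable_sum _ fun i _ => Finset.measurable_sum _ fun j _ =>
    measurable_leInd.comp ((h.measurable_left i).prodMk (h.measurable_right j))

lemma measurable_mean (h : TwoSample P X Y) {s : ℝ} (hs : 0 < s) (n : ℕ) :
    Measurable fun ω => ∫ t, t ∂lowerDist s (sample X n ω) (sample Y n ω) := by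
  simp only [integral_lowerDist hs]
  exact (h.measurable_sum_leInd n).div_const _

variable [IsProbabilityMeasure P]

/-- The central limit theorem for the Mann–Whitney statistic. -/
theorem tendstoInDistribution_mannWhitney (h : TwoSample P X Y) {θ : ℝ}
    (hθ : ∫ ω, rowMean P Y leInd (X 0 ω) ∂P = θ)
    {v : ℝ≥0} (hv : (v : ℝ) = ∫ ω, rowMean P Y leInd (X 0 ω) ^ 2 ∂P +
      ∫ ω, rowMean P X (fun b a => leInd a b) (Y 0 ω) ^ 2 ∂P - 2 * θ ^ 2) :
    TendstoInDistribution (fun (n : ℕ) ω => √(n : ℝ) *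
        (mannWhitney (sample X n ω) (sample Y n ω) - θ)) atTop id (fun _ => P)
      (gaussianReal 0 v) := by
  refine (h.tendstoInDistribution_mean measurable_leInd leInd_mem hθ hv).congr
    (fun n => ae_of_all _ fun ω => ?_) (ae_of_all _ fun _ => rfl)
  simp only [Finset.sum_range, mannWhitney, sample]

/-- The tails are centred at the mean of the lower distribution, so the boundary argument needs the
limit law of that mean; it is within `o(1/√n)` of the Mann–Whitney statistic. -/
lemma tendstoInDistribution_mean_lowerDist (h : TwoSample P X Y) {s : ℝ} (hs : 0 < s) {θ : ℝ}
    (hθ : ∫ ω, rowMean P Y leInd (X 0 ω) ∂P = θ)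
    {v : ℝ≥0} (hv : (v : ℝ) = ∫ ω, rowMean P Y leInd (X 0 ω) ^ 2 ∂P +
      ∫ ω, rowMean P X (fun b a => leInd a b) (Y 0 ω) ^ 2 ∂P - 2 * θ ^ 2) :
    TendstoInDistribution (fun (n : ℕ) ω => √(n : ℝ) *
        ((∫ t, t ∂lowerDist s (sample X n ω) (sample Y n ω)) - θ)) atTop id (fun _ => P)
      (gaussianReal 0 v) := by
  have hm := h.measurable_mean hs
  have hU : ∀ n, Measurable fun ω => mannWhitney (sample X n ω) (sample Y n ω) := fun n =>
    (h.measurable_sum_leInd n).div_const _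
  have key := (h.tendstoInDistribution_mannWhitney hθ hv).add_of_tendstoInMeasure_const
    (tendstoInMeasure_const_of_ae (Z := fun (n : ℕ) ω => √(n : ℝ) *
      ((∫ t, t ∂lowerDist s (sample X n ω) (sample Y n ω)) -
        mannWhitney (sample X n ω) (sample Y n ω))) (c := 0)
      (fun n => ((hm n).sub (hU n)).const_mul _)
      (ae_of_all _ fun ω => tendsto_sqrt_mul_mean_sub hs))
    (fun n => (((hm n).sub (hU n)).const_mul _).aemeasurable)
  refine key.congr (fun n => ae_of_all _ fun ω => ?_) (ae_of_all _ fun _ => by simp)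
  simp only [Pi.add_apply]
  ring

/-- At the boundary, the tails of the weighted rank sum are asymptotically uniform. -/
theorem tendsto_measureReal_weightedTail_gt (h : TwoSample P X Y) {s : ℝ} (hs : 0 < s) {θ : ℝ}
    (hθ : ∫ ω, rowMean P Y leInd (X 0 ω) ∂P = θ)
    {v : ℝ≥0} (hv : (v : ℝ) = ∫ ω, rowMean P Y leInd (X 0 ω) ^ 2 ∂P +
      ∫ ω, rowMean P X (fun b a => leInd a b) (Y 0 ω) ^ 2 ∂P - 2 * θ ^ 2) (hv0 : v ≠ 0) (d : ℝ)
    {γ : ℝ} (h0 : 0 < γ) (h1 : γ < 1) :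
    Tendsto (fun n : ℕ => P.real {ω | 1 - γ < weightedTail s d (sample X n ω) (sample Y n ω) θ})
      atTop (𝓝 γ) := by
  have hnull := nullSingletonClass_gaussianReal (μ := 0) hv0
  have hm := h.measurable_mean hs
  let H : ℕ → Ω → ℝ → ℝ := fun n ω t => ((weightLaw s n).prod (weightLaw s n)).real
    {w | t < √(n : ℝ) * (weightedRankSum (sample X n ω) (sample Y n ω) w + d * (w.1 0 + w.2 0) -
      ∫ t, t ∂lowerDist s (sample X n ω) (sample Y n ω))}
  have key := tendsto_measureReal_tail_gt (P := P) (H := H)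
    (fun n ω t t' htt => measureReal_mono fun w hw => lt_of_le_of_lt htt hw)
    (fun n t => by
      have hset : MeasurableSet {z : Ω × ((Fin (n + 1) → ℝ) × (Fin (n + 1) → ℝ)) |
          t < √(n : ℝ) * (weightedRankSum (sample X n z.1) (sample Y n z.1) z.2 +
            d * (z.2.1 0 + z.2.2 0) -
            ∫ t, t ∂lowerDist s (sample X n z.1) (sample Y n z.1))} := by
        have m1 : Measurable fun z : Ω × ((Fin (n + 1) → ℝ) × (Fin (n + 1) → ℝ)) =>
            weightedRankSum (sample X n z.1) (sample Y n z.1) z.2 := by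
          refine Finset.measurable_sum _ fun i _ => Finset.measurable_sum _ fun j _ => ?_
          exact Measurable.mul (by fun_prop) ((measurable_leInd.comp
            ((h.measurable_left i).prodMk (h.measurable_right j))).comp measurable_fst)
        have m2 : Measurable fun z : Ω × ((Fin (n + 1) → ℝ) × (Fin (n + 1) → ℝ)) =>
            ∫ t, t ∂lowerDist s (sample X n z.1) (sample Y n z.1) := (hm n).comp measurable_fst
        exact measurableSet_lt measurable_const
          (((m1.add (by fun_prop)).sub m2).const_mul _)
      exact (measurable_measure_prodMk_left hset).ennreal_toReal)
    hv0 (fun t => by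
      filter_upwards [h.ae_tendsto_mannWhitney hθ] with ω hω
      exact tendsto_measureReal_gt (tendstoInDistribution_weightedRankSum (x := fun i => X i ω)
        (y := fun j => Y j ω) hs hω.1 hω.2.1 hω.2.2 hv d) (measure_singleton t))
    (h.tendstoInDistribution_mean_lowerDist hs hθ hv) h0 h1
  -- Standardizing the threshold `θ` gives `√n (θ - μ_n)`, the negative of the asymptotically normal
  -- variable.
  refine key.congr' ?_
  filter_upwards [eventually_gt_atTop 0] with n hn
  simp only [weightedTail_eq s d hn, H, ← mul_neg, neg_sub]

end TwoSample

/-! ### Assembly -/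

theorem theorem4 {Ω : Type*} [MeasurableSpace Ω] (P : Measure Ω) [IsProbabilityMeasure P]
    (X Y : ℕ → Ω → ℝ) (hX : ∀ i, Measurable (X i)) (hY : ∀ j, Measurable (Y j))
    (hindep : iIndepFun (Sum.elim X Y) P)
    (hXident : ∀ i, IdentDistrib (X i) (X 0) P P) (hYident : ∀ j, IdentDistrib (Y j) (Y 0) P P)
    (s : ℝ) (hs : 0 < s)
    (θ : ℝ) (hθ : θ = P.real {ω | X 0 ω ≤ Y 0 ω})
    (U : ℕ → ℕ → Ω → ℝ) (hU : ∀ i j ω, U i j ω = leInd (X i ω) (Y j ω)) :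
    -- for all data, `lowerDist` is the lower posterior distribution of `P(X ≤ Y)`
    (∀ (n : ℕ) (x y : Fin n → ℝ) (c : ℝ), lowerProb s x y c = (lowerDist s x y).real (Set.Ioi c)) ∧
    ∃ v : ℝ≥0, (v : ℝ) = cov[U 0 0, U 0 1; P] + cov[U 0 0, U 1 0; P] ∧ (0 < θ → θ < 1 → 0 < v) ∧
      -- for almost every data sequence, the lower distribution is asymptotically normal
      (∀ᵐ ω ∂P,
        TendstoInDistribution
          (fun (n : ℕ) (u : ℝ) =>
            √(n : ℝ) * (u - ∫ t, t ∂(lowerDist s (sample X n ω) (sample Y n ω))))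
          atTop id (fun n => lowerDist s (sample X n ω) (sample Y n ω)) (gaussianReal 0 v) ∧
        Tendsto (fun n : ℕ => ∫ t, t ∂(lowerDist s (sample X n ω) (sample Y n ω))) atTop (𝓝 θ) ∧
        Tendsto (fun n : ℕ => (n : ℝ) * Var[id; lowerDist s (sample X n ω) (sample Y n ω)])
          atTop (𝓝 (v : ℝ)) ∧
        Tendsto (fun n : ℕ => √(n : ℝ) *
            ((∫ t, t ∂(lowerDist s (sample X n ω) (sample Y n ω))) -
              mannWhitney (sample X n ω) (sample Y n ω)))
          atTop (𝓝 0)) ∧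
      -- the Mann–Whitney statistic has the same limit in distribution
      TendstoInDistribution
        (fun (n : ℕ) ω => √(n : ℝ) * (mannWhitney (sample X n ω) (sample Y n ω) - θ))
        atTop id (fun _ => P) (gaussianReal 0 v) ∧
      -- consistency of the test of `P(X ≤ Y) ≤ c` against `P(X ≤ Y) > c`
      (∀ᵐ ω ∂P,
        (∀ c < θ,
          Tendsto (fun n : ℕ => lowerProb s (sample X n ω) (sample Y n ω) c) atTop (𝓝 1) ∧
          Tendsto (fun n : ℕ => upperProb s (sample X n ω) (sample Y n ω) c) atTop (𝓝 1)) ∧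
        (∀ c > θ,
          Tendsto (fun n : ℕ => lowerProb s (sample X n ω) (sample Y n ω) c) atTop (𝓝 0) ∧
          Tendsto (fun n : ℕ => upperProb s (sample X n ω) (sample Y n ω) c) atTop (𝓝 0))) ∧
      (0 < θ → θ < 1 → ∀ γ : ℝ, 0 < γ → γ < 1 →
        Tendsto (fun n : ℕ => P.real {ω | 1 - γ < lowerProb s (sample X n ω) (sample Y n ω) θ})
          atTop (𝓝 γ) ∧
        Tendsto (fun n : ℕ => P.real {ω | 1 - γ < upperProb s (sample X n ω) (sample Y n ω) θ})
          atTop (𝓝 γ)) := by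
  have h : TwoSample P X Y := ⟨hX, hY, hindep, hXident, hYident⟩
  have hκ : ∫ ω, rowMean P Y leInd (X 0 ω) ∂P = θ := by
    rw [← h.integral_kernel_pair measurable_leInd abs_leInd_le, hθ,
      ← integral_indicator_one (measurableSet_le (hX 0) (hY 0))]
    refine integral_congr_ae (ae_of_all _ fun ω => ?_)
    simp only [leInd_eq_ite, Set.indicator_apply, Set.mem_ofPred_eq, Pi.one_apply]
  obtain ⟨hnonneg, hpos⟩ := h.asymptotic_variance hκ
  obtain ⟨c₁, c₂⟩ := h.cov_eq hκ
  obtain rfl : U = fun i j ω => leInd (X i ω) (Y j ω) := by ext i j ω; exact hU i j ω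
  -- Taking `v` in `ℝ≥0` is what records `σ² ≥ 0`.
  obtain ⟨v, hv⟩ : ∃ v : ℝ≥0, (v : ℝ) = ∫ ω, rowMean P Y leInd (X 0 ω) ^ 2 ∂P +
      ∫ ω, rowMean P X (fun b a => leInd a b) (Y 0 ω) ^ 2 ∂P - 2 * θ ^ 2 :=
    ⟨⟨_, hnonneg⟩, rfl⟩
  rw [← hv] at hpos
  refine ⟨fun n x y c => lowerProb_eq hs x y c, v, ?_, fun p₀ p₁ => hpos p₀ p₁, ?_,
    h.tendstoInDistribution_mannWhitney hκ hv, ?_, fun p₀ p₁ γ hγ₀ hγ₁ => ?_⟩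
  · rw [hv, c₁, c₂]
    ring
  · filter_upwards [h.ae_tendsto_mannWhitney hκ] with ω ⟨hω, h₁, h₂⟩
    exact ⟨tendstoInDistribution_lowerDist (x := fun i => X i ω) (y := fun j => Y j ω)
        hs hω h₁ h₂ hv,
      tendsto_mean hs hω, hv ▸ tendsto_natCast_mul_variance hs hω h₁ h₂,
        tendsto_sqrt_mul_mean_sub hs⟩
  · filter_upwards [h.ae_tendsto_mannWhitney hκ] with ω ⟨hω, h₁, h₂⟩
    have hl := fun c => tendsto_weightedTail (x := fun i => X i ω) (y := fun j => Y j ω)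
      hs hω h₁ h₂ hv 0 c
    have hu := fun c => tendsto_weightedTail (x := fun i => X i ω) (y := fun j => Y j ω)
      hs hω h₁ h₂ hv 1 c
    have hlow : ∀ (n : ℕ) (c : ℝ), weightedTail s 0 (sample X n ω) (sample Y n ω) c =
      lowerProb s (sample X n ω) (sample Y n ω) c := fun n c =>
        (lowerProb_eq_weightedTail hs _ _ c).symm
    have hl1 : ∀ c < θ, Tendsto (fun n : ℕ => lowerProb s (sample X n ω) (sample Y n ω) c) atTop
        (𝓝 1) := fun c hc => ((hl c).1 hc).congr fun n => hlow n c
    have hl0 : ∀ c > θ, Tendsto (fun n : ℕ => lowerProb s (sample X n ω) (sample Y n ω) c) atTop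
        (𝓝 0) := fun c hc => ((hl c).2 hc).congr fun n => hlow n c
    exact ⟨fun c hc => ⟨hl1 c hc, tendsto_of_tendsto_of_tendsto_of_le_of_le (hl1 c hc)
        ((hu c).1 hc) (fun n => lowerProb_le_upperProb hs _ _ c)
        fun n => upperProb_le_weightedTail hs _ _ c⟩,
      fun c hc => ⟨hl0 c hc, tendsto_of_tendsto_of_tendsto_of_le_of_le (hl0 c hc)
        ((hu c).2 hc) (fun n => lowerProb_le_upperProb hs _ _ c)
        fun n => upperProb_le_weightedTail hs _ _ c⟩⟩
  · have hv0 : v ≠ 0 := fun h0 => (hpos p₀ p₁).ne' (by simp [h0])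
    have hl := h.tendsto_measureReal_weightedTail_gt hs hκ hv hv0 0 hγ₀ hγ₁
    have hu := h.tendsto_measureReal_weightedTail_gt hs hκ hv hv0 1 hγ₀ hγ₁
    simp only [← lowerProb_eq_weightedTail hs] at hl
    -- The upper probability is squeezed between the tails for `d = 0` and `d = 1`; monotonicity of
    -- the measure requires no measurability of its event.
    exact ⟨hl, tendsto_of_tendsto_of_tendsto_of_le_of_le hl hu
      (fun n => measureReal_mono fun ω hω => lt_of_lt_of_le hω (lowerProb_le_upperProb hs _ _ θ))
      fun n => measureReal_mono fun ω hω => lt_of_lt_of_le hω (upperProb_le_weightedTail hs _ _ θ)⟩
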